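/- **Setting.** Let $N\ge 1$, $M\ge 0$, $\mathcal I=\{1,\dots,N\}$, $\mathcal J=\{1,\dots,M\}$, and let $H\in\mathbb F_2^{M\times N}$ be a parity-check matrix, with $\mathcal N(j)=\{i: H_{ji}\neq0\}$, $\mathcal N(i)=\{j:H_{ji}\ne 0\}$ and $\mathcal E_j=\{\mathcal B\subseteq\mathcal N(j): |\mathcal B|\text{ even}\}$; assume that no row of $H$ has weight exactly $1$. Consider a length-$N$ trellis of a binary-input finite-state channel: a finite state set $\mathcal S$, finite edge sets $\mathcal T_1,\dots,\mathcal T_N$, each edge $e$ having an initial state $s(e)$, a final state $s'(e)$ and an input bit $x(e)\in\{0,1\}$, and real branch metrics $b_{i,e}$ ($e\in\mathcal T_i$; edges of infinite metric are left out of $\mathcal T_i$). Assume that every input sequence in $\{0,1\}^N$ labels at least one trellis path. *Problem-P:* minimize $c(\mathbf g)=\sum_i\sum_{e\in\mathcal T_i}b_{i,e}g_{i,e}$ over $\mathbf g,\mathbf w\ge0$ subject to $\sum_{\mathcal B\in\mathcal E_j}w_{j,\mathcal B}=1$ for all $j$; $\sum_{e\in\mathcal T_p}g_{p,e}=1$ for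 all $p$; $\sum_{\mathcal B\in\mathcal E_j,\mathcal B\ni i}w_{j,\mathcal B}=\sum_{e\in\mathcal T_i:x(e)=1}g_{i,e}$ for all $i$ and $j\in\mathcal N(i)$; and $\sum_{e\in\mathcal T_i:s'(e)=k}g_{i,e}=\sum_{e\in\mathcal T_{i+1}:s(e)=k}g_{i+1,e}$ for all $i<N$, $k\in\mathcal S$. Its minimum is $P^*$. *Problem-DS* (for $K_1,K_2>0$ and $p\in\mathcal I$): maximize over $\mathbf m=(m_{i,j})$ $$-\frac1{K_1}\sum_j\ln\sum_{\mathcal B\in\mathcal E_j}e^{-K_1\sum_{i\in\mathcal B}m_{i,j}}-\frac1{K_2}\ln\sum_{e\in\mathcal T_p}e^{-K_2\{\Gamma_{p,e}-\overrightarrow n_{p-1,s(e)}+\overleftarrow n_{p,s'(e)}\}},$$ where $\Gamma_{i,e}=b_{i,e}-\delta_{x(e)=1}\sum_{j\in\mathcal N(i)}m_{i,j}$, $\overrightarrow n_{0,k}=\overleftarrow n_{N,k}=0$, $e^{K_2\overrightarrow n_{i,k}}=\sum_{e\in\mathcal T_i:s'(e)=k}e^{-K_2\{\Gamma_{i,e}-\overrightarrow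 n_{i-1,s(e)}\}}$ and $e^{-K_2\overleftarrow n_{i,k}}=\sum_{e\in\mathcal T_{i+1}:s(e)=k}e^{-K_2\{\Gamma_{i+1,e}+\overleftarrow n_{i+1,s'(e)}\}}$ (an empty sum is $0=e^{-\infty}$). *Problem-PS:* minimize $c(\mathbf g)-\frac1{K_1}\sum_jH(w_j)-\frac1{K_2}H_{\mathcal T}(\mathbf g)$ subject to the constraints of Problem-P, where $H(x)=-\sum_ix_i\ln x_i$ and $H_{\mathcal T}(\mathbf g)=\sum_{i=1}^NH(g_i)-\sum_{i=1}^{N-1}H(\sigma_i)$, $\sigma_i(k)=\sum_{e\in\mathcal T_i:s'(e)=k}g_{i,e}$, is the entropy of the trellis flow. *Problem-PS$_p$* is the same problem with $H_{\mathcal T}(\mathbf g)$ replaced by the single-section entropy $H(g_p)$. *Modified Algorithm 1.* Start from $\mathbf m=0$. One iteration treats $p=1,\dots,N$ in turn: with $\lambda_{i,e}=e^{-K_2\Gamma_{i,e}}$ computed from the current $\mathbf m$, let $\alpha_0=\beta_N\equiv1/|\mathcal S|$, $\alpha_i(k)\propto\sum_{e\in\mathcal T_i:s'(e)=k}\alpha_{i-1}(s(e))\lambda_{i,e}$,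 $\beta_{i-1}(k)\propto\sum_{e\in\mathcal T_i:s(e)=k}\beta_i(s'(e))\lambda_{i,e}$ (normalized over $k$), $$\gamma_p=\ln\frac{\sum_{e\in\mathcal T_p:x(e)=0}\alpha_{p-1}(s(e))\lambda_{p,e}\beta_p(s'(e))}{\sum_{e\in\mathcal T_p:x(e)=1}\alpha_{p-1}(s(e))\lambda_{p,e}\beta_p(s'(e))},$$ and replace $m_{p,j}$, for all $j\in\mathcal N(p)$, by $\frac1{K_1}\ln\frac{1-l_{p,j}}{1+l_{p,j}}+\frac{\gamma_p}{K_1}$, where $l_{p,j}=\prod_{r\in\mathcal N(j)\setminus p}\tanh(K_1m_{r,j}/2)$. Let $\mathbf m^{(\ell)}$ be the messages after $\ell$ iterations, and let $g^{(\ell)}_{i,e}\propto\alpha_{i-1}(s(e))\lambda_{i,e}\beta_i(s'(e))$ (normalized over $e\in\mathcal T_i$) and $w^{(\ell)}_{j,\mathcal B}\propto e^{-K_1\sum_{i\in\mathcal B}m_{i,j}}$ (normalized over $\mathcal B\in\mathcal E_j$) be computed from $\mathbf m^{(\ell)}$. **Theorem.** The minimum $P^*$ is attained. For every $\delta>0$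 there is $K_0>0$ such that for all $K_1,K_2\ge K_0$: 1. Problem-PS has a unique optimal solution $(\tilde{\mathbf g},\tilde{\mathbf w})$; it is feasible for Problem-P, and the minimum $P_S$ of Problem-PS equals the maximum of Problem-DS, which is attained, for every $p$. 2. With $\tilde P=c(\tilde{\mathbf g})$ the value of $\tilde{\mathbf g}$ in Problem-P, $\;0\le(\tilde P-P^*)/N\le\delta$. Moreover $0\le(P^*-P_S)/N\le\delta$. 3. If $|\mathcal N(i)|\,K_2<K_1$ for all $i$, then the modified Algorithm 1 converges and yields $\tilde{\mathbf g}$: as $\ell\to\infty$, the value of Problem-DS at $\mathbf m^{(\ell)}$ tends to its maximum, $\mathbf g^{(\ell)}\to\tilde{\mathbf g}$ and $\mathbf w^{(\ell)}\to\tilde{\mathbf w}$. If moreover no row of $H$ has weight $2$, then $\mathbf m^{(\ell)}$ converges to a maximizer of Problem-DS, and for all sufficiently large $\ell$ the vector $\mathbf g^{(\ell)}$ is itself feasible for Problem-P (together with some $\mathbf w$) and satisfies $0\le(c(\mathbf g^{(\ell)})-P^*)/N\le\delta$. 4. For every $p$, Problem-PS$_p$ has a minimum $P_p$ with $0\le(P^*-P_p)/N\le\delta$,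 and each of its optimal solutions $(\mathbf g,\mathbf w)$ satisfies $0\le(c(\mathbf g)-P^*)/N\le\delta$. -/

import Mathlib

open Filter Topology

noncomputable section

/-- Data of the joint decoding problem for a code of length `N` with `M` parity checks and the
length-`N` trellis of a binary-input finite-state channel with states `S` and edge labels `E`.
Only edges in `sec i` belong to the `i`-th trellis section, so edges of infinite cost
(probability zero, or a forbidden initial state) are simply left out of the section. -/
structure JointDecoding (N M : ℕ) (S E : Type*) where
  /-- parity-check matrix -/
  H : Matrix (Fin M) (Fin N) (ZMod 2)
  /-- the edges of each trellis section -/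
  sec : Fin N → Finset E
  /-- initial state of an edge -/
  src : E → S
  /-- final state of an edge -/
  dst : E → S
  /-- input bit of an edge (`true` is 1) -/
  inp : E → Bool
  /-- branch metric -/
  b : Fin N → E → ℝ

namespace JointDecoding

variable {N M : ℕ} {S E : Type*} [Fintype S] [DecidableEq S]

/-- The variable nodes adjacent to check `j`. -/
def checkNbr (D : JointDecoding N M S E) (j : Fin M) : Finset (Fin N) :=
  Finset.univ.filter fun i => D.H j i ≠ 0

/-- The check nodes adjacent to bit `i`. -/
def bitNbr (D : JointDecoding N M S E) (i : Fin N) : Finset (Fin M) :=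
  Finset.univ.filter fun j => D.H j i ≠ 0

/-- The valid local patterns of check `j`: subsets of its neighbourhood of even size. -/
def patterns (D : JointDecoding N M S E) (j : Fin M) : Finset (Finset (Fin N)) :=
  (D.checkNbr j).powerset.filter fun B => Even B.card

/-- A trellis path: one edge from each section, consecutive edges sharing a state. -/
def IsPath (D : JointDecoding N M S E) (ε : Fin N → E) : Prop :=
  (∀ i, ε i ∈ D.sec i) ∧
    ∀ (i : ℕ) (h : i + 1 < N), D.dst (ε ⟨i, Nat.lt_of_succ_lt h⟩) = D.src (ε ⟨i + 1, h⟩)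

/-- The channel can be driven by every binary input sequence. -/
def AcceptsAllInputs (D : JointDecoding N M S E) : Prop :=
  ∀ u : Fin N → Bool, ∃ ε : Fin N → E, D.IsPath ε ∧ ∀ i, D.inp (ε i) = u i

/-! ### The primal problems -/

/-- The feasible pairs `(g, w)` of Problem-P. The variables are `g i e` for `e ∈ sec i` and
`w j B` for `B ∈ patterns j`; all the other entries of the two arrays are fixed to be zero. -/
structure Feasible (D : JointDecoding N M S E)
    (x : (Fin N → E → ℝ) × (Fin M → Finset (Fin N) → ℝ)) : Prop where
  w_sum : ∀ j, ∑ B ∈ D.patterns j, x.2 j B = 1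
  g_sum : ∀ p, ∑ e ∈ D.sec p, x.1 p e = 1
  coupling : ∀ i, ∀ j ∈ D.bitNbr i,
    ∑ B ∈ D.patterns j with i ∈ B, x.2 j B = ∑ e ∈ D.sec i with D.inp e = true, x.1 i e
  flow : ∀ (i : ℕ) (h : i + 1 < N) (k : S),
    ∑ e ∈ D.sec ⟨i, Nat.lt_of_succ_lt h⟩ with D.dst e = k, x.1 ⟨i, Nat.lt_of_succ_lt h⟩ e =
      ∑ e ∈ D.sec ⟨i + 1, h⟩ with D.src e = k, x.1 ⟨i + 1, h⟩ e
  w_nonneg : ∀ j, ∀ B ∈ D.patterns j, 0 ≤ x.2 j B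
  g_nonneg : ∀ i, ∀ e ∈ D.sec i, 0 ≤ x.1 i e
  w_off : ∀ j, ∀ B, B ∉ D.patterns j → x.2 j B = 0
  g_off : ∀ i, ∀ e, e ∉ D.sec i → x.1 i e = 0

/-- The feasible set of Problem-P. -/
def feasibleSet (D : JointDecoding N M S E) :
    Set ((Fin N → E → ℝ) × (Fin M → Finset (Fin N) → ℝ)) :=
  {x | D.Feasible x}

/-- The objective of Problem-P. -/
def cost (D : JointDecoding N M S E) (g : Fin N → E → ℝ) : ℝ :=
  ∑ i, ∑ e ∈ D.sec i, D.b i e * g i e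

/-- The entropy of the local distribution `w j`. -/
def checkEntropy (D : JointDecoding N M S E) (w : Fin M → Finset (Fin N) → ℝ) (j : Fin M) : ℝ :=
  ∑ B ∈ D.patterns j, Real.negMulLog (w j B)

/-- The entropy of the edge distribution `g p` of one section. -/
def sectionEntropy (D : JointDecoding N M S E) (g : Fin N → E → ℝ) (p : Fin N) : ℝ :=
  ∑ e ∈ D.sec p, Real.negMulLog (g p e)

/-- The entropy of the state distribution at the end of section `i`. -/
def stateEntropy (D : JointDecoding N M S E) (g : Fin N → E → ℝ) (i : Fin N) : ℝ :=
  ∑ k : S, Real.negMulLog (∑ e ∈ D.sec i with D.dst e = k, g i e)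

/-- The entropy of the trellis flow `g`, that is, of the Markov chain of edges with marginals `g`:
`∑_i H(g_i) - ∑_{i < N} H(σ_i)`, with `σ_i` the state distribution between sections `i` and `i+1`.
For every section `p` it is `H(g_p)` plus the conditional entropies of the edges of the sections
before `p` given their final state and of those after `p` given their initial state. -/
def trellisEntropy (D : JointDecoding N M S E) (g : Fin N → E → ℝ) : ℝ :=
  ∑ i, D.sectionEntropy g i -
    ∑ i ∈ Finset.univ.filter (fun i : Fin N => (i : ℕ) + 1 < N), D.stateEntropy g i

/-- The objective of Problem-PS, in the form that is the Lagrangian dual of Problem-DS. -/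
def psObj (D : JointDecoding N M S E) (K₁ K₂ : ℝ)
    (x : (Fin N → E → ℝ) × (Fin M → Finset (Fin N) → ℝ)) : ℝ :=
  D.cost x.1 - 1 / K₁ * ∑ j, D.checkEntropy x.2 j - 1 / K₂ * D.trellisEntropy x.1

/-- The objective of the variant of Problem-PS that keeps, of the trellis entropy, only the
entropy of section `p`. -/
def psObjAt (D : JointDecoding N M S E) (K₁ K₂ : ℝ) (p : Fin N)
    (x : (Fin N → E → ℝ) × (Fin M → Finset (Fin N) → ℝ)) : ℝ :=
  D.cost x.1 - 1 / K₁ * ∑ j, D.checkEntropy x.2 j - 1 / K₂ * D.sectionEntropy x.1 p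

/-! ### The soft-min dual problem -/

/-- `Γ_{i,e} = b_{i,e} - δ_{x(e)=1} ∑_{j ∈ N(i)} m_{i,j}`. -/
def Gam (D : JointDecoding N M S E) (m : Fin N → Fin M → ℝ) (i : Fin N) (e : E) : ℝ :=
  D.b i e - if D.inp e = true then ∑ j ∈ D.bitNbr i, m i j else 0

/-- `λ_{i,e} = exp(-K₂ Γ_{i,e})`. -/
def lam (D : JointDecoding N M S E) (K₂ : ℝ) (m : Fin N → Fin M → ℝ) (i : Fin N) (e : E) : ℝ :=
  Real.exp (-K₂ * D.Gam m i e)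

/-- The forward soft-min recursion in exponential form: with `n⃗` the forward variable of
Problem-DS, `fwd i k = exp(K₂ n⃗_{i,k})`; it is zero (`n⃗_{i,k} = -∞`) at unreachable states. -/
def fwd (D : JointDecoding N M S E) (K₂ : ℝ) (m : Fin N → Fin M → ℝ) : ℕ → S → ℝ
  | 0, _ => 1
  | i + 1, k =>
    if h : i < N then
      ∑ e ∈ D.sec ⟨i, h⟩ with D.dst e = k, fwd D K₂ m i (D.src e) * D.lam K₂ m ⟨i, h⟩ e
    else 0

/-- The backward soft-min recursion in exponential form, by the number `r` of sections to the end: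
with `n⃖` the backward variable of Problem-DS, `bwdRev r k = exp(-K₂ n⃖_{N-r,k})`. -/
def bwdRev (D : JointDecoding N M S E) (K₂ : ℝ) (m : Fin N → Fin M → ℝ) : ℕ → S → ℝ
  | 0, _ => 1
  | r + 1, k =>
    if h : r < N then
      ∑ e ∈ D.sec ⟨N - 1 - r, by omega⟩ with D.src e = k,
        bwdRev D K₂ m r (D.dst e) * D.lam K₂ m ⟨N - 1 - r, by omega⟩ e
    else 0

/-- `bwd i k = exp(-K₂ n⃖_{i,k})`. -/
def bwd (D : JointDecoding N M S E) (K₂ : ℝ) (m : Fin N → Fin M → ℝ) (i : ℕ) : S → ℝ :=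
  D.bwdRev K₂ m (N - i)

/-- The objective of Problem-DS, written at section `p`. (Sections are numbered from zero, so
section `p` runs from the vertices of time `p` to those of time `p + 1`.) -/
def dsObj (D : JointDecoding N M S E) (K₁ K₂ : ℝ) (p : Fin N) (m : Fin N → Fin M → ℝ) : ℝ :=
  -(1 / K₁) * ∑ j, Real.log (∑ B ∈ D.patterns j,
      Real.exp (-K₁ * ∑ i ∈ D.checkNbr j, if i ∈ B then m i j else 0))
    - 1 / K₂ * Real.log (∑ e ∈ D.sec p,
      D.fwd K₂ m p (D.src e) * D.lam K₂ m p e * D.bwd K₂ m (p + 1) (D.dst e))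

/-! ### The algorithm with the cyclic schedule -/

/-- Normalized forward (BCJR) messages. -/
def alpha (D : JointDecoding N M S E) (K₂ : ℝ) (m : Fin N → Fin M → ℝ) : ℕ → S → ℝ
  | 0, _ => 1 / (Fintype.card S : ℝ)
  | i + 1, k =>
    if h : i < N then
      (∑ e ∈ D.sec ⟨i, h⟩ with D.dst e = k, alpha D K₂ m i (D.src e) * D.lam K₂ m ⟨i, h⟩ e) /
        ∑ k' : S, ∑ e ∈ D.sec ⟨i, h⟩ with D.dst e = k',
          alpha D K₂ m i (D.src e) * D.lam K₂ m ⟨i, h⟩ e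
    else 0

/-- Normalized backward (BCJR) messages, by the number of sections to the end. -/
def betaRev (D : JointDecoding N M S E) (K₂ : ℝ) (m : Fin N → Fin M → ℝ) : ℕ → S → ℝ
  | 0, _ => 1 / (Fintype.card S : ℝ)
  | r + 1, k =>
    if h : r < N then
      (∑ e ∈ D.sec ⟨N - 1 - r, by omega⟩ with D.src e = k,
        betaRev D K₂ m r (D.dst e) * D.lam K₂ m ⟨N - 1 - r, by omega⟩ e) /
        ∑ k' : S, ∑ e ∈ D.sec ⟨N - 1 - r, by omega⟩ with D.src e = k',
          betaRev D K₂ m r (D.dst e) * D.lam K₂ m ⟨N - 1 - r, by omega⟩ e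
    else 0

/-- Normalized backward (BCJR) messages. -/
def beta (D : JointDecoding N M S E) (K₂ : ℝ) (m : Fin N → Fin M → ℝ) (i : ℕ) : S → ℝ :=
  D.betaRev K₂ m (N - i)

/-- The unnormalized BCJR belief of an edge. -/
def edgeWeight (D : JointDecoding N M S E) (K₂ : ℝ) (m : Fin N → Fin M → ℝ)
    (i : Fin N) (e : E) : ℝ :=
  D.alpha K₂ m i (D.src e) * D.lam K₂ m i e * D.beta K₂ m (i + 1) (D.dst e)

/-- The trellis-to-bit message. -/
def gam (D : JointDecoding N M S E) (K₂ : ℝ) (m : Fin N → Fin M → ℝ) (i : Fin N) : ℝ :=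
  Real.log ((∑ e ∈ D.sec i with D.inp e = false, D.edgeWeight K₂ m i e) /
    ∑ e ∈ D.sec i with D.inp e = true, D.edgeWeight K₂ m i e)

/-- The product of hyperbolic tangents in the check-to-bit message. -/
def ell (D : JointDecoding N M S E) (K₁ : ℝ) (m : Fin N → Fin M → ℝ) (i : Fin N) (j : Fin M) : ℝ :=
  ∏ r ∈ (D.checkNbr j).erase i, Real.tanh (K₁ * m r j / 2)

/-- The check-to-bit message. -/
def checkMsg (D : JointDecoding N M S E) (K₁ : ℝ) (m : Fin N → Fin M → ℝ)
    (i : Fin N) (j : Fin M) : ℝ :=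
  1 / K₁ * Real.log ((1 - D.ell K₁ m i j) / (1 + D.ell K₁ m i j))

/-- One update of the cyclic schedule: compute the trellis-to-bit message of bit `p` from the
current messages, then replace `m p j` for the checks `j` adjacent to `p`. -/
def bitUpdate (D : JointDecoding N M S E) (K₁ K₂ : ℝ) (p : Fin N) (m : Fin N → Fin M → ℝ) :
    Fin N → Fin M → ℝ :=
  fun i j => if i = p ∧ j ∈ D.bitNbr p then D.checkMsg K₁ m p j + D.gam K₂ m p / K₁ else m i j

/-- One iteration: update the bits in cyclic order, each from the messages left by its
predecessor. -/
def sweep (D : JointDecoding N M S E) (K₁ K₂ : ℝ) (m : Fin N → Fin M → ℝ) : Fin N → Fin M → ℝ :=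
  (List.finRange N).foldl (fun m' p => D.bitUpdate K₁ K₂ p m') m

/-- The messages after `l` iterations, started from `m = 0`. -/
def iter (D : JointDecoding N M S E) (K₁ K₂ : ℝ) (l : ℕ) : Fin N → Fin M → ℝ :=
  (D.sweep K₁ K₂)^[l] 0

open Classical in
/-- The primal edge variables obtained from messages `m`: the normalized BCJR edge beliefs. -/
def gOf (D : JointDecoding N M S E) (K₂ : ℝ) (m : Fin N → Fin M → ℝ) (i : Fin N) (e : E) : ℝ :=
  if e ∈ D.sec i then D.edgeWeight K₂ m i e / ∑ e' ∈ D.sec i, D.edgeWeight K₂ m i e' else 0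

/-- The primal pattern variables obtained from messages `m`: the local beliefs of the checks. -/
def wOf (D : JointDecoding N M S E) (K₁ : ℝ) (m : Fin N → Fin M → ℝ)
    (j : Fin M) (B : Finset (Fin N)) : ℝ :=
  if B ∈ D.patterns j then
    Real.exp (-K₁ * ∑ i ∈ B, m i j) / ∑ B' ∈ D.patterns j, Real.exp (-K₁ * ∑ i ∈ B', m i j)
  else 0

end JointDecoding

end

/-!
Problem-DS is the Lagrange dual of Problem-PS. The trellis term of the dual does not depend on the
section `p`, because the forward-backward recursions compute the total weight of all trellis paths.
Gibbs' inequality, applied to the patterns of every check and to the Markov chain of trellis edges,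
bounds the dual by the primal objective, with equality exactly when the primal point consists of
the beliefs `gOf`, `wOf` of the messages. At a stationary point of the dual the check and trellis
beliefs have the same bit marginals, so they form the unique primal optimum.

A bit update of the algorithm is a damped ascent step in the block of messages at that bit: it
increases the dual when `|N(i)| K₂ < K₁`, strictly unless the block is stationary. The messages may
be unbounded, but the dual and the beliefs depend on them only through natural parameters, which
stay bounded on superlevel sets of the dual. Compactness there yields a stationary point and, by
the strict increase, convergence of the beliefs along the iteration.

The entropies are bounded independently of `K₁` and `K₂`, so for large parameters the smoothed
objectives are uniformly close to the cost. If every check has degree at least three, all vectors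
of marginals near a strictly positive `w` are again realised by weights on the even patterns, which
makes the late iterates feasible, and each message is recovered from the `wOf` of its check.
-/

/-! ### Entropy and convexity inequalities -/

theorem negMulLog_add_mul_log_eq {a q : ℝ} (h : q = 0 → a = 0) :
    Real.negMulLog a + a * Real.log q = q - a - q * InformationTheory.klFun (a / q) := by
  rcases eq_or_ne q 0 with rfl | hq
  · simp [h rfl]
  rcases eq_or_ne a 0 with rfl | ha
  · simp [InformationTheory.klFun_zero]
  rw [InformationTheory.klFun_apply, Real.negMulLog, Real.log_div ha hq]
  field_simp
  ring

/-- The gap in the log-sum inequality is the relative entropy of `a` with respect to the multiple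
of `c` of the same total mass. -/
theorem sum_negMulLog_add_mul_log_eq {ι : Type*} {s : Finset ι} {a c : ι → ℝ}
    (ha : ∀ e ∈ s, 0 ≤ a e) (hc : ∀ e ∈ s, 0 ≤ c e) (h0 : ∀ e ∈ s, c e = 0 → a e = 0) :
    ∑ e ∈ s, (Real.negMulLog (a e) + a e * Real.log (c e)) =
      Real.negMulLog (∑ e ∈ s, a e) + (∑ e ∈ s, a e) * Real.log (∑ e ∈ s, c e) -
        ∑ e ∈ s, (∑ e ∈ s, a e) * c e / (∑ e ∈ s, c e) *
          InformationTheory.klFun (a e / ((∑ e ∈ s, a e) * c e / ∑ e ∈ s, c e)) := by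
  set A := ∑ e ∈ s, a e with hA
  set C := ∑ e ∈ s, c e with hC
  rcases (Finset.sum_nonneg ha).eq_or_lt' with hA0 | hApos
  · have ha0 : ∀ e ∈ s, a e = 0 := (Finset.sum_eq_zero_iff_of_nonneg ha).1 hA0
    rw [Finset.sum_congr rfl fun e he => by rw [ha0 e he]]
    simp [A, hA0]
  replace hApos : 0 < A := hApos
  have hCpos : 0 < C := by
    obtain ⟨e, he, hpos⟩ := (Finset.sum_pos_iff_of_nonneg ha).1 hApos
    exact (Finset.sum_pos_iff_of_nonneg hc).2
      ⟨e, he, (hc e he).lt_of_ne' fun h => hpos.ne' (h0 e he h)⟩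
  have hterm : ∀ e ∈ s, Real.negMulLog (a e) + a e * Real.log (c e) =
      A * c e / C - a e - A * c e / C * InformationTheory.klFun (a e / (A * c e / C)) -
        a e * (Real.log A - Real.log C) := by
    intro e he
    by_cases hce : c e = 0
    · simp [h0 e he hce, hce]
    · rw [← negMulLog_add_mul_log_eq fun h => absurd h (by positivity),
        Real.log_div (by positivity) hCpos.ne', Real.log_mul hApos.ne' hce]
      ring
  have hmass : ∑ e ∈ s, A * c e / C = A := by
    rw [← Finset.sum_div, ← Finset.mul_sum, ← hC, mul_div_cancel_right₀ _ hCpos.ne']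
  rw [Finset.sum_congr rfl hterm, Finset.sum_sub_distrib, Finset.sum_sub_distrib,
    Finset.sum_sub_distrib, hmass, ← Finset.sum_mul, ← hA, Real.negMulLog]
  ring

section LogSum

variable {ι : Type*} {s : Finset ι} {a c : ι → ℝ}

theorem mul_klFun_nonneg {q x : ℝ} (hq : 0 ≤ q) (hx : 0 ≤ x) :
    0 ≤ q * InformationTheory.klFun (x / q) :=
  mul_nonneg hq (InformationTheory.klFun_nonneg (div_nonneg hx hq))

theorem mul_klFun_eq_zero_iff {q x : ℝ} (hq : 0 ≤ q) (hx : 0 ≤ x) (h : q = 0 → x = 0) :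
    q * InformationTheory.klFun (x / q) = 0 ↔ x = q := by
  rcases eq_or_ne q 0 with rfl | hq0
  · simp [h rfl]
  · rw [mul_eq_zero, InformationTheory.klFun_eq_zero_iff (div_nonneg hx hq), div_eq_one_iff_eq hq0,
      or_iff_right hq0]

theorem sum_negMulLog_add_mul_log_le
    (ha : ∀ e ∈ s, 0 ≤ a e) (hc : ∀ e ∈ s, 0 ≤ c e) (h0 : ∀ e ∈ s, c e = 0 → a e = 0) :
    ∑ e ∈ s, (Real.negMulLog (a e) + a e * Real.log (c e)) ≤
      Real.negMulLog (∑ e ∈ s, a e) + (∑ e ∈ s, a e) * Real.log (∑ e ∈ s, c e) := by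
  rw [sum_negMulLog_add_mul_log_eq ha hc h0]
  exact sub_le_self _ (Finset.sum_nonneg fun e he => mul_klFun_nonneg
    (div_nonneg (mul_nonneg (Finset.sum_nonneg ha) (hc e he)) (Finset.sum_nonneg hc)) (ha e he))

theorem sum_negMulLog_add_mul_log_eq_iff
    (ha : ∀ e ∈ s, 0 ≤ a e) (hc : ∀ e ∈ s, 0 ≤ c e) (h0 : ∀ e ∈ s, c e = 0 → a e = 0) :
    ∑ e ∈ s, (Real.negMulLog (a e) + a e * Real.log (c e)) =
        Real.negMulLog (∑ e ∈ s, a e) + (∑ e ∈ s, a e) * Real.log (∑ e ∈ s, c e) ↔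
      ∀ e ∈ s, a e = (∑ e' ∈ s, a e') * c e / ∑ e' ∈ s, c e' := by
  have hq : ∀ e ∈ s, 0 ≤ (∑ e' ∈ s, a e') * c e / ∑ e' ∈ s, c e' := fun e he =>
    div_nonneg (mul_nonneg (Finset.sum_nonneg ha) (hc e he)) (Finset.sum_nonneg hc)
  have hq0 : ∀ e ∈ s, (∑ e' ∈ s, a e') * c e / (∑ e' ∈ s, c e') = 0 → a e = 0 := by
    intro e he h
    rcases div_eq_zero_iff.1 h with h | h
    · rcases mul_eq_zero.1 h with h | h
      · exact (Finset.sum_eq_zero_iff_of_nonneg ha).1 h e he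
      · exact h0 e he h
    · exact h0 e he ((Finset.sum_eq_zero_iff_of_nonneg hc).1 h e he)
  rw [sum_negMulLog_add_mul_log_eq ha hc h0, sub_eq_self, Finset.sum_eq_zero_iff_of_nonneg
    fun e he => mul_klFun_nonneg (hq e he) (ha e he)]
  exact forall₂_congr fun e he => mul_klFun_eq_zero_iff (hq e he) (ha e he) (hq0 e he)

theorem negMulLog_sum_le_sum_negMulLog (ha : ∀ e ∈ s, 0 ≤ a e) :
    Real.negMulLog (∑ e ∈ s, a e) ≤ ∑ e ∈ s, Real.negMulLog (a e) := by
  rw [Real.negMulLog, neg_mul, Finset.sum_mul, ← Finset.sum_neg_distrib]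
  refine Finset.sum_le_sum fun e he => ?_
  rw [Real.negMulLog, neg_mul]
  rcases (ha e he).eq_or_lt with h | h
  · simp [← h]
  · exact neg_le_neg (mul_le_mul_of_nonneg_left
      (Real.log_le_log h (Finset.single_le_sum ha he)) h.le)

theorem sum_negMulLog_nonneg (ha : ∀ e ∈ s, 0 ≤ a e) (hsum : ∑ e ∈ s, a e = 1) :
    0 ≤ ∑ e ∈ s, Real.negMulLog (a e) := by
  simpa only [hsum, Real.negMulLog_one] using negMulLog_sum_le_sum_negMulLog ha

theorem sum_negMulLog_le_card (ha : ∀ e ∈ s, 0 ≤ a e) :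
    ∑ e ∈ s, Real.negMulLog (a e) ≤ s.card := by
  refine (Finset.sum_le_card_nsmul s _ 1 fun e he => ?_).trans_eq (nsmul_one _)
  linarith [Real.negMulLog_le_one_sub_self (ha e he), ha e he]

end LogSum

/-- The softplus function with reflected argument. If `u` is the log-odds of a bit being `0`, then
`softplus u` is minus the log-probability of the bit being `0`. -/
noncomputable def softplus (u : ℝ) : ℝ := Real.log (1 + Real.exp (-u))

theorem hasDerivAt_softplus (u : ℝ) : HasDerivAt softplus (-(1 + Real.exp u)⁻¹) u := by
  have h : HasDerivAt (fun u : ℝ => 1 + Real.exp (-u)) (-Real.exp (-u)) u := by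
    simpa using ((hasDerivAt_neg u).exp).const_add 1
  have hlog : HasDerivAt softplus (-Real.exp (-u) / (1 + Real.exp (-u))) u :=
    h.log (by positivity)
  convert hlog using 1
  rw [Real.exp_neg]
  have := Real.exp_pos u
  field_simp
  ring

theorem strictConvexOn_softplus : StrictConvexOn ℝ Set.univ softplus := by
  refine StrictMonoOn.strictConvexOn_of_deriv convex_univ
    (fun u _ => (hasDerivAt_softplus u).continuousAt.continuousWithinAt) fun x _ y _ hxy => ?_
  rw [(hasDerivAt_softplus x).deriv, (hasDerivAt_softplus y).deriv]
  gcongr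

theorem log_add_eq_log_add_softplus {x y : ℝ} (hx : 0 < x) (hy : 0 < y) :
    Real.log (x + y) = Real.log x + softplus (Real.log (x / y)) := by
  rw [softplus, Real.exp_neg, Real.exp_log (by positivity), ← Real.log_mul hx.ne' (by positivity)]
  congr 1
  field_simp

theorem log_div_exp_mul {a b t : ℝ} (ha : 0 < a) (hb : 0 < b) :
    Real.log (a / (Real.exp t * b)) = Real.log (a / b) - t := by
  rw [Real.log_div ha.ne' (by positivity), Real.log_mul (by positivity) hb.ne', Real.log_exp,
    Real.log_div ha.ne' hb.ne']
  ring

section Relaxation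

variable {ι V : Type*} [AddCommGroup V] [Module ℝ V] {s : Finset ι} {f : V → ℝ} {t : ι → V}
  {y : V} {r : ℝ}

theorem sum_insertNone_elim_smul (s : Finset ι) (r : ℝ) (y : V) (t : ι → V) :
    ∑ o ∈ s.insertNone, (o.elim (1 - s.card * r) fun _ => r) • o.elim y t =
      y - r • ∑ j ∈ s, (y - t j) := by
  rw [Finset.sum_insertNone]
  simp only [Option.elim, Finset.sum_sub_distrib, Finset.sum_const, ← Finset.smul_sum]
  module

theorem pos_of_mem_insertNone (hr : 0 < r) (hs : s.card * r < 1) :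
    ∀ o ∈ s.insertNone, 0 < (o.elim (1 - s.card * r) fun _ => r : ℝ) := by
  rintro (_ | i) _
  · simpa using hs
  · exact hr

theorem sum_insertNone_elim_weights (s : Finset ι) (r : ℝ) :
    ∑ o ∈ s.insertNone, (o.elim (1 - s.card * r) fun _ => r : ℝ) = 1 := by
  simp [Finset.sum_insertNone]

theorem sum_insertNone_elim_smul_map {X : Type*} (s : Finset ι) (r : ℝ) (y : X) (t : ι → X)
    (f : X → ℝ) :
    ∑ o ∈ s.insertNone, (o.elim (1 - s.card * r) fun _ => r) • f (o.elim y t) =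
      f y - r * ∑ j ∈ s, (f y - f (t j)) := by
  rw [← smul_eq_mul r, ← sum_insertNone_elim_smul]
  exact Finset.sum_congr rfl fun o _ => by cases o <;> rfl

theorem map_sub_smul_sum_le (hf : ConvexOn ℝ Set.univ f) (hr : 0 < r) (hs : s.card * r < 1) :
    f (y - r • ∑ j ∈ s, (y - t j)) ≤ f y - r * ∑ j ∈ s, (f y - f (t j)) := by
  rw [← sum_insertNone_elim_smul, ← sum_insertNone_elim_smul_map]
  exact hf.map_sum_le (fun o ho => (pos_of_mem_insertNone hr hs o ho).le)
    (sum_insertNone_elim_weights s r) fun _ _ => Set.mem_univ _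

theorem eq_of_map_sub_smul_sum_eq (hf : StrictConvexOn ℝ Set.univ f) (hr : 0 < r)
    (hs : s.card * r < 1)
    (h : f (y - r • ∑ j ∈ s, (y - t j)) = f y - r * ∑ j ∈ s, (f y - f (t j))) :
    ∀ j ∈ s, t j = y := by
  rw [← sum_insertNone_elim_smul, ← sum_insertNone_elim_smul_map] at h
  have hmean := (hf.map_sum_eq_iff (pos_of_mem_insertNone hr hs)
    (sum_insertNone_elim_weights s r) fun _ _ => Set.mem_univ _).1 h
  intro j hj
  exact (hmean (some j) (by simpa using hj)).trans (hmean none (by simp)).symm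

end Relaxation

/-! ### Parity sums and bounded preimages -/

theorem sum_even_add_sum_not_even {ι R : Type*} [CommSemiring R] (s : Finset ι) (a : ι → R) :
    ∑ B ∈ s.powerset with Even B.card, ∏ i ∈ B, a i +
      ∑ B ∈ s.powerset with ¬ Even B.card, ∏ i ∈ B, a i = ∏ i ∈ s, (1 + a i) := by
  classical
  rw [Finset.sum_filter_add_sum_filter_not, Finset.prod_one_add]

theorem sum_even_sub_sum_not_even {ι R : Type*} [CommRing R] (s : Finset ι) (a : ι → R) :
    ∑ B ∈ s.powerset with Even B.card, ∏ i ∈ B, a i -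
      ∑ B ∈ s.powerset with ¬ Even B.card, ∏ i ∈ B, a i = ∏ i ∈ s, (1 - a i) := by
  classical
  simp only [sub_eq_add_neg (1 : R)]
  rw [← sum_even_add_sum_not_even s fun i => -a i, sub_eq_add_neg, ← Finset.sum_neg_distrib]
  congr 1 <;> refine Finset.sum_congr rfl fun B hB => ?_
  · rw [Finset.prod_neg, (Finset.mem_filter.1 hB).2.neg_one_pow, one_mul]
  · rw [Finset.prod_neg, (Nat.not_even_iff_odd.1 (Finset.mem_filter.1 hB).2).neg_one_pow,
      neg_one_mul]

theorem tanh_half_eq (x : ℝ) : Real.tanh (x / 2) = (1 - Real.exp (-x)) / (1 + Real.exp (-x)) := by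
  have hsq : Real.exp (-x) = Real.exp (-(x / 2)) * Real.exp (-(x / 2)) := by
    rw [← Real.exp_add]
    ring_nf
  rw [Real.tanh_eq_sinh_div_cosh, Real.sinh_eq, Real.cosh_eq, hsq, Real.exp_neg (x / 2)]
  have := Real.exp_pos (x / 2)
  field_simp

theorem exists_apply_eq_norm_le_mul_norm_apply {V W : Type*} [NormedAddCommGroup V]
    [NormedSpace ℝ V] [NormedAddCommGroup W] [NormedSpace ℝ W] [FiniteDimensional ℝ W]
    (A : V →ₗ[ℝ] W) : ∃ C : ℝ, ∀ v, ∃ u, A u = A v ∧ ‖u‖ ≤ C * ‖A v‖ := by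
  obtain ⟨R, hR⟩ := A.rangeRestrict.exists_rightInverse_of_surjective A.range_rangeRestrict
  let R' := LinearMap.toContinuousLinearMap R
  refine ⟨‖R'‖, fun v => ⟨R' (A.rangeRestrict v), ?_, R'.le_opNorm _⟩⟩
  exact congrArg Subtype.val (LinearMap.congr_fun hR (A.rangeRestrict v))

namespace JointDecoding

variable {N M : ℕ} {S E : Type*}

/-! ### The forward and backward recursions -/

section Trellis

theorem lam_pos (D : JointDecoding N M S E) (K₂ : ℝ) (m : Fin N → Fin M → ℝ) (i : Fin N) (e : E) :
    0 < D.lam K₂ m i e :=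
  Real.exp_pos _

theorem AcceptsAllInputs.exists_isPath {D : JointDecoding N M S E} (hD : D.AcceptsAllInputs) :
    ∃ ε, D.IsPath ε :=
  (hD fun _ => true).imp fun _ => And.left

variable [DecidableEq S] (D : JointDecoding N M S E) (K₂ : ℝ) (m : Fin N → Fin M → ℝ)

theorem fwd_succ (i : Fin N) (k : S) :
    D.fwd K₂ m (i + 1) k =
      ∑ e ∈ D.sec i with D.dst e = k, D.fwd K₂ m i (D.src e) * D.lam K₂ m i e := by
  rw [fwd, dif_pos i.2]

theorem bwd_last (k : S) : D.bwd K₂ m N k = 1 := by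
  rw [bwd, Nat.sub_self, bwdRev]

theorem bwd_eq_sum (i : Fin N) (k : S) :
    D.bwd K₂ m i k =
      ∑ e ∈ D.sec i with D.src e = k, D.bwd K₂ m (i + 1) (D.dst e) * D.lam K₂ m i e := by
  have hsub : N - (i : ℕ) = (N - 1 - i) + 1 := by omega
  have hidx : (⟨N - 1 - (N - 1 - i), by omega⟩ : Fin N) = i := Fin.ext (by simp; omega)
  have hnext : N - ((i : ℕ) + 1) = N - 1 - i := by omega
  rw [bwd, bwd, hsub, bwdRev, dif_pos (by omega), hidx, hnext]

theorem fwd_nonneg (i : ℕ) (k : S) : 0 ≤ D.fwd K₂ m i k := by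
  induction i generalizing k with
  | zero => exact zero_le_one
  | succ i ih =>
    rw [fwd]
    split_ifs
    · exact Finset.sum_nonneg fun e _ => mul_nonneg (ih _) (D.lam_pos _ _ _ _).le
    · exact le_rfl

theorem bwd_nonneg (i : ℕ) (k : S) : 0 ≤ D.bwd K₂ m i k := by
  rw [bwd]
  generalize N - i = r
  induction r generalizing k with
  | zero => exact zero_le_one
  | succ r ih =>
    rw [bwdRev]
    split_ifs
    · exact Finset.sum_nonneg fun e _ => mul_nonneg (ih _) (D.lam_pos _ _ _ _).le
    · exact le_rfl

theorem fwd_mul_lam_nonneg (i : Fin N) (e : E) :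
    0 ≤ D.fwd K₂ m i (D.src e) * D.lam K₂ m i e :=
  mul_nonneg (D.fwd_nonneg _ _ _ _) (D.lam_pos _ _ _ _).le

theorem bwd_mul_lam_nonneg (i : Fin N) (e : E) :
    0 ≤ D.bwd K₂ m (i + 1) (D.dst e) * D.lam K₂ m i e :=
  mul_nonneg (D.bwd_nonneg _ _ _ _) (D.lam_pos _ _ _ _).le

theorem bwd_dst_eq_zero {i : Fin N} {e : E} (he : e ∈ D.sec i) (h : D.bwd K₂ m i (D.src e) = 0) :
    D.bwd K₂ m (i + 1) (D.dst e) = 0 := by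
  rw [bwd_eq_sum, Finset.sum_eq_zero_iff_of_nonneg fun e _ => D.bwd_mul_lam_nonneg K₂ m i e] at h
  exact (mul_eq_zero.1 (h e (Finset.mem_filter.2 ⟨he, rfl⟩))).resolve_right (D.lam_pos _ _ _ _).ne'

/-- The total weight of the trellis paths through the edge `e` of section `i`, where a path has the
product of the `lam` of its edges as weight. -/
noncomputable def edgeMass (i : Fin N) (e : E) : ℝ :=
  D.fwd K₂ m i (D.src e) * D.lam K₂ m i e * D.bwd K₂ m (i + 1) (D.dst e)

theorem edgeMass_eq_mul_div {i : Fin N} {e : E} (he : e ∈ D.sec i) :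
    D.edgeMass K₂ m i e = D.fwd K₂ m i (D.src e) * D.bwd K₂ m i (D.src e) *
      (D.bwd K₂ m (i + 1) (D.dst e) * D.lam K₂ m i e) / D.bwd K₂ m i (D.src e) := by
  by_cases h : D.bwd K₂ m i (D.src e) = 0
  · rw [edgeMass, D.bwd_dst_eq_zero K₂ m he h, h, mul_zero, mul_zero, zero_mul, zero_div]
  · rw [edgeMass]
    field_simp

theorem edgeMass_nonneg (i : Fin N) (e : E) : 0 ≤ D.edgeMass K₂ m i e :=
  mul_nonneg (D.fwd_mul_lam_nonneg K₂ m i e) (D.bwd_nonneg _ _ _ _)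

theorem sum_edgeMass_src_eq (i : Fin N) (k : S) :
    ∑ e ∈ D.sec i with D.src e = k, D.edgeMass K₂ m i e = D.fwd K₂ m i k * D.bwd K₂ m i k := by
  rw [bwd_eq_sum, Finset.mul_sum]
  refine Finset.sum_congr rfl fun e he => ?_
  rw [edgeMass, (Finset.mem_filter.1 he).2]
  ring

theorem sum_edgeMass_dst_eq (i : Fin N) (k : S) :
    ∑ e ∈ D.sec i with D.dst e = k, D.edgeMass K₂ m i e =
      D.fwd K₂ m (i + 1) k * D.bwd K₂ m (i + 1) k := by
  rw [fwd_succ, Finset.sum_mul]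
  refine Finset.sum_congr rfl fun e he => ?_
  rw [edgeMass, (Finset.mem_filter.1 he).2]

/-- The total weight of the trellis paths whose edge in section `i` has input bit `c`. -/
noncomputable def bitMass (i : Fin N) (c : Bool) : ℝ :=
  ∑ e ∈ D.sec i with D.inp e = c, D.edgeMass K₂ m i e

theorem bitMass_false_add_bitMass_true (i : Fin N) :
    D.bitMass K₂ m i false + D.bitMass K₂ m i true = ∑ e ∈ D.sec i, D.edgeMass K₂ m i e := by
  rw [bitMass, bitMass, add_comm, ← Finset.sum_filter_add_sum_filter_not (D.sec i)
    (fun e => D.inp e = true)]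
  simp only [Bool.not_eq_true]

/-- The log-odds of bit `i` being `0` under the path distribution of the trellis. -/
noncomputable def bitLogit (i : Fin N) : ℝ :=
  Real.log (D.bitMass K₂ m i false / D.bitMass K₂ m i true)

variable {D}

theorem IsPath.fwd_pos {ε : Fin N → E} (hε : D.IsPath ε) (i : Fin N) :
    0 < D.fwd K₂ m i (D.src (ε i)) := by
  obtain ⟨i, hi⟩ := i
  induction i with
  | zero => exact zero_lt_one
  | succ i ih =>
    have hi' : i < N := by omega
    refine (Finset.sum_pos' (fun e _ => D.fwd_mul_lam_nonneg K₂ m ⟨i, hi'⟩ e)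
      ⟨ε ⟨i, hi'⟩, Finset.mem_filter.2 ⟨hε.1 _, hε.2 i hi⟩,
        mul_pos (ih hi') (D.lam_pos _ _ _ _)⟩).trans_eq (D.fwd_succ K₂ m ⟨i, hi'⟩ _).symm

theorem IsPath.bwd_pos {ε : Fin N → E} (hε : D.IsPath ε) (i : Fin N) :
    0 < D.bwd K₂ m (i + 1) (D.dst (ε i)) := by
  obtain ⟨r, hr⟩ : ∃ r, r + (i + 1) = N := ⟨N - (i + 1), by omega⟩
  induction r generalizing i with
  | zero =>
    rw [show (i : ℕ) + 1 = N by omega, bwd_last]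
    exact zero_lt_one
  | succ r ih =>
    have hi : (i : ℕ) + 1 < N := by omega
    refine (Finset.sum_pos' (fun e _ => D.bwd_mul_lam_nonneg K₂ m ⟨i + 1, hi⟩ e)
      ⟨ε ⟨i + 1, hi⟩, Finset.mem_filter.2 ⟨hε.1 _, (hε.2 i hi).symm⟩,
        mul_pos (ih _ (by simp; omega)) (D.lam_pos _ _ _ _)⟩).trans_eq
      (D.bwd_eq_sum K₂ m ⟨i + 1, hi⟩ _).symm

theorem IsPath.edgeMass_pos {ε : Fin N → E} (hε : D.IsPath ε) (i : Fin N) :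
    0 < D.edgeMass K₂ m i (ε i) :=
  mul_pos (mul_pos (hε.fwd_pos K₂ m i) (D.lam_pos _ _ _ _)) (hε.bwd_pos K₂ m i)

theorem AcceptsAllInputs.bitMass_pos (hD : D.AcceptsAllInputs) (i : Fin N) (c : Bool) :
    0 < D.bitMass K₂ m i c := by
  obtain ⟨ε, hε, hinp⟩ := hD fun _ => c
  exact Finset.sum_pos' (fun e _ => D.edgeMass_nonneg K₂ m i e)
    ⟨ε i, Finset.mem_filter.2 ⟨hε.1 i, hinp i⟩, hε.edgeMass_pos K₂ m i⟩

variable [Fintype S] (D)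

/-- The partition function of the trellis: the total weight of all its paths. -/
noncomputable def trellisMass : ℝ := ∑ k : S, D.bwd K₂ m 0 k

theorem sum_fwd_mul_bwd {i : ℕ} (hi : i ≤ N) :
    ∑ k : S, D.fwd K₂ m i k * D.bwd K₂ m i k = D.trellisMass K₂ m := by
  induction i with
  | zero => exact Finset.sum_congr rfl fun k _ => by rw [fwd, one_mul]
  | succ i ih =>
    have hdst := D.sum_edgeMass_dst_eq K₂ m ⟨i, hi⟩
    have hsrc := D.sum_edgeMass_src_eq K₂ m ⟨i, hi⟩
    simp only at hdst hsrc
    rw [← ih (by omega)]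
    simp only [← hdst, ← hsrc, Finset.sum_fiberwise]

theorem sum_edgeMass (i : Fin N) : ∑ e ∈ D.sec i, D.edgeMass K₂ m i e = D.trellisMass K₂ m := by
  rw [← D.sum_fwd_mul_bwd K₂ m i.2.le, ← Finset.sum_fiberwise (D.sec i) D.src]
  exact Finset.sum_congr rfl fun k _ => D.sum_edgeMass_src_eq K₂ m i k

variable {D}

theorem AcceptsAllInputs.trellisMass_pos (hD : D.AcceptsAllInputs) (hN : 0 < N) :
    0 < D.trellisMass K₂ m := by
  obtain ⟨ε, hε⟩ := hD.exists_isPath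
  rw [← D.sum_edgeMass K₂ m ⟨0, hN⟩]
  exact Finset.sum_pos' (fun e _ => D.edgeMass_nonneg _ _ _ e) ⟨_, hε.1 _, hε.edgeMass_pos K₂ m _⟩

end Trellis

/-! ### The normalized messages -/

section Messages

variable [Fintype S] [DecidableEq S]

theorem alpha_succ (D : JointDecoding N M S E) (K₂ : ℝ) (m : Fin N → Fin M → ℝ) (i : Fin N)
    (k : S) :
    D.alpha K₂ m (i + 1) k =
      (∑ e ∈ D.sec i with D.dst e = k, D.alpha K₂ m i (D.src e) * D.lam K₂ m i e) /
        ∑ e ∈ D.sec i, D.alpha K₂ m i (D.src e) * D.lam K₂ m i e := by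
  rw [alpha, dif_pos i.2, Finset.sum_fiberwise]

theorem beta_last (D : JointDecoding N M S E) (K₂ : ℝ) (m : Fin N → Fin M → ℝ) (k : S) :
    D.beta K₂ m N k = 1 / (Fintype.card S : ℝ) := by
  rw [beta, Nat.sub_self, betaRev]

theorem beta_eq_div (D : JointDecoding N M S E) (K₂ : ℝ) (m : Fin N → Fin M → ℝ) (i : Fin N)
    (k : S) :
    D.beta K₂ m i k =
      (∑ e ∈ D.sec i with D.src e = k, D.beta K₂ m (i + 1) (D.dst e) * D.lam K₂ m i e) /
        ∑ e ∈ D.sec i, D.beta K₂ m (i + 1) (D.dst e) * D.lam K₂ m i e := by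
  have hsub : N - (i : ℕ) = (N - 1 - i) + 1 := by omega
  have hidx : (⟨N - 1 - (N - 1 - i), by omega⟩ : Fin N) = i := Fin.ext (by simp; omega)
  have hnext : N - ((i : ℕ) + 1) = N - 1 - i := by omega
  rw [beta, beta, hsub, betaRev, dif_pos (by omega), hidx, hnext, Finset.sum_fiberwise]

variable {D : JointDecoding N M S E} (hD : D.AcceptsAllInputs) (K₂ : ℝ) (m : Fin N → Fin M → ℝ)
include hD

theorem AcceptsAllInputs.exists_alpha_eq_mul_fwd (hN : 0 < N) {i : ℕ} (hi : i ≤ N) :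
    ∃ c : ℝ, 0 < c ∧ ∀ k, D.alpha K₂ m i k = c * D.fwd K₂ m i k := by
  obtain ⟨ε, hε⟩ := hD.exists_isPath
  induction i with
  | zero =>
    have : Nonempty S := ⟨D.src (ε ⟨0, hN⟩)⟩
    exact ⟨1 / (Fintype.card S : ℝ), by positivity, fun k => by rw [alpha, fwd, mul_one]⟩
  | succ i ih =>
    obtain ⟨c, hc, hck⟩ := ih (by omega)
    have halpha := D.alpha_succ K₂ m ⟨i, hi⟩
    have hfwd := D.fwd_succ K₂ m ⟨i, hi⟩
    simp only [hck, mul_assoc, ← Finset.mul_sum] at halpha hfwd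
    have hpos : 0 < ∑ e ∈ D.sec ⟨i, hi⟩, D.fwd K₂ m i (D.src e) * D.lam K₂ m ⟨i, hi⟩ e :=
      Finset.sum_pos' (fun e _ => D.fwd_mul_lam_nonneg K₂ m ⟨i, hi⟩ e)
        ⟨_, hε.1 ⟨i, hi⟩, mul_pos (hε.fwd_pos K₂ m ⟨i, hi⟩) (D.lam_pos _ _ _ _)⟩
    refine ⟨_, inv_pos.2 hpos, fun k => ?_⟩
    rw [halpha, hfwd]
    field_simp

theorem AcceptsAllInputs.exists_beta_eq_mul_bwd (hN : 0 < N) {i : ℕ} (hi : i ≤ N) :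
    ∃ c : ℝ, 0 < c ∧ ∀ k, D.beta K₂ m i k = c * D.bwd K₂ m i k := by
  obtain ⟨ε, hε⟩ := hD.exists_isPath
  induction hi using Nat.decreasingInduction with
  | self =>
    have : Nonempty S := ⟨D.src (ε ⟨0, hN⟩)⟩
    exact ⟨1 / (Fintype.card S : ℝ), by positivity, fun k => by rw [beta_last, bwd_last, mul_one]⟩
  | @of_succ i hi ih =>
    obtain ⟨c, hc, hck⟩ := ih
    have hbeta := D.beta_eq_div K₂ m ⟨i, hi⟩
    have hbwd := D.bwd_eq_sum K₂ m ⟨i, hi⟩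
    simp only [hck, mul_assoc, ← Finset.mul_sum] at hbeta hbwd
    have hpos : 0 < ∑ e ∈ D.sec ⟨i, hi⟩,
        D.bwd K₂ m (i + 1) (D.dst e) * D.lam K₂ m ⟨i, hi⟩ e :=
      Finset.sum_pos' (fun e _ => D.bwd_mul_lam_nonneg K₂ m ⟨i, hi⟩ e)
        ⟨_, hε.1 ⟨i, hi⟩, mul_pos (hε.bwd_pos K₂ m ⟨i, hi⟩) (D.lam_pos _ _ _ _)⟩
    refine ⟨_, inv_pos.2 hpos, fun k => ?_⟩
    rw [hbeta, hbwd]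
    field_simp

theorem AcceptsAllInputs.exists_edgeWeight_eq_mul_edgeMass (i : Fin N) :
    ∃ c : ℝ, 0 < c ∧ ∀ e, D.edgeWeight K₂ m i e = c * D.edgeMass K₂ m i e := by
  obtain ⟨a, ha, hae⟩ := hD.exists_alpha_eq_mul_fwd K₂ m i.pos i.2.le
  obtain ⟨c, hc, hce⟩ := hD.exists_beta_eq_mul_bwd K₂ m i.pos (i := i + 1) i.2
  refine ⟨a * c, mul_pos ha hc, fun e => ?_⟩
  rw [edgeWeight, edgeMass, hae, hce]
  ring

theorem AcceptsAllInputs.gOf_eq_div (i : Fin N) {e : E} (he : e ∈ D.sec i) :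
    D.gOf K₂ m i e = D.edgeMass K₂ m i e / D.trellisMass K₂ m := by
  obtain ⟨c, hc, hce⟩ := hD.exists_edgeWeight_eq_mul_edgeMass K₂ m i
  rw [gOf, if_pos he]
  simp only [hce]
  rw [← Finset.mul_sum, sum_edgeMass, mul_div_mul_left _ _ hc.ne']

theorem AcceptsAllInputs.gam_eq_bitLogit (i : Fin N) : D.gam K₂ m i = D.bitLogit K₂ m i := by
  obtain ⟨c, hc, hce⟩ := hD.exists_edgeWeight_eq_mul_edgeMass K₂ m i
  rw [gam, bitLogit, bitMass, bitMass]
  simp only [hce]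
  rw [← Finset.mul_sum, ← Finset.mul_sum, mul_div_mul_left _ _ hc.ne']

end Messages

/-! ### The variational formula for the trellis -/

section Flow

variable [DecidableEq S]

/-- The flows of value one through the trellis: the edge marginals of the Markov chains of edges
that follow the trellis. -/
structure IsFlow (D : JointDecoding N M S E) (g : Fin N → E → ℝ) : Prop where
  g_sum : ∀ p, ∑ e ∈ D.sec p, g p e = 1
  flow : ∀ (i : ℕ) (h : i + 1 < N) (k : S),
    ∑ e ∈ D.sec ⟨i, Nat.lt_of_succ_lt h⟩ with D.dst e = k, g ⟨i, Nat.lt_of_succ_lt h⟩ e =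
      ∑ e ∈ D.sec ⟨i + 1, h⟩ with D.src e = k, g ⟨i + 1, h⟩ e
  g_nonneg : ∀ i, ∀ e ∈ D.sec i, 0 ≤ g i e

theorem Feasible.isFlow {D : JointDecoding N M S E}
    {x : (Fin N → E → ℝ) × (Fin M → Finset (Fin N) → ℝ)} (hx : D.Feasible x) : D.IsFlow x.1 :=
  ⟨hx.g_sum, hx.flow, hx.g_nonneg⟩

/-- The state distribution of a flow at time `i`, that is, at the end of the first `i` sections.
At time `0` it is read off the initial states of the first section. -/
def stateFlow (D : JointDecoding N M S E) (g : Fin N → E → ℝ) : ℕ → S → ℝ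
  | 0, k => if h : 0 < N then ∑ e ∈ D.sec ⟨0, h⟩ with D.src e = k, g ⟨0, h⟩ e else 0
  | i + 1, k => if h : i < N then ∑ e ∈ D.sec ⟨i, h⟩ with D.dst e = k, g ⟨i, h⟩ e else 0

theorem stateFlow_succ (D : JointDecoding N M S E) (g : Fin N → E → ℝ) (i : Fin N) (k : S) :
    D.stateFlow g (i + 1) k = ∑ e ∈ D.sec i with D.dst e = k, g i e := by
  rw [stateFlow, dif_pos i.2]

variable {D : JointDecoding N M S E} {g : Fin N → E → ℝ} (hg : D.IsFlow g)
  (K₂ : ℝ) (m : Fin N → Fin M → ℝ)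
include hg

theorem IsFlow.sum_src (i : Fin N) (k : S) :
    ∑ e ∈ D.sec i with D.src e = k, g i e = D.stateFlow g i k := by
  obtain ⟨i, hi⟩ := i
  cases i with
  | zero => simp only; rw [stateFlow, dif_pos hi]
  | succ i => rw [← hg.flow i hi k, ← D.stateFlow_succ g ⟨i, by omega⟩ k]

theorem IsFlow.stateFlow_nonneg (i : Fin N) (k : S) : 0 ≤ D.stateFlow g i k := by
  rw [← hg.sum_src]
  exact Finset.sum_nonneg fun e he => hg.g_nonneg i e (Finset.mem_filter.1 he).1

theorem IsFlow.sum_stateFlow_zero [Fintype S] (hN : 0 < N) : ∑ k : S, D.stateFlow g 0 k = 1 := by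
  have hsrc := hg.sum_src ⟨0, hN⟩
  simp only at hsrc
  simp only [← hsrc, Finset.sum_fiberwise, hg.g_sum]

theorem IsFlow.eq_zero_of_bwd_eq_zero (i : Fin N) {e : E} (he : e ∈ D.sec i)
    (h : D.bwd K₂ m (i + 1) (D.dst e) = 0) : g i e = 0 := by
  obtain ⟨r, hr⟩ : ∃ r, r + (i + 1) = N := ⟨N - (i + 1), by omega⟩
  induction r generalizing i e with
  | zero =>
    rw [show (i : ℕ) + 1 = N by omega, bwd_last] at h
    exact absurd h one_ne_zero
  | succ r ih =>
    have hi : (i : ℕ) + 1 < N := by omega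
    have hnext : ∑ e' ∈ D.sec ⟨i + 1, hi⟩ with D.src e' = D.dst e, g ⟨i + 1, hi⟩ e' = 0 := by
      refine Finset.sum_eq_zero fun e' he' => ?_
      obtain ⟨hmem, hsrc⟩ := Finset.mem_filter.1 he'
      exact ih ⟨i + 1, hi⟩ hmem (D.bwd_dst_eq_zero K₂ m hmem (hsrc ▸ h)) (by simp; omega)
    rw [← hg.flow i hi] at hnext
    exact (Finset.sum_eq_zero_iff_of_nonneg fun e' he' =>
      hg.g_nonneg _ _ (Finset.mem_filter.1 he').1).1 hnext e (Finset.mem_filter.2 ⟨he, rfl⟩)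

theorem IsFlow.stateFlow_eq_zero_of_bwd_eq_zero (i : Fin N) {k : S} (h : D.bwd K₂ m i k = 0) :
    D.stateFlow g i k = 0 := by
  rw [← hg.sum_src]
  refine Finset.sum_eq_zero fun e he => ?_
  obtain ⟨hmem, hsrc⟩ := Finset.mem_filter.1 he
  exact hg.eq_zero_of_bwd_eq_zero K₂ m i hmem (D.bwd_dst_eq_zero K₂ m hmem (hsrc ▸ h))

theorem IsFlow.sum_src_negMulLog_add_mul_log_le (i : Fin N) (k : S) :
    ∑ e ∈ D.sec i with D.src e = k, (Real.negMulLog (g i e) +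
        g i e * Real.log (D.bwd K₂ m (i + 1) (D.dst e) * D.lam K₂ m i e)) ≤
      Real.negMulLog (D.stateFlow g i k) + D.stateFlow g i k * Real.log (D.bwd K₂ m i k) := by
  rw [bwd_eq_sum, ← hg.sum_src]
  exact sum_negMulLog_add_mul_log_le
    (fun e he => hg.g_nonneg i e (Finset.mem_filter.1 he).1)
    (fun e _ => D.bwd_mul_lam_nonneg K₂ m i e) fun e he h =>
      hg.eq_zero_of_bwd_eq_zero K₂ m i (Finset.mem_filter.1 he).1
        ((mul_eq_zero.1 h).resolve_right (D.lam_pos _ _ _ _).ne')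

theorem IsFlow.sum_src_negMulLog_add_mul_log_eq_iff (i : Fin N) (k : S) :
    ∑ e ∈ D.sec i with D.src e = k, (Real.negMulLog (g i e) +
        g i e * Real.log (D.bwd K₂ m (i + 1) (D.dst e) * D.lam K₂ m i e)) =
        Real.negMulLog (D.stateFlow g i k) + D.stateFlow g i k * Real.log (D.bwd K₂ m i k) ↔
      ∀ e ∈ (D.sec i).filter (fun e => D.src e = k), g i e = D.stateFlow g i k *
        (D.bwd K₂ m (i + 1) (D.dst e) * D.lam K₂ m i e) / D.bwd K₂ m i k := by
  rw [bwd_eq_sum, ← hg.sum_src]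
  exact sum_negMulLog_add_mul_log_eq_iff
    (fun e he => hg.g_nonneg i e (Finset.mem_filter.1 he).1)
    (fun e _ => D.bwd_mul_lam_nonneg K₂ m i e) fun e he h =>
      hg.eq_zero_of_bwd_eq_zero K₂ m i (Finset.mem_filter.1 he).1
        ((mul_eq_zero.1 h).resolve_right (D.lam_pos _ _ _ _).ne')

end Flow

section FreeEntropy

/-- The entropy of section `i` of a flow plus the mean logarithm of the edge weights `lam`. -/
noncomputable def sectionFreeEntropy (D : JointDecoding N M S E) (K₂ : ℝ)
    (m : Fin N → Fin M → ℝ) (g : Fin N → E → ℝ) (i : Fin N) : ℝ :=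
  D.sectionEntropy g i + ∑ e ∈ D.sec i, g i e * Real.log (D.lam K₂ m i e)

variable [Fintype S] [DecidableEq S]

/-- The entropy of the flow `g` plus the mean logarithm of the weights of its paths, that is, minus
the free energy of `g`. -/
noncomputable def freeEntropy (D : JointDecoding N M S E) (K₂ : ℝ) (m : Fin N → Fin M → ℝ)
    (g : Fin N → E → ℝ) : ℝ :=
  D.trellisEntropy g + ∑ i, ∑ e ∈ D.sec i, g i e * Real.log (D.lam K₂ m i e)

/-- The largest free entropy that the sections from time `i` on can have when the state distribution
at time `i` is that of `g`. -/
noncomputable def statePotential (D : JointDecoding N M S E) (K₂ : ℝ) (m : Fin N → Fin M → ℝ)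
    (g : Fin N → E → ℝ) (i : ℕ) : ℝ :=
  ∑ k : S, (Real.negMulLog (D.stateFlow g i k) + D.stateFlow g i k * Real.log (D.bwd K₂ m i k))

theorem trellisEntropy_eq_sum_sub (D : JointDecoding N M S E) (hN : 0 < N) (g : Fin N → E → ℝ) :
    D.trellisEntropy g = ∑ i, (D.sectionEntropy g i - D.stateEntropy g i) +
      D.stateEntropy g ⟨N - 1, by omega⟩ := by
  have hlast : (Finset.univ.filter fun i : Fin N => ¬ (i : ℕ) + 1 < N) = {⟨N - 1, by omega⟩} := by
    ext i
    simp only [Finset.mem_filter, Finset.mem_univ, true_and, Finset.mem_singleton, Fin.ext_iff]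
    omega
  rw [trellisEntropy, Finset.sum_sub_distrib,
    ← Finset.sum_filter_add_sum_filter_not Finset.univ (fun i : Fin N => (i : ℕ) + 1 < N)
      (D.stateEntropy g), hlast, Finset.sum_singleton]
  ring

theorem statePotential_last (D : JointDecoding N M S E) (K₂ : ℝ) (m : Fin N → Fin M → ℝ)
    (g : Fin N → E → ℝ) (hN : 0 < N) :
    D.statePotential K₂ m g N = D.stateEntropy g ⟨N - 1, by omega⟩ := by
  have hdst := D.stateFlow_succ g ⟨N - 1, by omega⟩
  simp only [Nat.sub_add_cancel hN] at hdst
  simp only [statePotential, stateEntropy, bwd_last, hdst, Real.log_one, mul_zero, add_zero]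

theorem statePotential_succ_sub_stateEntropy (D : JointDecoding N M S E) (K₂ : ℝ)
    (m : Fin N → Fin M → ℝ) (g : Fin N → E → ℝ) (i : Fin N) :
    D.statePotential K₂ m g (i + 1) - D.stateEntropy g i =
      ∑ e ∈ D.sec i, g i e * Real.log (D.bwd K₂ m (i + 1) (D.dst e)) := by
  rw [statePotential, stateEntropy, ← Finset.sum_sub_distrib,
    ← Finset.sum_fiberwise (D.sec i) D.dst]
  refine Finset.sum_congr rfl fun k _ => ?_
  rw [D.stateFlow_succ, add_sub_cancel_left, Finset.sum_mul]
  exact Finset.sum_congr rfl fun e he => by rw [(Finset.mem_filter.1 he).2]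

/-- Telescoping: the potential differences between consecutive times add up to the difference
between the last potential, a state entropy, and the first. -/
theorem freeEntropy_eq_statePotential_zero_add (D : JointDecoding N M S E) (K₂ : ℝ)
    (m : Fin N → Fin M → ℝ) (g : Fin N → E → ℝ) (hN : 0 < N) :
    D.freeEntropy K₂ m g = D.statePotential K₂ m g 0 + ∑ i : Fin N,
      (D.sectionFreeEntropy K₂ m g i + D.statePotential K₂ m g (i + 1) - D.stateEntropy g i -
        D.statePotential K₂ m g i) := by
  have htel : ∑ i : Fin N, (D.statePotential K₂ m g (i + 1) - D.statePotential K₂ m g i) =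
      D.statePotential K₂ m g N - D.statePotential K₂ m g 0 := by
    rw [Fin.sum_univ_eq_sum_range
      (fun i => D.statePotential K₂ m g (i + 1) - D.statePotential K₂ m g i), Finset.sum_range_sub]
  rw [freeEntropy, D.trellisEntropy_eq_sum_sub hN, ← D.statePotential_last K₂ m g hN]
  simp only [sectionFreeEntropy, Finset.sum_sub_distrib, Finset.sum_add_distrib] at htel ⊢
  linarith

variable {D : JointDecoding N M S E} {g : Fin N → E → ℝ} (hg : D.IsFlow g)
  (K₂ : ℝ) (m : Fin N → Fin M → ℝ)
include hg

theorem IsFlow.sectionFreeEntropy_add_statePotential_sub (i : Fin N) :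
    D.sectionFreeEntropy K₂ m g i + D.statePotential K₂ m g (i + 1) - D.stateEntropy g i =
      ∑ k : S, ∑ e ∈ D.sec i with D.src e = k, (Real.negMulLog (g i e) +
        g i e * Real.log (D.bwd K₂ m (i + 1) (D.dst e) * D.lam K₂ m i e)) := by
  rw [add_sub_assoc, statePotential_succ_sub_stateEntropy, Finset.sum_fiberwise, sectionFreeEntropy,
    sectionEntropy, ← Finset.sum_add_distrib, ← Finset.sum_add_distrib]
  refine Finset.sum_congr rfl fun e he => ?_
  by_cases hbwd : D.bwd K₂ m (i + 1) (D.dst e) = 0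
  · simp only [hg.eq_zero_of_bwd_eq_zero K₂ m i he hbwd, zero_mul, add_zero]
  · rw [Real.log_mul hbwd (D.lam_pos _ _ _ _).ne']
    ring

theorem IsFlow.sectionFreeEntropy_le (i : Fin N) :
    D.sectionFreeEntropy K₂ m g i + D.statePotential K₂ m g (i + 1) - D.stateEntropy g i ≤
      D.statePotential K₂ m g i := by
  rw [hg.sectionFreeEntropy_add_statePotential_sub]
  exact Finset.sum_le_sum fun k _ => hg.sum_src_negMulLog_add_mul_log_le K₂ m i k

theorem IsFlow.sectionFreeEntropy_eq_iff (i : Fin N) :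
    D.sectionFreeEntropy K₂ m g i + D.statePotential K₂ m g (i + 1) - D.stateEntropy g i =
        D.statePotential K₂ m g i ↔
      ∀ e ∈ D.sec i, g i e = D.stateFlow g i (D.src e) *
        (D.bwd K₂ m (i + 1) (D.dst e) * D.lam K₂ m i e) / D.bwd K₂ m i (D.src e) := by
  rw [hg.sectionFreeEntropy_add_statePotential_sub, statePotential,
    Finset.sum_eq_sum_iff_of_le fun k _ => hg.sum_src_negMulLog_add_mul_log_le K₂ m i k]
  simp only [hg.sum_src_negMulLog_add_mul_log_eq_iff K₂ m i, Finset.mem_univ, forall_const,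
    Finset.mem_filter]
  exact ⟨fun h e he => h _ e ⟨he, rfl⟩, fun h k e ⟨he, hk⟩ => hk ▸ h e he⟩

theorem IsFlow.statePotential_zero_le (hN : 0 < N) :
    D.statePotential K₂ m g 0 ≤ Real.log (D.trellisMass K₂ m) := by
  have h := sum_negMulLog_add_mul_log_le (s := Finset.univ)
    (fun k _ => hg.stateFlow_nonneg ⟨0, hN⟩ k) (fun k _ => D.bwd_nonneg K₂ m 0 k)
    (fun k _ => hg.stateFlow_eq_zero_of_bwd_eq_zero K₂ m ⟨0, hN⟩)
  simpa only [statePotential, trellisMass, hg.sum_stateFlow_zero hN, Real.negMulLog_one, one_mul,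
    zero_add] using h

theorem IsFlow.statePotential_zero_eq_iff (hN : 0 < N) :
    D.statePotential K₂ m g 0 = Real.log (D.trellisMass K₂ m) ↔
      ∀ k, D.stateFlow g 0 k = D.bwd K₂ m 0 k / D.trellisMass K₂ m := by
  have h := sum_negMulLog_add_mul_log_eq_iff (s := Finset.univ)
    (fun k _ => hg.stateFlow_nonneg ⟨0, hN⟩ k) (fun k _ => D.bwd_nonneg K₂ m 0 k)
    (fun k _ => hg.stateFlow_eq_zero_of_bwd_eq_zero K₂ m ⟨0, hN⟩)
  simpa only [statePotential, trellisMass, hg.sum_stateFlow_zero hN, Real.negMulLog_one, one_mul,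
    zero_add, Finset.mem_univ, forall_const] using h

theorem IsFlow.freeEntropy_le (hN : 0 < N) :
    D.freeEntropy K₂ m g ≤ Real.log (D.trellisMass K₂ m) := by
  rw [D.freeEntropy_eq_statePotential_zero_add K₂ m g hN]
  have hsections := Finset.sum_nonpos fun i (_ : i ∈ Finset.univ) =>
    sub_nonpos.2 (hg.sectionFreeEntropy_le K₂ m i)
  linarith [hg.statePotential_zero_le K₂ m hN]

theorem IsFlow.freeEntropy_eq_iff (hN : 0 < N) :
    D.freeEntropy K₂ m g = Real.log (D.trellisMass K₂ m) ↔
      (∀ k, D.stateFlow g 0 k = D.bwd K₂ m 0 k / D.trellisMass K₂ m) ∧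
      ∀ i, ∀ e ∈ D.sec i, g i e = D.stateFlow g i (D.src e) *
        (D.bwd K₂ m (i + 1) (D.dst e) * D.lam K₂ m i e) / D.bwd K₂ m i (D.src e) := by
  have hle := fun i (_ : i ∈ Finset.univ) => sub_nonpos.2 (hg.sectionFreeEntropy_le K₂ m i)
  have hsections := Finset.sum_nonpos hle
  have hinit := hg.statePotential_zero_le K₂ m hN
  rw [D.freeEntropy_eq_statePotential_zero_add K₂ m g hN, ← hg.statePotential_zero_eq_iff K₂ m hN]
  simp only [← hg.sectionFreeEntropy_eq_iff]
  constructor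
  · intro h
    exact ⟨by linarith, fun i => sub_eq_zero.1 <|
      (Finset.sum_eq_zero_iff_of_nonpos hle).1 (by linarith) i (Finset.mem_univ i)⟩
  · rintro ⟨h, hi⟩
    rw [h, Finset.sum_eq_zero fun i _ => sub_eq_zero.2 (hi i), add_zero]

end FreeEntropy

section Gibbs

variable [Fintype S] [DecidableEq S] {D : JointDecoding N M S E} (hD : D.AcceptsAllInputs) (K₂ : ℝ)
  (m : Fin N → Fin M → ℝ)
include hD

theorem AcceptsAllInputs.isFlow_gOf : D.IsFlow (D.gOf K₂ m) where
  g_sum p := by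
    rw [Finset.sum_congr rfl fun e he => hD.gOf_eq_div K₂ m p he, ← Finset.sum_div, sum_edgeMass,
      div_self (hD.trellisMass_pos K₂ m p.pos).ne']
  flow i h k := by
    rw [Finset.sum_congr rfl fun e he => hD.gOf_eq_div K₂ m _ (Finset.mem_filter.1 he).1,
      Finset.sum_congr rfl fun e he => hD.gOf_eq_div K₂ m _ (Finset.mem_filter.1 he).1,
      ← Finset.sum_div, ← Finset.sum_div, sum_edgeMass_dst_eq, sum_edgeMass_src_eq]
  g_nonneg i e he := by
    rw [hD.gOf_eq_div K₂ m i he]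
    exact div_nonneg (D.edgeMass_nonneg _ _ _ _) (hD.trellisMass_pos K₂ m i.pos).le

theorem AcceptsAllInputs.stateFlow_gOf (i : Fin N) (k : S) :
    D.stateFlow (D.gOf K₂ m) i k = D.fwd K₂ m i k * D.bwd K₂ m i k / D.trellisMass K₂ m := by
  rw [← (hD.isFlow_gOf K₂ m).sum_src,
    Finset.sum_congr rfl fun e he => hD.gOf_eq_div K₂ m _ (Finset.mem_filter.1 he).1,
    ← Finset.sum_div, sum_edgeMass_src_eq]

theorem AcceptsAllInputs.freeEntropy_gOf (hN : 0 < N) :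
    D.freeEntropy K₂ m (D.gOf K₂ m) = Real.log (D.trellisMass K₂ m) := by
  refine ((hD.isFlow_gOf K₂ m).freeEntropy_eq_iff K₂ m hN).2 ⟨fun k => ?_, fun i e he => ?_⟩
  · have h := hD.stateFlow_gOf K₂ m ⟨0, hN⟩ k
    rwa [fwd, one_mul] at h
  · rw [hD.gOf_eq_div K₂ m i he, hD.stateFlow_gOf, D.edgeMass_eq_mul_div K₂ m he]
    ring

variable {K₂ m}

theorem AcceptsAllInputs.eq_gOf_of_freeEntropy_eq {g : Fin N → E → ℝ} (hg : D.IsFlow g)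
    (h : D.freeEntropy K₂ m g = Real.log (D.trellisMass K₂ m)) (i : Fin N) {e : E}
    (he : e ∈ D.sec i) : g i e = D.gOf K₂ m i e := by
  obtain ⟨hinit, hsec⟩ := (hg.freeEntropy_eq_iff K₂ m i.pos).1 h
  have hedge (i : Fin N) (hi : ∀ k, D.stateFlow g i k =
      D.fwd K₂ m i k * D.bwd K₂ m i k / D.trellisMass K₂ m) (e : E) (he : e ∈ D.sec i) :
      g i e = D.edgeMass K₂ m i e / D.trellisMass K₂ m := by
    rw [hsec i e he, hi, D.edgeMass_eq_mul_div K₂ m he]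
    ring
  have hstate (i : ℕ) (hi : i ≤ N) (k : S) :
      D.stateFlow g i k = D.fwd K₂ m i k * D.bwd K₂ m i k / D.trellisMass K₂ m := by
    induction i generalizing k with
    | zero => rw [hinit, fwd, one_mul]
    | succ i ih =>
      have hflow := D.stateFlow_succ g ⟨i, hi⟩ k
      have hmass := D.sum_edgeMass_dst_eq K₂ m ⟨i, hi⟩ k
      simp only at hflow hmass
      rw [hflow, ← hmass, Finset.sum_div]
      exact Finset.sum_congr rfl fun e he =>
        hedge ⟨i, hi⟩ (ih (by omega)) e (Finset.mem_filter.1 he).1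
  rw [hD.gOf_eq_div K₂ m i he]
  exact hedge i (hstate i i.2.le) e he

end Gibbs

/-! ### The local distributions of the checks -/

section Check

variable {D : JointDecoding N M S E}

theorem mem_bitNbr {i : Fin N} {j : Fin M} : j ∈ D.bitNbr i ↔ i ∈ D.checkNbr j := by
  simp [bitNbr, checkNbr]

theorem mem_patterns {j : Fin M} {B : Finset (Fin N)} :
    B ∈ D.patterns j ↔ B ⊆ D.checkNbr j ∧ Even B.card := by
  simp [patterns]

theorem mem_bitNbr_of_mem_pattern {i : Fin N} {j : Fin M} {B : Finset (Fin N)}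
    (hB : B ∈ D.patterns j) (hi : i ∈ B) : j ∈ D.bitNbr i :=
  mem_bitNbr.2 ((mem_patterns.1 hB).1 hi)

theorem pair_mem_patterns {i r : Fin N} {j : Fin M} (hi : i ∈ D.checkNbr j)
    (hr : r ∈ D.checkNbr j) (h : i ≠ r) : {i, r} ∈ D.patterns j := by
  rw [mem_patterns, Finset.card_pair h]
  exact ⟨Finset.insert_subset hi (Finset.singleton_subset_iff.2 hr), even_two⟩

/-- The weight of a pattern under the messages `m`. -/
noncomputable def patternMass (K₁ : ℝ) (m : Fin N → Fin M → ℝ) (j : Fin M)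
    (B : Finset (Fin N)) : ℝ :=
  Real.exp (-K₁ * ∑ i ∈ B, m i j)

theorem patternMass_pos (K₁ : ℝ) (m : Fin N → Fin M → ℝ) (j : Fin M) (B : Finset (Fin N)) :
    0 < patternMass K₁ m j B := Real.exp_pos _

theorem patternMass_eq_prod (K₁ : ℝ) (m : Fin N → Fin M → ℝ) (j : Fin M) (B : Finset (Fin N)) :
    patternMass K₁ m j B = ∏ i ∈ B, Real.exp (-K₁ * m i j) := by
  rw [patternMass, Finset.mul_sum, Real.exp_sum]

variable (D) (K₁ : ℝ) (m : Fin N → Fin M → ℝ)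

theorem empty_mem_patterns (j : Fin M) : ∅ ∈ D.patterns j :=
  mem_patterns.2 ⟨Finset.empty_subset _, Even.zero⟩

/-- The partition function of check `j`: the total weight of its patterns. -/
noncomputable def checkMass (j : Fin M) : ℝ := ∑ B ∈ D.patterns j, patternMass K₁ m j B

/-- The total weight of the patterns of check `j` in which bit `i` is `1`. -/
noncomputable def checkMassOne (i : Fin N) (j : Fin M) : ℝ :=
  ∑ B ∈ D.patterns j with i ∈ B, patternMass K₁ m j B

/-- The total weight of the patterns of check `j` in which bit `i` is `0`. -/
noncomputable def checkMassZero (i : Fin N) (j : Fin M) : ℝ :=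
  ∑ B ∈ D.patterns j with i ∉ B, patternMass K₁ m j B

theorem checkMassZero_add_checkMassOne (i : Fin N) (j : Fin M) :
    D.checkMassZero K₁ m i j + D.checkMassOne K₁ m i j = D.checkMass K₁ m j := by
  rw [add_comm, checkMassZero, checkMassOne, Finset.sum_filter_add_sum_filter_not, checkMass]

theorem checkMass_pos (j : Fin M) : 0 < D.checkMass K₁ m j :=
  Finset.sum_pos (fun B _ => patternMass_pos K₁ m j B) ⟨∅, D.empty_mem_patterns j⟩

theorem checkMassZero_pos (i : Fin N) (j : Fin M) : 0 < D.checkMassZero K₁ m i j :=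
  Finset.sum_pos (fun B _ => patternMass_pos K₁ m j B)
    ⟨∅, Finset.mem_filter.2 ⟨D.empty_mem_patterns j, Finset.notMem_empty i⟩⟩

variable {D} in
theorem checkMassOne_pos {i : Fin N} {j : Fin M} (hij : j ∈ D.bitNbr i)
    (hj : (D.checkNbr j).card ≠ 1) : 0 < D.checkMassOne K₁ m i j := by
  have hi := mem_bitNbr.1 hij
  have hcard : 1 < (D.checkNbr j).card := by
    have := Finset.card_pos.2 ⟨i, hi⟩
    omega
  obtain ⟨r, hr, hne⟩ := Finset.exists_mem_ne hcard i
  exact Finset.sum_pos (fun B _ => patternMass_pos K₁ m j B)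
    ⟨{i, r}, Finset.mem_filter.2 ⟨pair_mem_patterns hi hr hne.symm, Finset.mem_insert_self _ _⟩⟩

theorem wOf_eq_div (j : Fin M) {B : Finset (Fin N)} (hB : B ∈ D.patterns j) :
    D.wOf K₁ m j B = patternMass K₁ m j B / D.checkMass K₁ m j := by
  rw [wOf, if_pos hB]
  rfl

theorem checkMassZero_eq_sum_even (i : Fin N) (j : Fin M) :
    D.checkMassZero K₁ m i j = ∑ B ∈ ((D.checkNbr j).erase i).powerset with Even B.card,
      ∏ r ∈ B, Real.exp (-K₁ * m r j) := by
  simp only [checkMassZero, patternMass_eq_prod]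
  refine Finset.sum_congr ?_ fun _ _ => rfl
  ext B
  simp only [Finset.mem_filter, mem_patterns, Finset.mem_powerset, Finset.subset_erase]
  tauto

variable {D} in
theorem checkMassOne_eq_mul_sum_odd {i : Fin N} {j : Fin M} (hij : j ∈ D.bitNbr i) :
    D.checkMassOne K₁ m i j = Real.exp (-K₁ * m i j) *
      ∑ B ∈ ((D.checkNbr j).erase i).powerset with ¬ Even B.card,
        ∏ r ∈ B, Real.exp (-K₁ * m r j) := by
  have hi := mem_bitNbr.1 hij
  simp only [checkMassOne, patternMass_eq_prod, Finset.mul_sum]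
  refine Finset.sum_nbij' (fun B => B.erase i) (fun B => insert i B) ?_ ?_ ?_ ?_ ?_
  · intro B hB
    simp only [Finset.mem_filter, mem_patterns, Finset.mem_powerset] at hB ⊢
    rw [← Finset.card_erase_add_one hB.2, Nat.even_add_one] at hB
    exact ⟨Finset.erase_subset_erase i hB.1.1, hB.1.2⟩
  · intro B hB
    simp only [Finset.mem_filter, mem_patterns, Finset.mem_powerset, Finset.subset_erase] at hB ⊢
    rw [Finset.card_insert_of_notMem hB.1.2, Nat.even_add_one]
    exact ⟨⟨Finset.insert_subset hi hB.1.1, hB.2⟩, Finset.mem_insert_self i B⟩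
  · intro B hB
    exact Finset.insert_erase (Finset.mem_filter.1 hB).2
  · intro B hB
    simp only [Finset.mem_filter, Finset.mem_powerset, Finset.subset_erase] at hB
    exact Finset.erase_insert hB.1.2
  · intro B hB
    exact (Finset.mul_prod_erase B (fun r => Real.exp (-K₁ * m r j))
      (Finset.mem_filter.1 hB).2).symm

/-- The log-odds of bit `i` being `0` under the pattern distribution of check `j`. -/
noncomputable def checkLogit (i : Fin N) (j : Fin M) : ℝ :=
  Real.log (D.checkMassZero K₁ m i j / D.checkMassOne K₁ m i j)

variable {D} {K₁} in
theorem checkMsg_eq_sub_checkLogit_div {i : Fin N} {j : Fin M} (hK₁ : K₁ ≠ 0)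
    (hij : j ∈ D.bitNbr i) (hj : (D.checkNbr j).card ≠ 1) :
    D.checkMsg K₁ m i j = m i j - D.checkLogit K₁ m i j / K₁ := by
  have hzero := D.checkMassZero_pos K₁ m i j
  have hone := checkMassOne_pos K₁ m hij hj
  have hodd := checkMassOne_eq_mul_sum_odd K₁ m hij
  have hadd := sum_even_add_sum_not_even ((D.checkNbr j).erase i) fun r => Real.exp (-K₁ * m r j)
  have hsub := sum_even_sub_sum_not_even ((D.checkNbr j).erase i) fun r => Real.exp (-K₁ * m r j)
  rw [← checkMassZero_eq_sum_even] at hadd hsub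
  set odd := ∑ B ∈ ((D.checkNbr j).erase i).powerset with ¬ Even B.card,
    ∏ r ∈ B, Real.exp (-K₁ * m r j)
  have hodd_pos : 0 < odd := pos_of_mul_pos_right (hodd ▸ hone) (Real.exp_pos _).le
  have hell : D.ell K₁ m i j =
      (D.checkMassZero K₁ m i j - odd) / (D.checkMassZero K₁ m i j + odd) := by
    rw [hadd, hsub, ← Finset.prod_div_distrib, ell]
    exact Finset.prod_congr rfl fun r _ => by rw [tanh_half_eq, neg_mul]
  have hratio : (1 - D.ell K₁ m i j) / (1 + D.ell K₁ m i j) = odd / D.checkMassZero K₁ m i j := by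
    have hsum : D.checkMassZero K₁ m i j + odd ≠ 0 := (add_pos hzero hodd_pos).ne'
    rw [hell, one_sub_div hsum, one_add_div hsum, div_div_div_cancel_right₀ hsum]
    rw [show ∀ z : ℝ, z + odd - (z - odd) = 2 * odd by intro; ring,
      show ∀ z : ℝ, z + odd + (z - odd) = 2 * z by intro; ring, mul_div_mul_left _ _ two_ne_zero]
  rw [checkMsg, hratio, checkLogit, hodd, log_div_exp_mul hzero hodd_pos,
    ← inv_div (D.checkMassZero K₁ m i j) odd, Real.log_inv]
  field_simp
  ring

/-- The entropy of the local distribution `w j` plus the mean logarithm of the pattern weights,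
that is, minus the free energy of `w j`. -/
noncomputable def checkFreeEntropy (w : Fin M → Finset (Fin N) → ℝ) (j : Fin M) : ℝ :=
  D.checkEntropy w j - K₁ * ∑ B ∈ D.patterns j, w j B * ∑ i ∈ B, m i j

theorem checkFreeEntropy_eq_sum (w : Fin M → Finset (Fin N) → ℝ) (j : Fin M) :
    D.checkFreeEntropy K₁ m w j = ∑ B ∈ D.patterns j,
      (Real.negMulLog (w j B) + w j B * Real.log (patternMass K₁ m j B)) := by
  rw [checkFreeEntropy, checkEntropy, Finset.mul_sum, ← Finset.sum_sub_distrib]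
  refine Finset.sum_congr rfl fun B _ => ?_
  rw [patternMass, Real.log_exp]
  ring

variable {D} {w : Fin M → Finset (Fin N) → ℝ} {j : Fin M} (hw : ∀ B ∈ D.patterns j, 0 ≤ w j B)
  (hsum : ∑ B ∈ D.patterns j, w j B = 1)
include hw hsum

theorem checkFreeEntropy_le : D.checkFreeEntropy K₁ m w j ≤ Real.log (D.checkMass K₁ m j) := by
  have h := sum_negMulLog_add_mul_log_le hw (fun B _ => (patternMass_pos K₁ m j B).le)
    (fun B _ h => absurd h (patternMass_pos K₁ m j B).ne')
  rwa [hsum, Real.negMulLog_one, zero_add, one_mul, ← checkFreeEntropy_eq_sum] at h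

theorem checkFreeEntropy_eq_iff :
    D.checkFreeEntropy K₁ m w j = Real.log (D.checkMass K₁ m j) ↔
      ∀ B ∈ D.patterns j, w j B = D.wOf K₁ m j B := by
  have h := sum_negMulLog_add_mul_log_eq_iff hw (fun B _ => (patternMass_pos K₁ m j B).le)
    (fun B _ h => absurd h (patternMass_pos K₁ m j B).ne')
  rw [hsum, Real.negMulLog_one, zero_add, one_mul, ← checkFreeEntropy_eq_sum] at h
  refine h.trans (forall₂_congr fun B hB => ?_)
  rw [D.wOf_eq_div K₁ m j hB, one_mul, checkMass]

end Check

/-! ### Weak duality -/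

section Linear

variable (D : JointDecoding N M S E)

/-- The probability that bit `i` is `1` under the edge variables `g`. -/
def marg (g : Fin N → E → ℝ) (i : Fin N) : ℝ :=
  ∑ e ∈ D.sec i with D.inp e = true, g i e

variable {D} in
theorem sum_sum_pattern_eq {w : Fin M → Finset (Fin N) → ℝ} {q : Fin N → ℝ}
    (h : ∀ i, ∀ j ∈ D.bitNbr i, ∑ B ∈ D.patterns j with i ∈ B, w j B = q i)
    (m : Fin N → Fin M → ℝ) :
    ∑ j, ∑ B ∈ D.patterns j, w j B * ∑ i ∈ B, m i j =
      ∑ i, (∑ j ∈ D.bitNbr i, m i j) * q i := by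
  have hswap (j : Fin M) : ∑ B ∈ D.patterns j, w j B * ∑ i ∈ B, m i j =
      ∑ i, m i j * ∑ B ∈ D.patterns j with i ∈ B, w j B := by
    simp only [Finset.mul_sum, Finset.sum_filter]
    rw [Finset.sum_comm]
    refine Finset.sum_congr rfl fun B _ => ?_
    simp only [mul_ite, mul_zero, ← Finset.sum_filter, Finset.filter_univ_mem]
    exact Finset.sum_congr rfl fun i _ => mul_comm _ _
  rw [Finset.sum_congr rfl fun j _ => hswap j, Finset.sum_comm]
  refine Finset.sum_congr rfl fun i _ => ?_
  rw [Finset.sum_mul, ← Finset.sum_subset (Finset.subset_univ (D.bitNbr i))]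
  · exact Finset.sum_congr rfl fun j hj => by rw [h i j hj]
  · intro j _ hj
    rw [Finset.filter_false_of_mem fun B hB hi => hj (mem_bitNbr_of_mem_pattern hB hi),
      Finset.sum_empty, mul_zero]

theorem sum_mul_log_lam (K₂ : ℝ) (m : Fin N → Fin M → ℝ) (g : Fin N → E → ℝ) :
    ∑ i, ∑ e ∈ D.sec i, g i e * Real.log (D.lam K₂ m i e) =
      -K₂ * (D.cost g - ∑ i, (∑ j ∈ D.bitNbr i, m i j) * D.marg g i) := by
  rw [cost, ← Finset.sum_sub_distrib, Finset.mul_sum]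
  refine Finset.sum_congr rfl fun i _ => ?_
  rw [marg, Finset.sum_filter, Finset.mul_sum, ← Finset.sum_sub_distrib, Finset.mul_sum]
  refine Finset.sum_congr rfl fun e _ => ?_
  rw [lam, Real.log_exp, Gam]
  split_ifs <;> ring

end Linear

section Dual

variable [Fintype S] [DecidableEq S]

/-- The objective of Problem-DS in terms of the partition functions of the checks and of the
trellis, which does not refer to a section. -/
noncomputable def dual (D : JointDecoding N M S E) (K₁ K₂ : ℝ) (m : Fin N → Fin M → ℝ) : ℝ :=
  -(1 / K₁) * ∑ j, Real.log (D.checkMass K₁ m j) - 1 / K₂ * Real.log (D.trellisMass K₂ m)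

theorem dsObj_eq_dual (D : JointDecoding N M S E) (K₁ K₂ : ℝ) (p : Fin N) :
    D.dsObj K₁ K₂ p = D.dual K₁ K₂ := by
  funext m
  have hpattern (j : Fin M) (B : Finset (Fin N)) (hB : B ∈ D.patterns j) :
      Real.exp (-K₁ * ∑ i ∈ D.checkNbr j, if i ∈ B then m i j else 0) = patternMass K₁ m j B := by
    rw [patternMass, ← Finset.sum_filter, Finset.filter_mem_eq_inter,
      Finset.inter_eq_right.2 (mem_patterns.1 hB).1]
  have htrellis := D.sum_edgeMass K₂ m p
  simp only [edgeMass] at htrellis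
  rw [dsObj, dual, htrellis]
  congr 2
  exact Finset.sum_congr rfl fun j _ => by rw [Finset.sum_congr rfl (hpattern j), checkMass]

variable {D : JointDecoding N M S E} {K₁ K₂ : ℝ} (hK₁ : 0 < K₁) (hK₂ : 0 < K₂)
  {x : (Fin N → E → ℝ) × (Fin M → Finset (Fin N) → ℝ)} (hx : D.Feasible x)
include hK₁ hK₂ hx

theorem Feasible.psObj_sub_dual_eq (m : Fin N → Fin M → ℝ) :
    D.psObj K₁ K₂ x - D.dual K₁ K₂ m =
      1 / K₁ * ∑ j, (Real.log (D.checkMass K₁ m j) - D.checkFreeEntropy K₁ m x.2 j) +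
      1 / K₂ * (Real.log (D.trellisMass K₂ m) - D.freeEntropy K₂ m x.1) := by
  simp only [freeEntropy, checkFreeEntropy]
  rw [sum_mul_log_lam, Finset.sum_sub_distrib, Finset.sum_sub_distrib, ← Finset.mul_sum,
    sum_sum_pattern_eq (q := D.marg x.1) hx.coupling, dual, psObj]
  field_simp
  ring

theorem Feasible.dual_le_psObj (hN : 0 < N) (m : Fin N → Fin M → ℝ) :
    D.dual K₁ K₂ m ≤ D.psObj K₁ K₂ x := by
  rw [← sub_nonneg, hx.psObj_sub_dual_eq hK₁ hK₂]
  have hcheck := Finset.sum_nonneg fun j (_ : j ∈ Finset.univ) =>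
    sub_nonneg.2 (checkFreeEntropy_le K₁ m (hx.w_nonneg j) (hx.w_sum j))
  have htrellis := sub_nonneg.2 (hx.isFlow.freeEntropy_le K₂ m hN)
  positivity

theorem Feasible.dual_eq_psObj_iff (hD : D.AcceptsAllInputs) (hN : 0 < N)
    (m : Fin N → Fin M → ℝ) :
    D.dual K₁ K₂ m = D.psObj K₁ K₂ x ↔ x = (D.gOf K₂ m, D.wOf K₁ m) := by
  have hcheck (j : Fin M) (_ : j ∈ Finset.univ) :=
    sub_nonneg.2 (checkFreeEntropy_le K₁ m (hx.w_nonneg j) (hx.w_sum j))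
  have htrellis := sub_nonneg.2 (hx.isFlow.freeEntropy_le K₂ m hN)
  rw [eq_comm, ← sub_eq_zero, hx.psObj_sub_dual_eq hK₁ hK₂, add_eq_zero_iff_of_nonneg
    (mul_nonneg (by positivity) (Finset.sum_nonneg hcheck)) (mul_nonneg (by positivity) htrellis),
    mul_eq_zero_iff_left (by positivity), mul_eq_zero_iff_left (by positivity),
    Finset.sum_eq_zero_iff_of_nonneg hcheck]
  simp only [sub_eq_zero, eq_comm (a := Real.log _), Finset.mem_univ, forall_const,
    checkFreeEntropy_eq_iff K₁ m (hx.w_nonneg _) (hx.w_sum _)]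
  constructor
  · rintro ⟨hw, hg⟩
    refine Prod.ext (funext₂ fun i e => ?_) (funext₂ fun j B => ?_)
    · by_cases he : e ∈ D.sec i
      · exact hD.eq_gOf_of_freeEntropy_eq hx.isFlow hg i he
      · simp only [hx.g_off i e he, gOf, if_neg he]
    · by_cases hB : B ∈ D.patterns j
      · exact hw j B hB
      · simp only [hx.w_off j B hB, wOf, if_neg hB]
  · rintro rfl
    exact ⟨fun _ _ _ => rfl, hD.freeEntropy_gOf K₂ m hN⟩

end Dual

/-! ### Changing the messages of one bit -/

section AddSingle

theorem sum_add_single (m : Fin N → Fin M → ℝ) (p : Fin N) (Δ : Fin M → ℝ) (j : Fin M)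
    (B : Finset (Fin N)) :
    ∑ i ∈ B, (m + Pi.single p Δ : Fin N → Fin M → ℝ) i j =
      ∑ i ∈ B, m i j + if p ∈ B then Δ j else 0 := by
  simp only [Pi.add_apply, Finset.sum_add_distrib]
  congr 1
  rw [← Finset.sum_apply, ← Finset.sum_ite_eq' B p fun _ => Δ j, Finset.sum_apply]
  refine Finset.sum_congr rfl fun i _ => ?_
  rw [Pi.single_apply]
  split_ifs <;> rfl

variable (D : JointDecoding N M S E) (K₁ K₂ : ℝ) (m : Fin N → Fin M → ℝ) (p : Fin N)
  (Δ : Fin M → ℝ)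

theorem patternMass_add_single (j : Fin M) (B : Finset (Fin N)) :
    patternMass K₁ (m + Pi.single p Δ) j B =
      (if p ∈ B then Real.exp (-K₁ * Δ j) else 1) * patternMass K₁ m j B := by
  rw [patternMass, patternMass, sum_add_single]
  split_ifs
  · rw [← Real.exp_add]
    ring_nf
  · rw [add_zero, one_mul]

theorem checkMassZero_add_single (j : Fin M) :
    D.checkMassZero K₁ (m + Pi.single p Δ) p j = D.checkMassZero K₁ m p j :=
  Finset.sum_congr rfl fun B hB => by
    rw [patternMass_add_single, if_neg (Finset.mem_filter.1 hB).2, one_mul]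

theorem checkMassOne_add_single (j : Fin M) :
    D.checkMassOne K₁ (m + Pi.single p Δ) p j =
      Real.exp (-K₁ * Δ j) * D.checkMassOne K₁ m p j := by
  rw [checkMassOne, checkMassOne, Finset.mul_sum]
  exact Finset.sum_congr rfl fun B hB => by
    rw [patternMass_add_single, if_pos (Finset.mem_filter.1 hB).2]

variable {D p} in
theorem checkMass_add_single_of_notMem {j : Fin M} (hj : j ∉ D.bitNbr p) :
    D.checkMass K₁ (m + Pi.single p Δ) j = D.checkMass K₁ m j :=
  Finset.sum_congr rfl fun B hB => by
    rw [patternMass_add_single, if_neg fun hp => hj (mem_bitNbr_of_mem_pattern hB hp), one_mul]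

variable {D p} in
theorem log_checkMass_add_single {j : Fin M} (hj : j ∈ D.bitNbr p)
    (hcard : (D.checkNbr j).card ≠ 1) :
    Real.log (D.checkMass K₁ (m + Pi.single p Δ) j) = Real.log (D.checkMass K₁ m j) +
      (softplus (D.checkLogit K₁ m p j + K₁ * Δ j) - softplus (D.checkLogit K₁ m p j)) := by
  have hzero := D.checkMassZero_pos K₁ m p j
  have hone := checkMassOne_pos K₁ m hj hcard
  rw [← D.checkMassZero_add_checkMassOne K₁ m p j, ← D.checkMassZero_add_checkMassOne K₁ _ p j,
    checkMassZero_add_single, checkMassOne_add_single, log_add_eq_log_add_softplus hzero hone,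
    log_add_eq_log_add_softplus hzero (by positivity), log_div_exp_mul hzero hone, checkLogit]
  ring_nf

theorem Gam_add_single (e : E) :
    D.Gam (m + Pi.single p Δ) p e =
      D.Gam m p e - if D.inp e = true then ∑ j ∈ D.bitNbr p, Δ j else 0 := by
  simp only [Gam, Pi.add_apply, Pi.single_eq_same, Finset.sum_add_distrib]
  split_ifs <;> ring

theorem lam_add_single_of_ne {i : Fin N} (h : i ≠ p) :
    D.lam K₂ (m + Pi.single p Δ) i = D.lam K₂ m i := by
  funext e
  simp only [lam, Gam, Pi.add_apply, Pi.single_eq_of_ne h, Pi.zero_apply, add_zero]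

variable [DecidableEq S]

variable {m} in
theorem fwd_congr {m' : Fin N → Fin M → ℝ} (n : ℕ)
    (h : ∀ i : Fin N, (i : ℕ) < n → D.lam K₂ m i = D.lam K₂ m' i) :
    D.fwd K₂ m n = D.fwd K₂ m' n := by
  induction n with
  | zero => rfl
  | succ n ih =>
    funext k
    rw [fwd, fwd, ih fun i hi => h i (by omega)]
    split_ifs with hn
    · rw [h ⟨n, hn⟩ n.lt_succ_self]
    · rfl

variable {m} in
theorem bwdRev_congr {m' : Fin N → Fin M → ℝ} (r : ℕ)
    (h : ∀ i : Fin N, N - r ≤ (i : ℕ) → D.lam K₂ m i = D.lam K₂ m' i) :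
    D.bwdRev K₂ m r = D.bwdRev K₂ m' r := by
  induction r with
  | zero => rfl
  | succ r ih =>
    funext k
    rw [bwdRev, bwdRev, ih fun i hi => h i (by omega)]
    split_ifs with hr
    · rw [h ⟨N - 1 - r, by omega⟩ (by dsimp only; omega)]
    · rfl

theorem edgeMass_add_single (e : E) :
    D.edgeMass K₂ (m + Pi.single p Δ) p e =
      Real.exp (K₂ * if D.inp e = true then ∑ j ∈ D.bitNbr p, Δ j else 0) *
        D.edgeMass K₂ m p e := by
  have hfwd : D.fwd K₂ (m + Pi.single p Δ) p = D.fwd K₂ m p :=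
    D.fwd_congr K₂ p fun i hi => D.lam_add_single_of_ne K₂ m p Δ (Fin.ne_of_lt hi)
  have hbwd : D.bwd K₂ (m + Pi.single p Δ) (p + 1) = D.bwd K₂ m (p + 1) :=
    D.bwdRev_congr K₂ _ fun i hi => D.lam_add_single_of_ne K₂ m p Δ (by rintro rfl; omega)
  rw [edgeMass, edgeMass, hfwd, hbwd, lam, lam, Gam_add_single, mul_sub, sub_eq_neg_add,
    Real.exp_add]
  ring_nf

theorem bitMass_add_single_false :
    D.bitMass K₂ (m + Pi.single p Δ) p false = D.bitMass K₂ m p false := by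
  refine Finset.sum_congr rfl fun e he => ?_
  simp [edgeMass_add_single, (Finset.mem_filter.1 he).2]

theorem bitMass_add_single_true :
    D.bitMass K₂ (m + Pi.single p Δ) p true =
      Real.exp (K₂ * ∑ j ∈ D.bitNbr p, Δ j) * D.bitMass K₂ m p true := by
  rw [bitMass, bitMass, Finset.mul_sum]
  refine Finset.sum_congr rfl fun e he => ?_
  simp [edgeMass_add_single, (Finset.mem_filter.1 he).2]

variable {D} [Fintype S] (hD : D.AcceptsAllInputs)
include hD

theorem AcceptsAllInputs.log_trellisMass_add_single :
    Real.log (D.trellisMass K₂ (m + Pi.single p Δ)) = Real.log (D.trellisMass K₂ m) +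
      (softplus (D.bitLogit K₂ m p - K₂ * ∑ j ∈ D.bitNbr p, Δ j) -
        softplus (D.bitLogit K₂ m p)) := by
  have hzero := hD.bitMass_pos K₂ m p false
  have hone := hD.bitMass_pos K₂ m p true
  simp only [← D.sum_edgeMass K₂ _ p, ← bitMass_false_add_bitMass_true]
  rw [bitMass_add_single_false, bitMass_add_single_true, log_add_eq_log_add_softplus hzero hone,
    log_add_eq_log_add_softplus hzero (by positivity), log_div_exp_mul hzero hone, bitLogit]
  ring

theorem AcceptsAllInputs.dual_add_single_sub_dual (hcheck : ∀ j, (D.checkNbr j).card ≠ 1) :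
    D.dual K₁ K₂ (m + Pi.single p Δ) - D.dual K₁ K₂ m =
      1 / K₁ * ∑ j ∈ D.bitNbr p, (softplus (D.checkLogit K₁ m p j) -
        softplus (D.checkLogit K₁ m p j + K₁ * Δ j)) +
      1 / K₂ * (softplus (D.bitLogit K₂ m p) -
        softplus (D.bitLogit K₂ m p - K₂ * ∑ j ∈ D.bitNbr p, Δ j)) := by
  have hchecks : ∑ j, (Real.log (D.checkMass K₁ m j) -
        Real.log (D.checkMass K₁ (m + Pi.single p Δ) j)) =
      ∑ j ∈ D.bitNbr p, (softplus (D.checkLogit K₁ m p j) -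
        softplus (D.checkLogit K₁ m p j + K₁ * Δ j)) := by
    rw [← Finset.sum_subset (Finset.subset_univ (D.bitNbr p)) fun j _ hj => by
      rw [checkMass_add_single_of_notMem K₁ m Δ hj, sub_self]]
    refine Finset.sum_congr rfl fun j hj => ?_
    rw [log_checkMass_add_single K₁ m Δ hj (hcheck j)]
    ring
  rw [← hchecks, Finset.sum_sub_distrib, dual, dual, hD.log_trellisMass_add_single]
  ring

end AddSingle

/-! ### Monotonicity of the algorithm -/

section Update

/-- The update of bit `p` with step size `τ`, which moves the checks' log-odds of the bit towards
that of the trellis. `bitUpdate` has step size `1 / K₁`. -/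
noncomputable def bitStep [DecidableEq S] (D : JointDecoding N M S E) (K₁ K₂ τ : ℝ) (p : Fin N)
    (m : Fin N → Fin M → ℝ) : Fin N → Fin M → ℝ :=
  m + Pi.single p fun j =>
    if j ∈ D.bitNbr p then τ * (D.bitLogit K₂ m p - D.checkLogit K₁ m p j) else 0

theorem bitStep_eq_self [DecidableEq S] {D : JointDecoding N M S E} {K₁ K₂ : ℝ} (τ : ℝ)
    {p : Fin N} {m : Fin N → Fin M → ℝ}
    (h : ∀ j ∈ D.bitNbr p, D.checkLogit K₁ m p j = D.bitLogit K₂ m p) :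
    D.bitStep K₁ K₂ τ p m = m := by
  rw [bitStep, add_eq_left, Pi.single_eq_zero_iff]
  funext j
  split_ifs with hj
  · rw [h j hj, sub_self, mul_zero, Pi.zero_apply]
  · rfl

variable [Fintype S] [DecidableEq S] {D : JointDecoding N M S E} (hD : D.AcceptsAllInputs)
  (hcheck : ∀ j, (D.checkNbr j).card ≠ 1) {K₁ K₂ : ℝ} (hK₁ : 0 < K₁)
include hD hcheck hK₁

theorem AcceptsAllInputs.bitUpdate_eq_bitStep (K₂ : ℝ) (p : Fin N) (m : Fin N → Fin M → ℝ) :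
    D.bitUpdate K₁ K₂ p m = D.bitStep K₁ K₂ (1 / K₁) p m := by
  funext i j
  rw [bitUpdate, bitStep, Pi.add_apply, Pi.add_apply]
  rcases eq_or_ne i p with rfl | hi
  · rw [Pi.single_eq_same]
    by_cases hj : j ∈ D.bitNbr i
    · rw [if_pos ⟨rfl, hj⟩, if_pos hj, checkMsg_eq_sub_checkLogit_div m hK₁.ne' hj (hcheck j),
        hD.gam_eq_bitLogit]
      ring
    · rw [if_neg fun h => hj h.2, if_neg hj, add_zero]
  · rw [if_neg fun h => hi h.1, Pi.single_eq_of_ne hi, Pi.zero_apply, add_zero]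

variable (hK₂ : 0 < K₂) {τ : ℝ}
include hK₂

/-- Convexity of `softplus` bounds the loss at each check by `τ` times the change of `softplus` from
its own log-odds to that of the trellis. -/
theorem AcceptsAllInputs.le_dual_bitStep_sub_dual (hτ : 0 ≤ τ) (hτK₁ : K₁ * τ ≤ 1) (p : Fin N)
    (m : Fin N → Fin M → ℝ) :
    1 / K₂ * (softplus (D.bitLogit K₂ m p) - K₂ * τ *
        ∑ j ∈ D.bitNbr p, (softplus (D.bitLogit K₂ m p) - softplus (D.checkLogit K₁ m p j)) -
      softplus (D.bitLogit K₂ m p - (K₂ * τ) •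
        ∑ j ∈ D.bitNbr p, (D.bitLogit K₂ m p - D.checkLogit K₁ m p j))) ≤
    D.dual K₁ K₂ (D.bitStep K₁ K₂ τ p m) - D.dual K₁ K₂ m := by
  rw [bitStep, hD.dual_add_single_sub_dual K₁ K₂ m p _ hcheck]
  set y := D.bitLogit K₂ m p
  set t := D.checkLogit K₁ m p
  have hgain : ∀ j ∈ D.bitNbr p, K₁ * τ * (softplus (t j) - softplus y) ≤
      softplus (t j) - softplus (t j + K₁ * if j ∈ D.bitNbr p then τ * (y - t j) else 0) := by
    intro j hj
    rw [if_pos hj]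
    have h := strictConvexOn_softplus.convexOn.2 (Set.mem_univ (t j)) (Set.mem_univ y)
      (sub_nonneg.2 hτK₁) (by positivity : 0 ≤ K₁ * τ) (sub_add_cancel _ _)
    simp only [smul_eq_mul] at h
    rw [show (1 - K₁ * τ) * t j + K₁ * τ * y = t j + K₁ * (τ * (y - t j)) by ring] at h
    linarith
  have hsum := mul_le_mul_of_nonneg_left (Finset.sum_le_sum hgain) (one_div_pos.2 hK₁).le
  refine le_trans (le_of_eq ?_) (add_le_add_left hsum _)
  rw [Finset.sum_congr rfl fun j hj => if_pos hj, ← Finset.mul_sum, ← Finset.mul_sum, smul_eq_mul,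
    ← mul_assoc K₂]
  simp only [Finset.sum_sub_distrib]
  field_simp
  ring

variable (hτ : 0 < τ) (hτK₁ : K₁ * τ ≤ 1) {p : Fin N} (hτK₂ : (D.bitNbr p).card * (K₂ * τ) < 1)
  (m : Fin N → Fin M → ℝ)
include hτ hτK₁ hτK₂

theorem AcceptsAllInputs.dual_le_dual_bitStep :
    D.dual K₁ K₂ m ≤ D.dual K₁ K₂ (D.bitStep K₁ K₂ τ p m) := by
  have hjensen := map_sub_smul_sum_le (y := D.bitLogit K₂ m p) (t := D.checkLogit K₁ m p)
    strictConvexOn_softplus.convexOn (by positivity) hτK₂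
  exact sub_nonneg.1 <| (mul_nonneg (one_div_pos.2 hK₂).le (sub_nonneg.2 hjensen)).trans <|
    hD.le_dual_bitStep_sub_dual hcheck hK₁ hK₂ hτ.le hτK₁ p m

variable {m} in
theorem AcceptsAllInputs.checkLogit_eq_bitLogit_of_dual_bitStep_le
    (h : D.dual K₁ K₂ (D.bitStep K₁ K₂ τ p m) ≤ D.dual K₁ K₂ m) :
    ∀ j ∈ D.bitNbr p, D.checkLogit K₁ m p j = D.bitLogit K₂ m p := by
  have hpos : 0 < K₂ * τ := by positivity
  refine eq_of_map_sub_smul_sum_eq strictConvexOn_softplus hpos hτK₂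
    (le_antisymm (map_sub_smul_sum_le strictConvexOn_softplus.convexOn hpos hτK₂) ?_)
  have hgain := (hD.le_dual_bitStep_sub_dual hcheck hK₁ hK₂ hτ.le hτK₁ p m).trans
    (sub_nonpos.2 h)
  exact sub_nonpos.1 (nonpos_of_mul_nonpos_right hgain (one_div_pos.2 hK₂))

end Update

section Stationary

/-- Messages at which the checks and the trellis agree on the distribution of every bit. -/
def IsStationary [DecidableEq S] (D : JointDecoding N M S E) (K₁ K₂ : ℝ)
    (m : Fin N → Fin M → ℝ) : Prop :=
  ∀ p, ∀ j ∈ D.bitNbr p, D.checkLogit K₁ m p j = D.bitLogit K₂ m p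

variable [Fintype S] [DecidableEq S] {D : JointDecoding N M S E} (hD : D.AcceptsAllInputs)
  (hcheck : ∀ j, (D.checkNbr j).card ≠ 1) {K₁ K₂ : ℝ}
include hD hcheck

theorem IsStationary.feasible {m : Fin N → Fin M → ℝ} (hm : D.IsStationary K₁ K₂ m) :
    D.Feasible (D.gOf K₂ m, D.wOf K₁ m) where
  w_sum j := by
    dsimp only
    rw [Finset.sum_congr rfl fun B hB => D.wOf_eq_div K₁ m j hB, ← Finset.sum_div]
    exact div_self (D.checkMass_pos K₁ m j).ne'
  g_sum := (hD.isFlow_gOf K₂ m).g_sum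
  coupling i j hj := by
    dsimp only
    rw [Finset.sum_congr rfl fun B hB => D.wOf_eq_div K₁ m j (Finset.mem_filter.1 hB).1,
      Finset.sum_congr rfl fun e he => hD.gOf_eq_div K₂ m i (Finset.mem_filter.1 he).1,
      ← Finset.sum_div, ← Finset.sum_div, ← checkMassOne, ← bitMass,
      ← D.checkMassZero_add_checkMassOne K₁ m i j, ← D.sum_edgeMass K₂ m i,
      ← bitMass_false_add_bitMass_true]
    have hzero := D.checkMassZero_pos K₁ m i j
    have hone := checkMassOne_pos K₁ m hj (hcheck j)
    have hfalse := hD.bitMass_pos K₂ m i false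
    have htrue := hD.bitMass_pos K₂ m i true
    have hodds := Real.log_injOn_pos (Set.mem_Ioi.2 (by positivity)) (Set.mem_Ioi.2 (by positivity))
      (hm i j hj)
    rw [div_eq_div_iff hone.ne' htrue.ne'] at hodds
    rw [div_eq_div_iff (by positivity) (by positivity)]
    linear_combination -hodds
  flow := (hD.isFlow_gOf K₂ m).flow
  w_nonneg j B hB := by
    dsimp only
    rw [D.wOf_eq_div K₁ m j hB]
    exact div_nonneg (patternMass_pos K₁ m j B).le (D.checkMass_pos K₁ m j).le
  g_nonneg := (hD.isFlow_gOf K₂ m).g_nonneg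
  w_off j B hB := if_neg hB
  g_off i e he := if_neg he

variable (hK₁ : 0 < K₁) (hK₂ : 0 < K₂)
include hK₁ hK₂

theorem IsStationary.dual_eq (hN : 0 < N) {m : Fin N → Fin M → ℝ} (hm : D.IsStationary K₁ K₂ m) :
    D.dual K₁ K₂ m = D.psObj K₁ K₂ (D.gOf K₂ m, D.wOf K₁ m) :=
  ((hm.feasible hD hcheck).dual_eq_psObj_iff hK₁ hK₂ hD hN m).2 rfl

theorem isStationary_of_forall_dual_le {m : Fin N → Fin M → ℝ}
    (hm : ∀ m', D.dual K₁ K₂ m' ≤ D.dual K₁ K₂ m) : D.IsStationary K₁ K₂ m := by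
  intro p
  refine hD.checkLogit_eq_bitLogit_of_dual_bitStep_le hcheck hK₁ hK₂
    (τ := 1 / (K₁ + (D.bitNbr p).card * K₂)) (by positivity) ?_ ?_ (hm _)
  · rw [mul_one_div, div_le_one (by positivity)]
    exact le_add_of_nonneg_right (by positivity)
  · rw [← mul_assoc, mul_one_div, div_lt_one (by positivity)]
    exact lt_add_of_pos_left _ hK₁

variable (hK : ∀ i, ((D.bitNbr i).card : ℝ) * K₂ < K₁)
include hK

theorem dual_le_dual_bitUpdate (p : Fin N) (m : Fin N → Fin M → ℝ) :
    D.dual K₁ K₂ m ≤ D.dual K₁ K₂ (D.bitUpdate K₁ K₂ p m) := by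
  rw [hD.bitUpdate_eq_bitStep hcheck hK₁]
  refine hD.dual_le_dual_bitStep hcheck hK₁ hK₂ (one_div_pos.2 hK₁)
    (mul_one_div_cancel hK₁.ne').le ?_ m
  rw [← mul_assoc, mul_one_div, div_lt_one hK₁]
  exact hK p

theorem checkLogit_eq_bitLogit_of_dual_bitUpdate_le {p : Fin N} {m : Fin N → Fin M → ℝ}
    (h : D.dual K₁ K₂ (D.bitUpdate K₁ K₂ p m) ≤ D.dual K₁ K₂ m) :
    ∀ j ∈ D.bitNbr p, D.checkLogit K₁ m p j = D.bitLogit K₂ m p := by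
  rw [hD.bitUpdate_eq_bitStep hcheck hK₁] at h
  refine hD.checkLogit_eq_bitLogit_of_dual_bitStep_le hcheck hK₁ hK₂ (one_div_pos.2 hK₁)
    (mul_one_div_cancel hK₁.ne').le ?_ h
  rw [← mul_assoc, mul_one_div, div_lt_one hK₁]
  exact hK p

theorem dual_le_dual_foldl_bitUpdate (L : List (Fin N)) (m : Fin N → Fin M → ℝ) :
    D.dual K₁ K₂ m ≤ D.dual K₁ K₂ (L.foldl (fun m' p => D.bitUpdate K₁ K₂ p m') m) := by
  induction L generalizing m with
  | nil => rfl
  | cons p L ih => exact (dual_le_dual_bitUpdate hD hcheck hK₁ hK₂ hK p m).trans (ih _)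

theorem checkLogit_eq_bitLogit_of_dual_foldl_bitUpdate_le {L : List (Fin N)}
    {m : Fin N → Fin M → ℝ}
    (h : D.dual K₁ K₂ (L.foldl (fun m' p => D.bitUpdate K₁ K₂ p m') m) ≤ D.dual K₁ K₂ m) :
    ∀ p ∈ L, ∀ j ∈ D.bitNbr p, D.checkLogit K₁ m p j = D.bitLogit K₂ m p := by
  induction L with
  | nil => simp
  | cons p L ih =>
    have hp := checkLogit_eq_bitLogit_of_dual_bitUpdate_le hD hcheck hK₁ hK₂ hK
      ((dual_le_dual_foldl_bitUpdate hD hcheck hK₁ hK₂ hK L _).trans h)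
    rw [List.foldl_cons, hD.bitUpdate_eq_bitStep hcheck hK₁, bitStep_eq_self _ hp] at h
    exact List.forall_mem_cons.2 ⟨hp, ih h⟩

theorem dual_le_dual_sweep (m : Fin N → Fin M → ℝ) :
    D.dual K₁ K₂ m ≤ D.dual K₁ K₂ (D.sweep K₁ K₂ m) :=
  dual_le_dual_foldl_bitUpdate hD hcheck hK₁ hK₂ hK _ m

theorem isStationary_of_dual_sweep_le {m : Fin N → Fin M → ℝ}
    (h : D.dual K₁ K₂ (D.sweep K₁ K₂ m) ≤ D.dual K₁ K₂ m) : D.IsStationary K₁ K₂ m :=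
  fun p => checkLogit_eq_bitLogit_of_dual_foldl_bitUpdate_le hD hcheck hK₁ hK₂ hK h p
    (List.mem_finRange p)

end Stationary

/-! ### Bounds on the entropies -/

section EntropyBounds

variable {D : JointDecoding N M S E}

theorem IsFlow.sectionEntropy_nonneg [DecidableEq S] {g : Fin N → E → ℝ} (hg : D.IsFlow g)
    (i : Fin N) : 0 ≤ D.sectionEntropy g i :=
  sum_negMulLog_nonneg (hg.g_nonneg i) (hg.g_sum i)

theorem IsFlow.sectionEntropy_le_card [DecidableEq S] {g : Fin N → E → ℝ} (hg : D.IsFlow g)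
    (i : Fin N) : D.sectionEntropy g i ≤ (D.sec i).card :=
  sum_negMulLog_le_card (hg.g_nonneg i)

theorem Feasible.checkEntropy_nonneg [DecidableEq S]
    {x : (Fin N → E → ℝ) × (Fin M → Finset (Fin N) → ℝ)} (hx : D.Feasible x) (j : Fin M) :
    0 ≤ D.checkEntropy x.2 j :=
  sum_negMulLog_nonneg (hx.w_nonneg j) (hx.w_sum j)

theorem Feasible.checkEntropy_le_card [DecidableEq S]
    {x : (Fin N → E → ℝ) × (Fin M → Finset (Fin N) → ℝ)} (hx : D.Feasible x) (j : Fin M) :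
    D.checkEntropy x.2 j ≤ (D.patterns j).card :=
  sum_negMulLog_le_card (hx.w_nonneg j)

variable [Fintype S] [DecidableEq S] {g : Fin N → E → ℝ} (hg : D.IsFlow g)
include hg

theorem IsFlow.stateEntropy_le_sectionEntropy (i : Fin N) :
    D.stateEntropy g i ≤ D.sectionEntropy g i := by
  rw [stateEntropy, sectionEntropy, ← Finset.sum_fiberwise (D.sec i) D.dst]
  exact Finset.sum_le_sum fun k _ => negMulLog_sum_le_sum_negMulLog fun e he =>
    hg.g_nonneg i e (Finset.mem_filter.1 he).1

theorem IsFlow.stateEntropy_nonneg (i : Fin N) : 0 ≤ D.stateEntropy g i := by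
  refine sum_negMulLog_nonneg (fun k _ => Finset.sum_nonneg fun e he =>
    hg.g_nonneg i e (Finset.mem_filter.1 he).1) ?_
  rw [Finset.sum_fiberwise, hg.g_sum]

theorem IsFlow.trellisEntropy_nonneg (hN : 0 < N) : 0 ≤ D.trellisEntropy g := by
  rw [D.trellisEntropy_eq_sum_sub hN]
  exact add_nonneg
    (Finset.sum_nonneg fun i _ => sub_nonneg.2 (hg.stateEntropy_le_sectionEntropy i))
    (hg.stateEntropy_nonneg _)

theorem IsFlow.trellisEntropy_le_sum_card : D.trellisEntropy g ≤ ∑ i, ((D.sec i).card : ℝ) :=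
  (sub_le_self _ (Finset.sum_nonneg fun i _ => hg.stateEntropy_nonneg i)).trans
    (Finset.sum_le_sum fun i _ => hg.sectionEntropy_le_card i)

end EntropyBounds

/-! ### Coercivity of the dual -/

section PathFlow

open Classical in
/-- The flow that puts all its mass on the path `ε`. -/
noncomputable def pathFlow (ε : Fin N → E) (i : Fin N) (e : E) : ℝ := if e = ε i then 1 else 0

variable {D : JointDecoding N M S E} {ε : Fin N → E} (hε : D.IsPath ε)
include hε

theorem IsPath.sum_pathFlow_mul (i : Fin N) (f : E → ℝ) :
    ∑ e ∈ D.sec i, pathFlow ε i e * f e = f (ε i) := by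
  rw [Finset.sum_eq_single_of_mem _ (hε.1 i) fun e _ he => by rw [pathFlow, if_neg he, zero_mul],
    pathFlow, if_pos rfl, one_mul]

theorem IsPath.isFlow_pathFlow [DecidableEq S] : D.IsFlow (pathFlow ε) where
  g_sum p := by simpa only [mul_one] using hε.sum_pathFlow_mul p fun _ => 1
  flow i h k := by
    have hdst := hε.sum_pathFlow_mul ⟨i, Nat.lt_of_succ_lt h⟩ fun e => if D.dst e = k then 1 else 0
    have hsrc := hε.sum_pathFlow_mul ⟨i + 1, h⟩ fun e => if D.src e = k then 1 else 0
    simp only [mul_ite, mul_one, mul_zero, ← Finset.sum_filter] at hdst hsrc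
    rw [hdst, hsrc, hε.2 i h]
  g_nonneg i e _ := by
    unfold pathFlow
    positivity

end PathFlow

section SoftMin

variable (D : JointDecoding N M S E) (K₁ K₂ : ℝ) (m : Fin N → Fin M → ℝ)

/-- The soft minimum over the patterns of check `j` of the sum of the messages on the pattern. -/
noncomputable def checkSoftMin (j : Fin M) : ℝ := -(1 / K₁) * Real.log (D.checkMass K₁ m j)

/-- The soft minimum over the paths of the trellis of the sum of the metrics `Gam`. -/
noncomputable def trellisSoftMin [Fintype S] [DecidableEq S] : ℝ :=
  -(1 / K₂) * Real.log (D.trellisMass K₂ m)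

/-- The mean over the patterns of check `j` of the sum of the messages on the pattern. -/
noncomputable def checkMean (j : Fin M) : ℝ :=
  ((D.patterns j).card : ℝ)⁻¹ * ∑ B ∈ D.patterns j, ∑ i ∈ B, m i j

theorem sum_checkSoftMin_add_trellisSoftMin [Fintype S] [DecidableEq S] :
    ∑ j, D.checkSoftMin K₁ m j + D.trellisSoftMin K₂ m = D.dual K₁ K₂ m := by
  simp only [checkSoftMin, trellisSoftMin, dual, ← Finset.mul_sum]
  ring

variable {K₁} in
theorem checkSoftMin_le (hK₁ : 0 < K₁) {j : Fin M} {B : Finset (Fin N)} (hB : B ∈ D.patterns j) :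
    D.checkSoftMin K₁ m j ≤ ∑ i ∈ B, m i j := by
  have hle : patternMass K₁ m j B ≤ D.checkMass K₁ m j :=
    Finset.single_le_sum (fun B _ => (patternMass_pos K₁ m j B).le) hB
  have hlog := Real.log_le_log (patternMass_pos K₁ m j B) hle
  rw [patternMass, Real.log_exp] at hlog
  rw [checkSoftMin, neg_mul, one_div_mul_eq_div, neg_le, le_div_iff₀ hK₁]
  linarith

variable {D} {K₂} in
theorem IsPath.trellisSoftMin_le [Fintype S] [DecidableEq S] {ε : Fin N → E} (hε : D.IsPath ε)
    (hN : 0 < N) (hK₂ : 0 < K₂) : D.trellisSoftMin K₂ m ≤ ∑ i, D.Gam m i (ε i) := by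
  have hle := hε.isFlow_pathFlow.freeEntropy_le K₂ m hN
  have hnonneg := hε.isFlow_pathFlow.trellisEntropy_nonneg hN
  simp only [freeEntropy, hε.sum_pathFlow_mul, lam, Real.log_exp, ← Finset.mul_sum] at hle
  rw [trellisSoftMin, neg_mul, one_div_mul_eq_div, neg_le, le_div_iff₀ hK₂]
  linarith

theorem card_patterns_mul_checkMean (j : Fin M) :
    (D.patterns j).card * D.checkMean m j = ∑ B ∈ D.patterns j, ∑ i ∈ B, m i j := by
  have hne : (D.patterns j).card ≠ 0 := Finset.card_ne_zero_of_mem (D.empty_mem_patterns j)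
  rw [checkMean, mul_inv_cancel_left₀ (Nat.cast_ne_zero.2 hne)]

variable {D K₁ m} in
theorem sub_checkSoftMin_le (hK₁ : 0 < K₁) {j : Fin M} {B : Finset (Fin N)}
    (hB : B ∈ D.patterns j) : ∑ i ∈ B, m i j - D.checkSoftMin K₁ m j ≤
      (D.patterns j).card * (D.checkMean m j - D.checkSoftMin K₁ m j) := by
  rw [mul_sub, card_patterns_mul_checkMean, ← nsmul_eq_mul, ← Finset.sum_const,
    ← Finset.sum_sub_distrib]
  exact Finset.single_le_sum (f := fun B => ∑ i ∈ B, m i j - D.checkSoftMin K₁ m j)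
    (fun B hB => sub_nonneg.2 (D.checkSoftMin_le m hK₁ hB)) hB

variable {K₁} in
theorem checkSoftMin_le_checkMean (hK₁ : 0 < K₁) (j : Fin M) :
    D.checkSoftMin K₁ m j ≤ D.checkMean m j := by
  have hpos : 0 < (D.patterns j).card := Finset.card_pos.2 ⟨∅, D.empty_mem_patterns j⟩
  rw [checkMean, le_inv_mul_iff₀ (Nat.cast_pos.2 hpos), ← nsmul_eq_mul]
  exact Finset.card_nsmul_le_sum _ _ _ fun B hB => D.checkSoftMin_le m hK₁ hB

variable {D} in
theorem two_mul_card_filter_patterns {i : Fin N} {j : Fin M} (hij : j ∈ D.bitNbr i)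
    (hj : (D.checkNbr j).card ≠ 1) :
    2 * (((D.patterns j).filter fun B => i ∈ B).card : ℝ) = (D.patterns j).card := by
  have herase : ((D.checkNbr j).erase i).card ≠ 0 := by
    have := Finset.card_erase_add_one (mem_bitNbr.1 hij)
    omega
  have hdiff := sum_even_sub_sum_not_even ((D.checkNbr j).erase i) fun _ => (1 : ℝ)
  have hzero := D.checkMassZero_eq_sum_even 0 0 i j
  have hone := checkMassOne_eq_mul_sum_odd 0 0 hij
  have hadd := D.checkMassZero_add_checkMassOne 0 0 i j
  simp only [checkMass, checkMassOne, checkMassZero, patternMass, neg_zero, zero_mul, Real.exp_zero,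
    Finset.sum_const, nsmul_eq_mul, mul_one, Finset.prod_const_one, sub_self, Finset.prod_const,
    zero_pow herase, one_mul] at hdiff hzero hone hadd
  linarith

variable {D} in
theorem sum_checkMean (hcheck : ∀ j, (D.checkNbr j).card ≠ 1) :
    ∑ j, D.checkMean m j = 1 / 2 * ∑ i, ∑ j ∈ D.bitNbr i, m i j := by
  have hmarg : ∀ i, ∀ j ∈ D.bitNbr i,
      ∑ B ∈ D.patterns j with i ∈ B, ((D.patterns j).card : ℝ)⁻¹ = 1 / 2 := by
    intro i j hij
    have hne : ((D.patterns j).card : ℝ) ≠ 0 :=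
      Nat.cast_ne_zero.2 (Finset.card_ne_zero_of_mem (D.empty_mem_patterns j))
    rw [Finset.sum_const, nsmul_eq_mul, ← div_eq_mul_inv, div_eq_div_iff hne two_ne_zero, one_mul,
      mul_comm, two_mul_card_filter_patterns hij (hcheck j)]
  simp only [checkMean, Finset.mul_sum (D.patterns _)]
  rw [Finset.mul_sum, sum_sum_pattern_eq (q := fun _ => 1 / 2) hmarg]
  exact Finset.sum_congr rfl fun i _ => mul_comm _ _

theorem sum_Gam_eq (ε : Fin N → E) : ∑ i, D.Gam m i (ε i) =
    ∑ i, D.b i (ε i) - ∑ i, if D.inp (ε i) = true then ∑ j ∈ D.bitNbr i, m i j else 0 :=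
  Finset.sum_sub_distrib _ _

variable {D} in
theorem IsPath.abs_sum_b_le {ε : Fin N → E} (hε : D.IsPath ε) :
    |∑ i, D.b i (ε i)| ≤ ∑ i, ∑ e ∈ D.sec i, |D.b i e| :=
  (Finset.abs_sum_le_sum_abs _ _).trans <| Finset.sum_le_sum fun i _ =>
    Finset.single_le_sum (f := fun e => |D.b i e|) (fun _ _ => abs_nonneg _) (hε.1 i)

end SoftMin

section Coercive

variable [Fintype S] [DecidableEq S] {D : JointDecoding N M S E} (hD : D.AcceptsAllInputs)
  (hN : 0 < N) (hcheck : ∀ j, (D.checkNbr j).card ≠ 1) {K₁ K₂ : ℝ} (hK₁ : 0 < K₁) (hK₂ : 0 < K₂)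
  {m : Fin N → Fin M → ℝ}
include hD hN hcheck hK₂

/-- The messages on a path and on one with the complementary input add up to twice the sum of the
pattern means. -/
theorem IsPath.sum_Gam_sub_trellisSoftMin_add_le {ε : Fin N → E} (hε : D.IsPath ε) :
    (∑ i, D.Gam m i (ε i) - D.trellisSoftMin K₂ m) +
      2 * ∑ j, (D.checkMean m j - D.checkSoftMin K₁ m j) ≤
    2 * (∑ i, ∑ e ∈ D.sec i, |D.b i e| - D.dual K₁ K₂ m) := by
  obtain ⟨ε', hε', hinp⟩ := hD fun i => !(D.inp (ε i))
  have hsoft := hε'.trellisSoftMin_le m hN hK₂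
  have hb := (abs_le.1 hε.abs_sum_b_le).2
  have hb' := (abs_le.1 hε'.abs_sum_b_le).2
  have hcompl : (∑ i, if D.inp (ε i) = true then ∑ j ∈ D.bitNbr i, m i j else 0) +
      (∑ i, if D.inp (ε' i) = true then ∑ j ∈ D.bitNbr i, m i j else 0) =
        ∑ i, ∑ j ∈ D.bitNbr i, m i j := by
    rw [← Finset.sum_add_distrib]
    exact Finset.sum_congr rfl fun i _ => by rw [hinp]; cases D.inp (ε i) <;> simp
  rw [sum_Gam_eq] at hsoft ⊢
  rw [Finset.sum_sub_distrib, sum_checkMean m hcheck, ← sum_checkSoftMin_add_trellisSoftMin]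
  linarith

include hK₁

theorem IsPath.sum_Gam_sub_trellisSoftMin_le {ε : Fin N → E} (hε : D.IsPath ε) :
    ∑ i, D.Gam m i (ε i) - D.trellisSoftMin K₂ m ≤
      2 * (∑ i, ∑ e ∈ D.sec i, |D.b i e| - D.dual K₁ K₂ m) := by
  have hchecks := Finset.sum_nonneg fun j (_ : j ∈ Finset.univ) =>
    sub_nonneg.2 (D.checkSoftMin_le_checkMean m hK₁ j)
  linarith [hε.sum_Gam_sub_trellisSoftMin_add_le hD hN hcheck hK₂ (K₁ := K₁) (m := m)]

theorem checkMean_sub_checkSoftMin_le (j : Fin M) : D.checkMean m j - D.checkSoftMin K₁ m j ≤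
    ∑ i, ∑ e ∈ D.sec i, |D.b i e| - D.dual K₁ K₂ m := by
  obtain ⟨ε, hε⟩ := hD.exists_isPath
  have hj := Finset.single_le_sum (fun j _ => sub_nonneg.2 (D.checkSoftMin_le_checkMean m hK₁ j))
    (Finset.mem_univ j)
  linarith [hε.sum_Gam_sub_trellisSoftMin_add_le hD hN hcheck hK₂ (K₁ := K₁) (m := m),
    hε.trellisSoftMin_le m hN hK₂]

theorem abs_sum_bitNbr_le (i : Fin N) : |∑ j ∈ D.bitNbr i, m i j| ≤
    4 * ∑ i, ∑ e ∈ D.sec i, |D.b i e| - 2 * D.dual K₁ K₂ m := by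
  obtain ⟨ε, hε, hinp⟩ := hD fun i' => decide (i' = i)
  obtain ⟨ε', hε', hinp'⟩ := hD fun _ => false
  have hsum := D.sum_Gam_eq m ε
  have hsum' := D.sum_Gam_eq m ε'
  simp only [hinp, hinp', decide_eq_true_eq, Finset.sum_ite_eq', Finset.mem_univ, if_true,
    Bool.false_eq_true, if_false, Finset.sum_const_zero, sub_zero] at hsum hsum'
  have hle := hε.sum_Gam_sub_trellisSoftMin_le hD hN hcheck hK₁ hK₂ (m := m)
  have hle' := hε'.sum_Gam_sub_trellisSoftMin_le hD hN hcheck hK₁ hK₂ (m := m)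
  have hge := hε.trellisSoftMin_le m hN hK₂
  have hge' := hε'.trellisSoftMin_le m hN hK₂
  have hb := abs_le.1 hε.abs_sum_b_le
  have hb' := abs_le.1 hε'.abs_sum_b_le
  exact abs_le.2 ⟨by linarith, by linarith⟩

theorem abs_sum_pattern_le {j : Fin M} {B : Finset (Fin N)} (hB : B ∈ D.patterns j) :
    |∑ i ∈ B, m i j| ≤
      (D.patterns j).card * (∑ i, ∑ e ∈ D.sec i, |D.b i e| - D.dual K₁ K₂ m) := by
  have hmean := mul_le_mul_of_nonneg_left
    (checkMean_sub_checkSoftMin_le hD hN hcheck hK₁ hK₂ (m := m) j)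
    (Nat.cast_nonneg (α := ℝ) (D.patterns j).card)
  have hle := sub_checkSoftMin_le hK₁ hB (m := m)
  have hge := D.checkSoftMin_le m hK₁ hB
  have hle' := sub_checkSoftMin_le hK₁ (D.empty_mem_patterns j) (m := m)
  have hge' := D.checkSoftMin_le m hK₁ (D.empty_mem_patterns j)
  rw [Finset.sum_empty] at hle' hge'
  exact abs_le.2 ⟨by linarith, by linarith⟩

end Coercive

/-! ### Natural parameters -/

section Invariance

/-- The linear functionals of the messages on which the beliefs depend: their sums over the checks
of a bit and over the patterns of a check. -/
def natParam (D : JointDecoding N M S E) :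
    (Fin N → Fin M → ℝ) →ₗ[ℝ] (Fin N → ℝ) × (Fin M → Finset (Fin N) → ℝ) where
  toFun m := (fun i => ∑ j ∈ D.bitNbr i, m i j,
    fun j B => if B ∈ D.patterns j then ∑ i ∈ B, m i j else 0)
  map_add' m m' := by
    ext
    · simp only [Pi.add_apply, Finset.sum_add_distrib, Prod.mk_add_mk]
    · simp only [Pi.add_apply, Finset.sum_add_distrib, Prod.mk_add_mk, ite_add_ite, add_zero]
  map_smul' c m := by
    ext
    · simp only [Pi.smul_apply, smul_eq_mul, ← Finset.mul_sum, Prod.smul_mk, RingHom.id_apply]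
    · simp only [Pi.smul_apply, smul_eq_mul, ← Finset.mul_sum, Prod.smul_mk, RingHom.id_apply,
        mul_ite, mul_zero]

variable {D : JointDecoding N M S E} {m m' : Fin N → Fin M → ℝ} (h : D.natParam m = D.natParam m')
  (K₁ K₂ : ℝ)
include h

theorem sum_pattern_eq_of_natParam_eq {j : Fin M} {B : Finset (Fin N)} (hB : B ∈ D.patterns j) :
    ∑ i ∈ B, m i j = ∑ i ∈ B, m' i j := by
  simpa only [natParam, LinearMap.coe_mk, AddHom.coe_mk, if_pos hB] using
    congrFun (congrFun (congrArg Prod.snd h) j) B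

theorem patternMass_eq_of_natParam_eq {j : Fin M} {B : Finset (Fin N)} (hB : B ∈ D.patterns j) :
    patternMass K₁ m j B = patternMass K₁ m' j B := by
  rw [patternMass, patternMass, sum_pattern_eq_of_natParam_eq h hB]

theorem checkMass_eq_of_natParam_eq (j : Fin M) : D.checkMass K₁ m j = D.checkMass K₁ m' j :=
  Finset.sum_congr rfl fun _ hB => patternMass_eq_of_natParam_eq h K₁ hB

theorem wOf_eq_of_natParam_eq : D.wOf K₁ m = D.wOf K₁ m' := by
  funext j B
  by_cases hB : B ∈ D.patterns j
  · rw [wOf_eq_div D K₁ m j hB, wOf_eq_div D K₁ m' j hB, patternMass_eq_of_natParam_eq h K₁ hB,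
      checkMass_eq_of_natParam_eq h]
  · rw [wOf, wOf, if_neg hB, if_neg hB]

theorem checkLogit_eq_of_natParam_eq (i : Fin N) (j : Fin M) :
    D.checkLogit K₁ m i j = D.checkLogit K₁ m' i j := by
  have hzero : D.checkMassZero K₁ m i j = D.checkMassZero K₁ m' i j := Finset.sum_congr rfl
    fun _ hB => patternMass_eq_of_natParam_eq h K₁ (Finset.mem_filter.1 hB).1
  have hone : D.checkMassOne K₁ m i j = D.checkMassOne K₁ m' i j := Finset.sum_congr rfl
    fun _ hB => patternMass_eq_of_natParam_eq h K₁ (Finset.mem_filter.1 hB).1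
  rw [checkLogit, checkLogit, hzero, hone]

theorem lam_eq_of_natParam_eq (i : Fin N) : D.lam K₂ m i = D.lam K₂ m' i := by
  have hsum : ∑ j ∈ D.bitNbr i, m i j = ∑ j ∈ D.bitNbr i, m' i j := congrFun (congrArg Prod.fst h) i
  funext e
  rw [lam, lam, Gam, Gam, hsum]

variable [DecidableEq S]

theorem edgeMass_eq_of_natParam_eq (i : Fin N) (e : E) :
    D.edgeMass K₂ m i e = D.edgeMass K₂ m' i e := by
  have hlam (i : Fin N) : D.lam K₂ m i = D.lam K₂ m' i := lam_eq_of_natParam_eq h K₂ i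
  rw [edgeMass, edgeMass, hlam, D.fwd_congr K₂ i fun i _ => hlam i, bwd, bwd,
    D.bwdRev_congr K₂ _ fun i _ => hlam i]

theorem bitLogit_eq_of_natParam_eq (i : Fin N) : D.bitLogit K₂ m i = D.bitLogit K₂ m' i := by
  simp only [bitLogit, bitMass, edgeMass_eq_of_natParam_eq h]

variable [Fintype S]

theorem trellisMass_eq_of_natParam_eq : D.trellisMass K₂ m = D.trellisMass K₂ m' := by
  simp only [trellisMass, bwd, D.bwdRev_congr K₂ _ fun i _ => lam_eq_of_natParam_eq h K₂ i]

theorem dual_eq_of_natParam_eq : D.dual K₁ K₂ m = D.dual K₁ K₂ m' := by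
  simp only [dual, trellisMass_eq_of_natParam_eq h, checkMass_eq_of_natParam_eq h]

theorem AcceptsAllInputs.gOf_eq_of_natParam_eq (hD : D.AcceptsAllInputs) :
    D.gOf K₂ m = D.gOf K₂ m' := by
  funext i e
  by_cases he : e ∈ D.sec i
  · rw [hD.gOf_eq_div K₂ m i he, hD.gOf_eq_div K₂ m' i he, edgeMass_eq_of_natParam_eq h,
      trellisMass_eq_of_natParam_eq h]
  · rw [gOf, gOf, if_neg he, if_neg he]

variable {K₁} in
theorem AcceptsAllInputs.natParam_sweep_eq (hD : D.AcceptsAllInputs)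
    (hcheck : ∀ j, (D.checkNbr j).card ≠ 1) (hK₁ : 0 < K₁) :
    D.natParam (D.sweep K₁ K₂ m) = D.natParam (D.sweep K₁ K₂ m') := by
  rw [sweep, sweep]
  induction List.finRange N generalizing m m' with
  | nil => exact h
  | cons p _ ih =>
    refine ih ?_
    beta_reduce
    rw [hD.bitUpdate_eq_bitStep hcheck hK₁, hD.bitUpdate_eq_bitStep hcheck hK₁, bitStep, bitStep,
      map_add, map_add, h]
    simp only [bitLogit_eq_of_natParam_eq h, checkLogit_eq_of_natParam_eq h]

end Invariance

/-! ### Continuity -/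

section Continuity

variable (D : JointDecoding N M S E) (K₁ K₂ : ℝ)

theorem continuous_patternMass (j : Fin M) (B : Finset (Fin N)) :
    Continuous fun m => patternMass K₁ m j B := by
  unfold patternMass
  fun_prop

theorem continuous_checkMass (j : Fin M) : Continuous fun m => D.checkMass K₁ m j :=
  continuous_finsetSum _ fun B _ => continuous_patternMass K₁ j B

theorem continuous_wOf : Continuous (D.wOf K₁) := by
  refine continuous_pi fun j => continuous_pi fun B => ?_
  by_cases hB : B ∈ D.patterns j
  · simp only [D.wOf_eq_div K₁ _ j hB]
    exact (continuous_patternMass K₁ j B).div (D.continuous_checkMass K₁ j)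
      fun m => (D.checkMass_pos K₁ m j).ne'
  · simp only [wOf, if_neg hB]
    exact continuous_const

variable {D} in
theorem continuous_checkLogit {i : Fin N} {j : Fin M} (hij : j ∈ D.bitNbr i)
    (hj : (D.checkNbr j).card ≠ 1) : Continuous fun m => D.checkLogit K₁ m i j := by
  have hzero : Continuous fun m => D.checkMassZero K₁ m i j :=
    continuous_finsetSum _ fun B _ => continuous_patternMass K₁ j B
  have hone : Continuous fun m => D.checkMassOne K₁ m i j :=
    continuous_finsetSum _ fun B _ => continuous_patternMass K₁ j B
  exact (hzero.div hone fun m => (checkMassOne_pos K₁ m hij hj).ne').log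
    fun m => (div_pos (D.checkMassZero_pos K₁ m i j) (checkMassOne_pos K₁ m hij hj)).ne'

theorem continuous_lam (i : Fin N) (e : E) : Continuous fun m => D.lam K₂ m i e := by
  unfold lam Gam
  split_ifs <;> fun_prop

variable [DecidableEq S]

theorem continuous_fwd (n : ℕ) (k : S) : Continuous fun m => D.fwd K₂ m n k := by
  induction n generalizing k with
  | zero => exact continuous_const
  | succ n ih =>
    simp only [fwd]
    split_ifs
    · exact continuous_finsetSum _ fun e _ => (ih _).mul (D.continuous_lam K₂ _ _)
    · exact continuous_const

theorem continuous_bwdRev (r : ℕ) (k : S) : Continuous fun m => D.bwdRev K₂ m r k := by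
  induction r generalizing k with
  | zero => exact continuous_const
  | succ r ih =>
    simp only [bwdRev]
    split_ifs
    · exact continuous_finsetSum _ fun e _ => (ih _).mul (D.continuous_lam K₂ _ _)
    · exact continuous_const

theorem continuous_edgeMass (i : Fin N) (e : E) : Continuous fun m => D.edgeMass K₂ m i e :=
  ((D.continuous_fwd K₂ i _).mul (D.continuous_lam K₂ _ _)).mul (D.continuous_bwdRev K₂ _ _)

theorem continuous_bitMass (i : Fin N) (c : Bool) : Continuous fun m => D.bitMass K₂ m i c :=
  continuous_finsetSum _ fun e _ => D.continuous_edgeMass K₂ i e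

variable {D} in
theorem AcceptsAllInputs.continuous_bitLogit (hD : D.AcceptsAllInputs) (i : Fin N) :
    Continuous fun m => D.bitLogit K₂ m i := by
  have hpos (c : Bool) (m : Fin N → Fin M → ℝ) := hD.bitMass_pos K₂ m i c
  exact ((D.continuous_bitMass K₂ i false).div (D.continuous_bitMass K₂ i true)
    fun m => (hpos true m).ne').log fun m => (div_pos (hpos false m) (hpos true m)).ne'

variable [Fintype S]

theorem continuous_trellisMass : Continuous fun m => D.trellisMass K₂ m :=
  continuous_finsetSum _ fun k _ => D.continuous_bwdRev K₂ _ k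

variable {D} (hD : D.AcceptsAllInputs)
include hD

theorem AcceptsAllInputs.continuous_dual (hN : 0 < N) : Continuous (D.dual K₁ K₂) :=
  (continuous_const.mul (continuous_finsetSum _ fun j _ =>
    (D.continuous_checkMass K₁ j).log fun m => (D.checkMass_pos K₁ m j).ne')).sub
  (continuous_const.mul
    ((D.continuous_trellisMass K₂).log fun m => (hD.trellisMass_pos K₂ m hN).ne'))

theorem AcceptsAllInputs.continuous_gOf : Continuous (D.gOf K₂) := by
  refine continuous_pi fun i => continuous_pi fun e => ?_
  by_cases he : e ∈ D.sec i
  · simp only [hD.gOf_eq_div K₂ _ i he]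
    exact (D.continuous_edgeMass K₂ i e).div (D.continuous_trellisMass K₂)
      fun m => (hD.trellisMass_pos K₂ m i.pos).ne'
  · simp only [gOf, if_neg he]
    exact continuous_const

variable {K₁} (hcheck : ∀ j, (D.checkNbr j).card ≠ 1) (hK₁ : 0 < K₁)
include hcheck hK₁

theorem AcceptsAllInputs.continuous_bitUpdate (p : Fin N) : Continuous (D.bitUpdate K₁ K₂ p) := by
  rw [funext (hD.bitUpdate_eq_bitStep hcheck hK₁ K₂ p)]
  refine continuous_id.add ((continuous_single p).comp (continuous_pi fun j => ?_))
  split_ifs with hj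
  · exact continuous_const.mul
      ((hD.continuous_bitLogit K₂ p).sub (continuous_checkLogit K₁ hj (hcheck j)))
  · exact continuous_const

theorem AcceptsAllInputs.continuous_sweep : Continuous (D.sweep K₁ K₂) := by
  unfold sweep
  generalize List.finRange N = L
  induction L with
  | nil => exact continuous_id
  | cons p L ih => exact ih.comp (hD.continuous_bitUpdate K₂ hcheck hK₁ p)

end Continuity

/-! ### Dual maximizers and convergence of the iteration -/

section Maximizer

variable [Fintype S] [DecidableEq S] {D : JointDecoding N M S E} (hD : D.AcceptsAllInputs)
  (hN : 0 < N) (hcheck : ∀ j, (D.checkNbr j).card ≠ 1) {K₁ K₂ : ℝ} (hK₁ : 0 < K₁) (hK₂ : 0 < K₂)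
include hD hN hcheck hK₁ hK₂

theorem exists_norm_natParam_le (F : ℝ) :
    ∃ C : ℝ, ∀ m, F ≤ D.dual K₁ K₂ m → ‖D.natParam m‖ ≤ C := by
  set β := ∑ i, ∑ e ∈ D.sec i, |D.b i e|
  refine ⟨max (4 * β - 2 * F) (2 ^ N * (β - F)), fun m hm => ?_⟩
  have hbit (i : Fin N) : ‖∑ j ∈ D.bitNbr i, m i j‖ ≤ 4 * β - 2 * F :=
    (abs_sum_bitNbr_le hD hN hcheck hK₁ hK₂ i).trans (by linarith)
  have hpattern (j : Fin M) (B : Finset (Fin N)) (hB : B ∈ D.patterns j) :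
      ‖∑ i ∈ B, m i j‖ ≤ 2 ^ N * (β - F) := by
    have hcard : ((D.patterns j).card : ℝ) ≤ 2 ^ N := by
      exact_mod_cast (Finset.card_le_univ _).trans_eq (by simp)
    have hle := abs_sum_pattern_le hD hN hcheck hK₁ hK₂ (m := m) hB
    have hpos : 0 < ((D.patterns j).card : ℝ) :=
      Nat.cast_pos.2 (Finset.card_pos.2 ⟨∅, D.empty_mem_patterns j⟩)
    have hgap := nonneg_of_mul_nonneg_right ((abs_nonneg _).trans hle) hpos
    exact hle.trans (mul_le_mul hcard (by linarith) hgap (by positivity))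
  have hnonneg : 0 ≤ max (4 * β - 2 * F) (2 ^ N * (β - F)) :=
    le_max_of_le_left ((norm_nonneg _).trans (hbit ⟨0, hN⟩))
  refine norm_prod_le_iff.2 ⟨(pi_norm_le_iff_of_nonneg hnonneg).2 fun i =>
    le_max_of_le_left (hbit i), (pi_norm_le_iff_of_nonneg hnonneg).2 fun j =>
      (pi_norm_le_iff_of_nonneg hnonneg).2 fun B => ?_⟩
  change ‖if B ∈ D.patterns j then ∑ i ∈ B, m i j else 0‖ ≤ _
  split_ifs with hB
  · exact le_max_of_le_right (hpattern j B hB)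
  · rwa [norm_zero]

/-- The beliefs depend on the messages only through `natParam`, which is bounded on superlevel sets
of the dual although the messages themselves need not be. -/
theorem exists_mem_closedBall_natParam_eq (F : ℝ) : ∃ R : ℝ, ∀ m, F ≤ D.dual K₁ K₂ m →
    ∃ n ∈ Metric.closedBall (0 : Fin N → Fin M → ℝ) R, D.natParam n = D.natParam m := by
  obtain ⟨C, hC⟩ := exists_norm_natParam_le hD hN hcheck hK₁ hK₂ F
  obtain ⟨L, hL⟩ := exists_apply_eq_norm_le_mul_norm_apply D.natParam
  refine ⟨|L| * C, fun m hm => ?_⟩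
  obtain ⟨n, hn, hnorm⟩ := hL m
  refine ⟨n, mem_closedBall_zero_iff.2 (hnorm.trans ?_), hn⟩
  exact mul_le_mul (le_abs_self L) (hC m hm) (norm_nonneg _) (abs_nonneg L)

theorem exists_forall_dual_le : ∃ m, ∀ m', D.dual K₁ K₂ m' ≤ D.dual K₁ K₂ m := by
  obtain ⟨R, hR⟩ := exists_mem_closedBall_natParam_eq hD hN hcheck hK₁ hK₂ (D.dual K₁ K₂ 0)
  obtain ⟨n₀, hn₀, hn₀'⟩ := hR 0 le_rfl
  obtain ⟨m, -, hm⟩ := (isCompact_closedBall (0 : Fin N → Fin M → ℝ) R).exists_isMaxOn ⟨n₀, hn₀⟩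
    (hD.continuous_dual K₁ K₂ hN).continuousOn
  refine ⟨m, fun m' => ?_⟩
  rcases le_total (D.dual K₁ K₂ 0) (D.dual K₁ K₂ m') with h | h
  · obtain ⟨n, hn, hn'⟩ := hR m' h
    rw [← dual_eq_of_natParam_eq hn']
    exact hm hn
  · rw [← dual_eq_of_natParam_eq hn₀'] at h
    exact h.trans (hm hn₀)

end Maximizer

/-! ### Strong duality and convergence of the beliefs -/

theorem iter_succ [Fintype S] [DecidableEq S] (D : JointDecoding N M S E) (K₁ K₂ : ℝ) (l : ℕ) :
    D.iter K₁ K₂ (l + 1) = D.sweep K₁ K₂ (D.iter K₁ K₂ l) :=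
  Function.iterate_succ_apply' _ _ _

section Convergence

variable [Fintype S] [DecidableEq S] {D : JointDecoding N M S E} (hD : D.AcceptsAllInputs)
  (hN : 0 < N) (hcheck : ∀ j, (D.checkNbr j).card ≠ 1) {K₁ K₂ : ℝ} (hK₁ : 0 < K₁) (hK₂ : 0 < K₂)
include hD hN hcheck hK₁ hK₂

omit [Fintype S] in
theorem exists_isStationary [Finite S] : ∃ m, D.IsStationary K₁ K₂ m := by
  have := Fintype.ofFinite S
  obtain ⟨m, hm⟩ := exists_forall_dual_le hD hN hcheck hK₁ hK₂
  exact ⟨m, isStationary_of_forall_dual_le hD hcheck hK₁ hK₂ hm⟩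

section Optimality

variable {m : Fin N → Fin M → ℝ} (hm : D.IsStationary K₁ K₂ m)
include hm

theorem IsStationary.dual_le (m' : Fin N → Fin M → ℝ) : D.dual K₁ K₂ m' ≤ D.dual K₁ K₂ m := by
  rw [hm.dual_eq hD hcheck hK₁ hK₂ hN]
  exact (hm.feasible hD hcheck).dual_le_psObj hK₁ hK₂ hN m'

theorem IsStationary.isMinOn_psObj :
    IsMinOn (D.psObj K₁ K₂) D.feasibleSet (D.gOf K₂ m, D.wOf K₁ m) := fun x hx => by
  change D.psObj K₁ K₂ _ ≤ D.psObj K₁ K₂ x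
  rw [← hm.dual_eq hD hcheck hK₁ hK₂ hN]
  exact Feasible.dual_le_psObj hK₁ hK₂ hx hN m

omit hcheck hm in
theorem Feasible.dual_lt_psObj {x : (Fin N → E → ℝ) × (Fin M → Finset (Fin N) → ℝ)}
    (hx : D.Feasible x) (hne : x ≠ (D.gOf K₂ m, D.wOf K₁ m)) :
    D.dual K₁ K₂ m < D.psObj K₁ K₂ x :=
  (hx.dual_le_psObj hK₁ hK₂ hN m).lt_of_ne fun h =>
    hne ((hx.dual_eq_psObj_iff hK₁ hK₂ hD hN m).1 h)

theorem IsStationary.isGreatest_range_dual :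
    IsGreatest (Set.range (D.dual K₁ K₂)) (D.dual K₁ K₂ m) :=
  ⟨Set.mem_range_self m, Set.forall_mem_range.2 (hm.dual_le hD hN hcheck hK₁ hK₂)⟩

theorem IsStationary.dual_eq_dual {m' : Fin N → Fin M → ℝ} (hm' : D.IsStationary K₁ K₂ m') :
    D.dual K₁ K₂ m' = D.dual K₁ K₂ m :=
  (hm.dual_le hD hN hcheck hK₁ hK₂ m').antisymm (hm'.dual_le hD hN hcheck hK₁ hK₂ m)

theorem IsStationary.gOf_wOf_eq {m' : Fin N → Fin M → ℝ} (hm' : D.IsStationary K₁ K₂ m') :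
    (D.gOf K₂ m', D.wOf K₁ m') = (D.gOf K₂ m, D.wOf K₁ m) :=
  ((hm'.feasible hD hcheck).dual_eq_psObj_iff hK₁ hK₂ hD hN m).1 <| by
    rw [← hm'.dual_eq hD hcheck hK₁ hK₂ hN, hm.dual_eq_dual hD hN hcheck hK₁ hK₂ hm']

end Optimality

section Iteration

variable (hK : ∀ i, ((D.bitNbr i).card : ℝ) * K₂ < K₁)
include hK

omit hN in
theorem monotone_dual_iter : Monotone fun l => D.dual K₁ K₂ (D.iter K₁ K₂ l) :=
  monotone_nat_of_le_succ fun l => by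
    rw [iter_succ]
    exact dual_le_dual_sweep hD hcheck hK₁ hK₂ hK _

/-- At a limit of the iterates, up to messages that do not change the beliefs, a further iteration
leaves the dual unchanged, since the dual converges along the iterates. -/
theorem isStationary_of_tendsto {φ : ℕ → ℕ} (hφ : Tendsto φ atTop atTop)
    {n : ℕ → Fin N → Fin M → ℝ} (hn : ∀ l, D.natParam (n l) = D.natParam (D.iter K₁ K₂ (φ l)))
    {a : Fin N → Fin M → ℝ} (ha : Tendsto n atTop (𝓝 a)) : D.IsStationary K₁ K₂ a := by
  obtain ⟨mmax, hmax⟩ := exists_forall_dual_le hD hN hcheck hK₁ hK₂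
  have hlim := tendsto_atTop_ciSup (monotone_dual_iter hD hcheck hK₁ hK₂ hK)
    ⟨D.dual K₁ K₂ mmax, Set.forall_mem_range.2 fun l => hmax _⟩
  have hdual := hD.continuous_dual K₁ K₂ hN
  have hsweep := hdual.comp (hD.continuous_sweep K₂ hcheck hK₁)
  have ha_dual : D.dual K₁ K₂ a = ⨆ l, D.dual K₁ K₂ (D.iter K₁ K₂ l) :=
    tendsto_nhds_unique ((hdual.tendsto a).comp ha) <| (hlim.comp hφ).congr fun l =>
      (dual_eq_of_natParam_eq (hn l) K₁ K₂).symm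
  have ha_sweep : D.dual K₁ K₂ (D.sweep K₁ K₂ a) = ⨆ l, D.dual K₁ K₂ (D.iter K₁ K₂ l) := by
    refine tendsto_nhds_unique ((hsweep.tendsto a).comp ha) <|
      (hlim.comp ((tendsto_add_atTop_nat 1).comp hφ)).congr fun l => ?_
    change D.dual K₁ K₂ (D.iter K₁ K₂ (φ l + 1)) = D.dual K₁ K₂ (D.sweep K₁ K₂ (n l))
    rw [iter_succ]
    exact (dual_eq_of_natParam_eq (hD.natParam_sweep_eq (hn l) K₂ hcheck hK₁) K₁ K₂).symm
  exact isStationary_of_dual_sweep_le hD hcheck hK₁ hK₂ hK (ha_sweep.trans ha_dual.symm).le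

theorem tendsto_comp_iter {X : Type*} [TopologicalSpace X] {f : (Fin N → Fin M → ℝ) → X}
    (hf : Continuous f) (hinv : ∀ {m m'}, D.natParam m = D.natParam m' → f m = f m') {x : X}
    (hx : ∀ n, D.IsStationary K₁ K₂ n → f n = x) :
    Tendsto (fun l => f (D.iter K₁ K₂ l)) atTop (𝓝 x) := by
  obtain ⟨R, hR⟩ := exists_mem_closedBall_natParam_eq hD hN hcheck hK₁ hK₂
    (D.dual K₁ K₂ (D.iter K₁ K₂ 0))
  choose n hn_mem hn using fun l =>
    hR (D.iter K₁ K₂ l) (monotone_dual_iter hD hcheck hK₁ hK₂ hK (Nat.zero_le l))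
  refine tendsto_of_subseq_tendsto fun φ hφ => ?_
  obtain ⟨a, -, ψ, hψ, ha⟩ :=
    (isCompact_closedBall (0 : Fin N → Fin M → ℝ) R).tendsto_subseq fun l => hn_mem (φ l)
  have hstat := isStationary_of_tendsto hD hN hcheck hK₁ hK₂ hK (hφ.comp hψ.tendsto_atTop)
    (fun l => hn (φ (ψ l))) ha
  refine ⟨ψ, ?_⟩
  rw [← hx a hstat]
  exact ((hf.tendsto a).comp ha).congr fun l => hinv (hn _)

variable {m : Fin N → Fin M → ℝ} (hm : D.IsStationary K₁ K₂ m)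
include hm

theorem IsStationary.tendsto_dual_iter :
    Tendsto (fun l => D.dual K₁ K₂ (D.iter K₁ K₂ l)) atTop (𝓝 (D.dual K₁ K₂ m)) :=
  tendsto_comp_iter hD hN hcheck hK₁ hK₂ hK (hD.continuous_dual K₁ K₂ hN)
    (dual_eq_of_natParam_eq · K₁ K₂) fun _ => hm.dual_eq_dual hD hN hcheck hK₁ hK₂

theorem IsStationary.tendsto_gOf_iter :
    Tendsto (fun l => D.gOf K₂ (D.iter K₁ K₂ l)) atTop (𝓝 (D.gOf K₂ m)) :=
  tendsto_comp_iter hD hN hcheck hK₁ hK₂ hK (hD.continuous_gOf K₂)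
    (AcceptsAllInputs.gOf_eq_of_natParam_eq · K₂ hD) fun _ hn =>
      congrArg Prod.fst (hm.gOf_wOf_eq hD hN hcheck hK₁ hK₂ hn)

theorem IsStationary.tendsto_wOf_iter :
    Tendsto (fun l => D.wOf K₁ (D.iter K₁ K₂ l)) atTop (𝓝 (D.wOf K₁ m)) :=
  tendsto_comp_iter hD hN hcheck hK₁ hK₂ hK (D.continuous_wOf K₁)
    (wOf_eq_of_natParam_eq · K₁) fun _ hn =>
      congrArg Prod.snd (hm.gOf_wOf_eq hD hN hcheck hK₁ hK₂ hn)

end Iteration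

end Convergence

/-! ### The primal problems -/

section Primal

theorem isClosed_feasibleSet [DecidableEq S] (D : JointDecoding N M S E) :
    IsClosed D.feasibleSet := by
  have h : D.feasibleSet =
      {x | (∀ j, ∑ B ∈ D.patterns j, x.2 j B = 1) ∧ (∀ p, ∑ e ∈ D.sec p, x.1 p e = 1) ∧
        (∀ i, ∀ j ∈ D.bitNbr i, ∑ B ∈ D.patterns j with i ∈ B, x.2 j B =
          ∑ e ∈ D.sec i with D.inp e = true, x.1 i e) ∧
        (∀ (i : ℕ) (h : i + 1 < N) (k : S),
          ∑ e ∈ D.sec ⟨i, Nat.lt_of_succ_lt h⟩ with D.dst e = k, x.1 ⟨i, Nat.lt_of_succ_lt h⟩ e =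
            ∑ e ∈ D.sec ⟨i + 1, h⟩ with D.src e = k, x.1 ⟨i + 1, h⟩ e) ∧
        (∀ j, ∀ B ∈ D.patterns j, 0 ≤ x.2 j B) ∧ (∀ i, ∀ e ∈ D.sec i, 0 ≤ x.1 i e) ∧
        (∀ j, ∀ B, B ∉ D.patterns j → x.2 j B = 0) ∧
        (∀ i, ∀ e, e ∉ D.sec i → x.1 i e = 0)} := by
    ext x
    exact ⟨fun h => ⟨h.1, h.2, h.3, h.4, h.5, h.6, h.7, h.8⟩,
      fun ⟨h1, h2, h3, h4, h5, h6, h7, h8⟩ => ⟨h1, h2, h3, h4, h5, h6, h7, h8⟩⟩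
  rw [h]
  simp only [Set.ofPred_and, Set.ofPred_forall]
  repeat' first
    | exact isClosed_eq (by fun_prop) (by fun_prop)
    | exact isClosed_le (by fun_prop) (by fun_prop)
    | refine IsClosed.inter ?_ ?_
    | refine isClosed_iInter fun _ => ?_

theorem isCompact_feasibleSet [DecidableEq S] (D : JointDecoding N M S E) :
    IsCompact D.feasibleSet := by
  refine IsCompact.of_isClosed_subset
    ((isCompact_univ_pi fun _ : Fin N => isCompact_univ_pi fun _ : E => isCompact_Icc).prod
      (isCompact_univ_pi fun _ : Fin M => isCompact_univ_pi fun _ : Finset (Fin N) =>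
        isCompact_Icc (a := (0 : ℝ)) (b := 1)))
    D.isClosed_feasibleSet fun x (hx : D.Feasible x) =>
      ⟨fun i _ e _ => (?_ : x.1 i e ∈ Set.Icc (0 : ℝ) 1),
        fun j _ B _ => (?_ : x.2 j B ∈ Set.Icc (0 : ℝ) 1)⟩
  · by_cases he : e ∈ D.sec i
    · exact ⟨hx.g_nonneg i e he, hx.g_sum i ▸ Finset.single_le_sum (hx.g_nonneg i) he⟩
    · rw [hx.g_off i e he]
      exact unitInterval.zero_mem
  · by_cases hB : B ∈ D.patterns j
    · exact ⟨hx.w_nonneg j B hB, hx.w_sum j ▸ Finset.single_le_sum (hx.w_nonneg j) hB⟩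
    · rw [hx.w_off j B hB]
      exact unitInterval.zero_mem

theorem continuous_cost (D : JointDecoding N M S E) : Continuous D.cost := by
  unfold cost
  fun_prop

theorem continuous_psObjAt (D : JointDecoding N M S E) (K₁ K₂ : ℝ) (p : Fin N) :
    Continuous (D.psObjAt K₁ K₂ p) := by
  unfold psObjAt checkEntropy sectionEntropy
  exact ((D.continuous_cost.comp continuous_fst).sub (continuous_const.mul
    (continuous_finsetSum _ fun j _ => continuous_finsetSum _ fun B _ =>
      Real.continuous_negMulLog.comp (by fun_prop)))).sub (continuous_const.mul
    (continuous_finsetSum _ fun e _ => Real.continuous_negMulLog.comp (by fun_prop)))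

theorem feasibleSet_nonempty [Finite S] [DecidableEq S] {D : JointDecoding N M S E}
    (hD : D.AcceptsAllInputs) (hN : 0 < N) (hcheck : ∀ j, (D.checkNbr j).card ≠ 1) :
    D.feasibleSet.Nonempty := by
  have := Fintype.ofFinite S
  obtain ⟨m, hm⟩ := exists_isStationary hD hN hcheck one_pos one_pos
  exact ⟨_, hm.feasible hD hcheck⟩

theorem exists_isLeast_image_feasibleSet [Finite S] [DecidableEq S] {D : JointDecoding N M S E}
    (hD : D.AcceptsAllInputs) (hN : 0 < N) (hcheck : ∀ j, (D.checkNbr j).card ≠ 1)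
    {f : (Fin N → E → ℝ) × (Fin M → Finset (Fin N) → ℝ) → ℝ} (hf : Continuous f) :
    ∃ P, IsLeast (f '' D.feasibleSet) P :=
  (D.isCompact_feasibleSet.image hf).exists_isLeast ((feasibleSet_nonempty hD hN hcheck).image f)

end Primal

/-! ### Smoothing is a small perturbation -/

section Perturbation

section

variable {X : Type*} {s : Set X} {c f : X → ℝ} {P η : ℝ} (hP : IsLeast (c '' s) P)
  (hf : ∀ x ∈ s, f x ∈ Set.Icc (c x - η) (c x)) {x : X} (hx : x ∈ s) (hmin : IsMinOn f s x)
include hP hf hx hmin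

theorem sub_isLeast_mem_Icc_of_isMinOn : c x - P ∈ Set.Icc 0 η := by
  obtain ⟨⟨y, hy, rfl⟩, hle⟩ := hP
  have hxy : f x ≤ c y := (hmin hy).trans (hf y hy).2
  exact ⟨sub_nonneg.2 (hle ⟨x, hx, rfl⟩), by linarith [(hf x hx).1]⟩

theorem isLeast_sub_mem_Icc_of_isMinOn : P - f x ∈ Set.Icc 0 η := by
  have hcost : P ≤ c x := hP.2 ⟨x, hx, rfl⟩
  obtain ⟨⟨y, hy, rfl⟩, -⟩ := hP
  have hxy : f x ≤ c y := (hmin hy).trans (hf y hy).2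
  exact ⟨sub_nonneg.2 hxy, by linarith [(hf x hx).1]⟩

end

/-- A bound for the total entropy of the check patterns and the edges, used to choose the
temperatures `1 / K₁` and `1 / K₂`. -/
def entropyBound (D : JointDecoding N M S E) : ℝ :=
  ∑ j, ((D.patterns j).card : ℝ) + ∑ i, ((D.sec i).card : ℝ)

theorem entropyBound_nonneg (D : JointDecoding N M S E) : 0 ≤ D.entropyBound := by
  unfold entropyBound
  positivity

variable [DecidableEq S] {D : JointDecoding N M S E}
  {x : (Fin N → E → ℝ) × (Fin M → Finset (Fin N) → ℝ)} (hx : D.Feasible x) {K₀ K₁ K₂ : ℝ}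
  (hK₀ : 0 < K₀) (hK₁ : K₀ ≤ K₁) (hK₂ : K₀ ≤ K₂)
include hx hK₀ hK₁ hK₂

theorem Feasible.cost_sub_entropies_mem_Icc {h : ℝ} (h_nonneg : 0 ≤ h)
    (h_le : h ≤ ∑ i, ((D.sec i).card : ℝ)) :
    D.cost x.1 - 1 / K₁ * ∑ j, D.checkEntropy x.2 j - 1 / K₂ * h ∈
      Set.Icc (D.cost x.1 - D.entropyBound / K₀) (D.cost x.1) := by
  have hw_nonneg : 0 ≤ ∑ j, D.checkEntropy x.2 j :=
    Finset.sum_nonneg fun j _ => hx.checkEntropy_nonneg j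
  have hw_le : ∑ j, D.checkEntropy x.2 j ≤ ∑ j, ((D.patterns j).card : ℝ) :=
    Finset.sum_le_sum fun j _ => hx.checkEntropy_le_card j
  have hK₁' := hK₀.trans_le hK₁
  have hK₂' := hK₀.trans_le hK₂
  have hw : 1 / K₁ * ∑ j, D.checkEntropy x.2 j ≤ 1 / K₀ * ∑ j, ((D.patterns j).card : ℝ) := by
    gcongr
  have hh : 1 / K₂ * h ≤ 1 / K₀ * ∑ i, ((D.sec i).card : ℝ) := by gcongr
  have hbound : D.entropyBound / K₀ = 1 / K₀ * ∑ j, ((D.patterns j).card : ℝ) +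
      1 / K₀ * ∑ i, ((D.sec i).card : ℝ) := by rw [entropyBound]; ring
  have hw' : 0 ≤ 1 / K₁ * ∑ j, D.checkEntropy x.2 j := by positivity
  have hh' : 0 ≤ 1 / K₂ * h := by positivity
  constructor <;> linarith

theorem Feasible.psObj_mem_Icc [Fintype S] (hN : 0 < N) :
    D.psObj K₁ K₂ x ∈ Set.Icc (D.cost x.1 - D.entropyBound / K₀) (D.cost x.1) :=
  hx.cost_sub_entropies_mem_Icc hK₀ hK₁ hK₂ (hx.isFlow.trellisEntropy_nonneg hN)
    hx.isFlow.trellisEntropy_le_sum_card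

theorem Feasible.psObjAt_mem_Icc (p : Fin N) :
    D.psObjAt K₁ K₂ p x ∈ Set.Icc (D.cost x.1 - D.entropyBound / K₀) (D.cost x.1) :=
  hx.cost_sub_entropies_mem_Icc hK₀ hK₁ hK₂ (hx.isFlow.sectionEntropy_nonneg p) <|
    (hx.isFlow.sectionEntropy_le_card p).trans <|
      Finset.single_le_sum (f := fun i => ((D.sec i).card : ℝ)) (fun _ _ => Nat.cast_nonneg _)
        (Finset.mem_univ p)

end Perturbation

/-! ### Checks of degree at least three -/

section DegreeThree

theorem exists_ne_ne_of_two_lt_card {α : Type*} {s : Finset α} (hs : 2 < s.card) (i : α) :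
    ∃ a ∈ s, ∃ b ∈ s, i ≠ a ∧ i ≠ b ∧ a ≠ b := by
  classical
  obtain ⟨a, ha, b, hb, hab⟩ := Finset.one_lt_card.1
    ((Nat.lt_sub_of_add_lt hs).trans_le (Finset.pred_card_le_card_erase (a := i)))
  rw [Finset.mem_erase] at ha hb
  exact ⟨a, ha.2, b, hb.2, ha.1.symm, hb.1.symm, hab⟩

variable {D : JointDecoding N M S E}

theorem two_lt_card_checkNbr {i : Fin N} {j : Fin M} (hi : i ∈ D.checkNbr j)
    (hj : (D.checkNbr j).card ≠ 1) (hj' : (D.checkNbr j).card ≠ 2) : 2 < (D.checkNbr j).card := by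
  have := Finset.card_pos.2 ⟨i, hi⟩
  omega

theorem exists_marginal_direction {i : Fin N} {j : Fin M} (hi : i ∈ D.checkNbr j)
    (hj : 2 < (D.checkNbr j).card) :
    ∃ v : Finset (Fin N) → ℝ, (∀ B, B ∉ D.patterns j → v B = 0) ∧
      ∑ B ∈ D.patterns j, v B = 0 ∧
      ∀ r, ∑ B ∈ D.patterns j with r ∈ B, v B = if r = i then 1 else 0 := by
  obtain ⟨a, ha, b, hb, hia, hib, hab⟩ := exists_ne_ne_of_two_lt_card hj i
  have hmem_ia := pair_mem_patterns hi ha hia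
  have hmem_ib := pair_mem_patterns hi hb hib
  have hmem_ab := pair_mem_patterns ha hb hab
  have hmem_empty := D.empty_mem_patterns j
  -- Among the pairs in `{i, a, b}`, `i = ({i, a} + {i, b} - {a, b}) / 2`; the empty pattern
  -- restores the total mass.
  refine ⟨fun B => 1 / 2 * ((if B = {i, a} then 1 else 0) + (if B = {i, b} then 1 else 0) -
    (if B = {a, b} then 1 else 0) - (if B = ∅ then 1 else 0)), fun B hB => ?_, ?_, fun r => ?_⟩
  · have hne {B' : Finset (Fin N)} (hB' : B' ∈ D.patterns j) : B ≠ B' :=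
      (ne_of_mem_of_not_mem hB' hB).symm
    simp only [hne hmem_ia, hne hmem_ib, hne hmem_ab, hne hmem_empty, if_false]
    norm_num
  · rw [← Finset.mul_sum]
    simp only [Finset.sum_sub_distrib, Finset.sum_add_distrib, Finset.sum_ite_eq', hmem_ia,
      hmem_ib, hmem_ab, hmem_empty, if_true]
    norm_num
  · rw [← Finset.mul_sum]
    simp only [Finset.sum_sub_distrib, Finset.sum_add_distrib, Finset.sum_ite_eq',
      Finset.mem_filter, hmem_ia, hmem_ib, hmem_ab, hmem_empty, true_and, Finset.mem_insert,
      Finset.mem_singleton, Finset.notMem_empty, if_false]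
    grind

theorem exists_marginal_section {j : Fin M} (hj : (D.checkNbr j).card ≠ 1)
    (hj' : (D.checkNbr j).card ≠ 2) :
    ∃ V : (Fin N → ℝ) →ₗ[ℝ] Finset (Fin N) → ℝ, (∀ d, ∀ B, B ∉ D.patterns j → V d B = 0) ∧
      (∀ d, ∑ B ∈ D.patterns j, V d B = 0) ∧
      ∀ d, ∀ i ∈ D.checkNbr j, ∑ B ∈ D.patterns j with i ∈ B, V d B = d i := by
  choose! v hoff hsum hmarg using fun i (hi : i ∈ D.checkNbr j) =>
    exists_marginal_direction hi (two_lt_card_checkNbr hi hj hj')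
  have hV (d : Fin N → ℝ) (B : Finset (Fin N)) :
      (∑ i ∈ D.checkNbr j, (LinearMap.proj i : (Fin N → ℝ) →ₗ[ℝ] ℝ).smulRight (v i)) d B =
        ∑ i ∈ D.checkNbr j, d i * v i B := by
    simp only [LinearMap.sum_apply, LinearMap.smulRight_apply, LinearMap.proj_apply,
      Finset.sum_apply, Pi.smul_apply, smul_eq_mul]
  refine ⟨∑ i ∈ D.checkNbr j, (LinearMap.proj i : (Fin N → ℝ) →ₗ[ℝ] ℝ).smulRight (v i),
    fun d B hB => ?_, fun d => ?_, fun d r hr => ?_⟩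
  · rw [hV]
    exact Finset.sum_eq_zero fun i hi => by rw [hoff i hi B hB, mul_zero]
  · simp only [hV]
    rw [Finset.sum_comm]
    exact Finset.sum_eq_zero fun i hi => by rw [← Finset.mul_sum, hsum i hi, mul_zero]
  · simp only [hV]
    rw [Finset.sum_comm, Finset.sum_eq_single_of_mem r hr fun i hi hir => ?_, ← Finset.mul_sum,
      hmarg r hr, if_pos rfl, mul_one]
    rw [← Finset.mul_sum, hmarg i hi, if_neg hir.symm, mul_zero]

variable [DecidableEq S] in
theorem eventually_exists_feasible (hcheck : ∀ j, (D.checkNbr j).card ≠ 1)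
    (hcheck' : ∀ j, (D.checkNbr j).card ≠ 2) {g : Fin N → E → ℝ}
    {w : Fin M → Finset (Fin N) → ℝ} (hx : D.Feasible (g, w))
    (hw : ∀ j, ∀ B ∈ D.patterns j, 0 < w j B) {ι : Type*} {l : Filter ι} {u : ι → Fin N → E → ℝ}
    (hu : Tendsto u l (𝓝 g)) (hflow : ∀ n, D.IsFlow (u n))
    (hoff : ∀ n i e, e ∉ D.sec i → u n i e = 0) : ∀ᶠ n in l, ∃ w', D.Feasible (u n, w') := by
  choose V hV_off hV_sum hV_marg using fun j => exists_marginal_section (hcheck j) (hcheck' j)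
  let W := fun n j => w j + V j (D.marg (u n) - D.marg g)
  have hmarg : Tendsto (fun n => D.marg (u n) - D.marg g) l (𝓝 0) := by
    have hcont : Continuous D.marg := by
      unfold marg
      fun_prop
    simpa only [sub_self, Function.comp_apply] using
      ((hcont.tendsto g).comp hu).sub_const (D.marg g)
  have hW (j : Fin M) (B : Finset (Fin N)) : Tendsto (fun n => W n j B) l (𝓝 (w j B)) := by
    have hV := ((V j).continuous_of_finiteDimensional.tendsto 0).comp hmarg
    rw [map_zero] at hV
    simpa only [W, Pi.add_apply, Pi.zero_apply, add_zero, Function.comp_apply] using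
      (tendsto_pi_nhds.1 hV B).const_add (w j B)
  have hpos : ∀ᶠ n in l, ∀ j, ∀ B ∈ D.patterns j, 0 ≤ W n j B :=
    eventually_all.2 fun j => (Finset.eventually_all _).2 fun B hB =>
      ((hW j B).eventually (lt_mem_nhds (hw j B hB))).mono fun n hn => hn.le
  filter_upwards [hpos] with n hn
  refine ⟨W n, fun j => ?_, (hflow n).g_sum, fun i j hj => ?_, (hflow n).flow, hn,
    (hflow n).g_nonneg, fun j B hB => ?_, hoff n⟩
  · simp only [W, Pi.add_apply]
    rw [Finset.sum_add_distrib, hx.w_sum j, hV_sum, add_zero]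
  · simp only [W, Pi.add_apply]
    rw [Finset.sum_add_distrib, hx.coupling i j hj, hV_marg j _ i (mem_bitNbr.1 hj)]
    exact add_sub_cancel _ _
  · have hw_off : w j B = 0 := hx.w_off j B hB
    simp only [W, Pi.add_apply, hw_off, hV_off j _ B hB, add_zero]

theorem wOf_pos (K₁ : ℝ) (m : Fin N → Fin M → ℝ) {j : Fin M} {B : Finset (Fin N)}
    (hB : B ∈ D.patterns j) : 0 < D.wOf K₁ m j B := by
  rw [D.wOf_eq_div K₁ m j hB]
  exact div_pos (patternMass_pos K₁ m j B) (D.checkMass_pos K₁ m j)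

theorem sum_pattern_eq_log_wOf {K₁ : ℝ} (hK₁ : 0 < K₁) (m : Fin N → Fin M → ℝ) {j : Fin M}
    {B : Finset (Fin N)} (hB : B ∈ D.patterns j) :
    ∑ i ∈ B, m i j = -(1 / K₁) * Real.log (D.wOf K₁ m j B / D.wOf K₁ m j ∅) := by
  rw [D.wOf_eq_div K₁ m j hB, D.wOf_eq_div K₁ m j (D.empty_mem_patterns j),
    div_div_div_cancel_right₀ (D.checkMass_pos K₁ m j).ne', patternMass, patternMass,
    Finset.sum_empty, mul_zero, Real.exp_zero, div_one, Real.log_exp]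
  field_simp

theorem exists_tendsto_of_tendsto_wOf {K₁ : ℝ} (hK₁ : 0 < K₁) {ι : Type*} {l : Filter ι}
    {u : ι → Fin N → Fin M → ℝ} {w : Fin M → Finset (Fin N) → ℝ}
    (hw : ∀ j, ∀ B ∈ D.patterns j, 0 < w j B)
    (hlim : Tendsto (fun n => D.wOf K₁ (u n)) l (𝓝 w)) {i : Fin N} {j : Fin M}
    (hi : i ∈ D.checkNbr j) (hj : 2 < (D.checkNbr j).card) :
    ∃ t, Tendsto (fun n => u n i j) l (𝓝 t) := by
  have hpattern {B : Finset (Fin N)} (hB : B ∈ D.patterns j) : Tendsto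
      (fun n => ∑ i ∈ B, u n i j) l (𝓝 (-(1 / K₁) * Real.log (w j B / w j ∅))) := by
    have hwlim (B : Finset (Fin N)) := tendsto_pi_nhds.1 (tendsto_pi_nhds.1 hlim j) B
    have hempty := hw j ∅ (D.empty_mem_patterns j)
    simp only [sum_pattern_eq_log_wOf hK₁ _ hB]
    exact (((hwlim B).div (hwlim ∅) hempty.ne').log
      (div_pos (hw j B hB) hempty).ne').const_mul _
  obtain ⟨a, ha, b, hb, hia, hib, hab⟩ := exists_ne_ne_of_two_lt_card hj i
  refine ⟨_, ((((hpattern (pair_mem_patterns hi ha hia)).add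
    (hpattern (pair_mem_patterns hi hb hib))).sub
      (hpattern (pair_mem_patterns ha hb hab))).const_mul (1 / 2)).congr fun n => ?_⟩
  rw [Finset.sum_pair hia, Finset.sum_pair hib, Finset.sum_pair hab]
  ring

variable [Fintype S] [DecidableEq S]

theorem iter_eq_zero (K₁ K₂ : ℝ) (l : ℕ) {i : Fin N} {j : Fin M} (hij : j ∉ D.bitNbr i) :
    D.iter K₁ K₂ l i j = 0 := by
  have hsweep (m : Fin N → Fin M → ℝ) : D.sweep K₁ K₂ m i j = m i j := by
    rw [sweep]
    induction List.finRange N generalizing m with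
    | nil => rfl
    | cons p _ ih =>
      rw [List.foldl_cons, ih, bitUpdate, if_neg]
      rintro ⟨rfl, hj⟩
      exact hij hj
  induction l with
  | zero => rfl
  | succ l ih => rw [iter_succ, hsweep, ih]

theorem exists_tendsto_iter_of_tendsto_wOf (hcheck : ∀ j, (D.checkNbr j).card ≠ 1)
    (hcheck' : ∀ j, (D.checkNbr j).card ≠ 2) {K₁ K₂ : ℝ} (hK₁ : 0 < K₁)
    {w : Fin M → Finset (Fin N) → ℝ} (hw : ∀ j, ∀ B ∈ D.patterns j, 0 < w j B)
    (hlim : Tendsto (fun l => D.wOf K₁ (D.iter K₁ K₂ l)) atTop (𝓝 w)) :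
    ∃ m, Tendsto (D.iter K₁ K₂) atTop (𝓝 m) := by
  have hentry (i : Fin N) (j : Fin M) : ∃ t, Tendsto (fun l => D.iter K₁ K₂ l i j) atTop (𝓝 t) := by
    by_cases hij : j ∈ D.bitNbr i
    · have hi := mem_bitNbr.1 hij
      exact exists_tendsto_of_tendsto_wOf hK₁ hw hlim hi
        (two_lt_card_checkNbr hi (hcheck j) (hcheck' j))
    · simp only [iter_eq_zero K₁ K₂ _ hij]
      exact ⟨0, tendsto_const_nhds⟩
  choose m hm using hentry
  exact ⟨m, tendsto_pi_nhds.2 fun i => tendsto_pi_nhds.2 (hm i)⟩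

section Iteration

variable (hD : D.AcceptsAllInputs) (hN : 0 < N) (hcheck : ∀ j, (D.checkNbr j).card ≠ 1)
  (hcheck' : ∀ j, (D.checkNbr j).card ≠ 2) {K₁ K₂ : ℝ} (hK₁ : 0 < K₁) (hK₂ : 0 < K₂)
  (hK : ∀ i, ((D.bitNbr i).card : ℝ) * K₂ < K₁) {m : Fin N → Fin M → ℝ}
  (hm : D.IsStationary K₁ K₂ m)
include hD hN hcheck hcheck' hK₁ hK₂ hK hm

theorem IsStationary.exists_tendsto_iter :
    ∃ m', D.dual K₁ K₂ m' = D.dual K₁ K₂ m ∧ Tendsto (D.iter K₁ K₂) atTop (𝓝 m') := by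
  obtain ⟨m', hm'⟩ := exists_tendsto_iter_of_tendsto_wOf hcheck hcheck' hK₁
    (fun _ _ hB => wOf_pos K₁ m hB) (hm.tendsto_wOf_iter hD hN hcheck hK₁ hK₂ hK)
  exact ⟨m', tendsto_nhds_unique (((hD.continuous_dual K₁ K₂ hN).tendsto m').comp hm')
    (hm.tendsto_dual_iter hD hN hcheck hK₁ hK₂ hK), hm'⟩

theorem IsStationary.eventually_exists_feasible_gOf_iter :
    ∀ᶠ l in atTop, ∃ w', D.Feasible (D.gOf K₂ (D.iter K₁ K₂ l), w') :=
  eventually_exists_feasible hcheck hcheck' (hm.feasible hD hcheck)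
    (fun _ _ hB => wOf_pos K₁ m hB) (hm.tendsto_gOf_iter hD hN hcheck hK₁ hK₂ hK)
    (fun _ => hD.isFlow_gOf K₂ _) fun _ _ _ he => if_neg he

theorem IsStationary.eventually_cost_gOf_iter_sub_mem_Icc {P δ : ℝ}
    (hP : IsLeast ((fun x => D.cost x.1) '' D.feasibleSet) P) (hδ : D.cost (D.gOf K₂ m) - P < δ) :
    ∀ᶠ l in atTop, (∃ w', D.Feasible (D.gOf K₂ (D.iter K₁ K₂ l), w')) ∧
      D.cost (D.gOf K₂ (D.iter K₁ K₂ l)) - P ∈ Set.Icc 0 δ := by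
  have hcost := ((D.continuous_cost.tendsto _).comp
    (hm.tendsto_gOf_iter hD hN hcheck hK₁ hK₂ hK)).sub_const P
  filter_upwards [hcost.eventually_lt_const hδ,
    hm.eventually_exists_feasible_gOf_iter hD hN hcheck hcheck' hK₁ hK₂ hK] with l hlt ⟨w', hw'⟩
  exact ⟨⟨w', hw'⟩, sub_nonneg.2 (hP.2 ⟨_, hw', rfl⟩), hlt.le⟩

end Iteration

end DegreeThree

/-! ### Near optimality -/

section NearOptimality

theorem div_natCast_mem_Icc {a η δ : ℝ} {n : ℕ} (hn : 0 < n) (ha : a ∈ Set.Icc 0 η)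
    (hη : η ≤ δ) : a / n ∈ Set.Icc 0 δ :=
  ⟨div_nonneg ha.1 n.cast_nonneg,
    (div_le_self ha.1 (Nat.one_le_cast.2 hn)).trans (ha.2.trans hη)⟩

theorem exists_entropyBound_div_lt (D : JointDecoding N M S E) {δ : ℝ} (hδ : 0 < δ) :
    ∃ K₀ : ℝ, 0 < K₀ ∧ D.entropyBound / K₀ < δ := by
  have hC := D.entropyBound_nonneg
  have hK₀ : 0 < D.entropyBound / δ + 1 := by positivity
  exact ⟨_, hK₀, (div_lt_comm₀ hK₀ hδ).2 (lt_add_one _)⟩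

variable [DecidableEq S] {D : JointDecoding N M S E} (hD : D.AcceptsAllInputs) (hN : 0 < N)
  (hcheck : ∀ j, (D.checkNbr j).card ≠ 1) {P : ℝ}
  (hP : IsLeast ((fun x => D.cost x.1) '' D.feasibleSet) P) {K₀ K₁ K₂ : ℝ} (hK₀ : 0 < K₀)
  (hK₁ : K₀ ≤ K₁) (hK₂ : K₀ ≤ K₂)
include hD hN hcheck hP hK₀ hK₁ hK₂

theorem IsStationary.cost_gOf_sub_mem_Icc [Fintype S] {m : Fin N → Fin M → ℝ}
    (hm : D.IsStationary K₁ K₂ m) :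
    D.cost (D.gOf K₂ m) - P ∈ Set.Icc 0 (D.entropyBound / K₀) := by
  have hcost := sub_isLeast_mem_Icc_of_isMinOn hP
    (fun _ hx => Feasible.psObj_mem_Icc hx hK₀ hK₁ hK₂ hN) (hm.feasible hD hcheck)
    (hm.isMinOn_psObj hD hN hcheck (hK₀.trans_le hK₁) (hK₀.trans_le hK₂))
  exact hcost

theorem IsStationary.sub_dual_mem_Icc [Fintype S] {m : Fin N → Fin M → ℝ}
    (hm : D.IsStationary K₁ K₂ m) :
    P - D.dual K₁ K₂ m ∈ Set.Icc 0 (D.entropyBound / K₀) := by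
  have hK₁_pos := hK₀.trans_le hK₁
  have hK₂_pos := hK₀.trans_le hK₂
  rw [hm.dual_eq hD hcheck hK₁_pos hK₂_pos hN]
  exact isLeast_sub_mem_Icc_of_isMinOn hP
    (fun _ hx => Feasible.psObj_mem_Icc hx hK₀ hK₁ hK₂ hN) (hm.feasible hD hcheck)
    (hm.isMinOn_psObj hD hN hcheck hK₁_pos hK₂_pos)

theorem exists_isLeast_psObjAt [Finite S] (p : Fin N) :
    ∃ Q, IsLeast (D.psObjAt K₁ K₂ p '' D.feasibleSet) Q ∧
      P - Q ∈ Set.Icc 0 (D.entropyBound / K₀) ∧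
      ∀ x ∈ D.feasibleSet, D.psObjAt K₁ K₂ p x = Q →
        D.cost x.1 - P ∈ Set.Icc 0 (D.entropyBound / K₀) := by
  obtain ⟨Q, hQ⟩ := exists_isLeast_image_feasibleSet hD hN hcheck (D.continuous_psObjAt K₁ K₂ p)
  have hmin {x} (hxQ : D.psObjAt K₁ K₂ p x = Q) :
      IsMinOn (D.psObjAt K₁ K₂ p) D.feasibleSet x :=
    fun y hy => hxQ.trans_le (hQ.2 ⟨y, hy, rfl⟩)
  have hclose : ∀ x ∈ D.feasibleSet, D.psObjAt K₁ K₂ p x ∈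
      Set.Icc (D.cost x.1 - D.entropyBound / K₀) (D.cost x.1) :=
    fun _ hx => Feasible.psObjAt_mem_Icc hx hK₀ hK₁ hK₂ p
  obtain ⟨x₀, hx₀, hx₀Q⟩ := hQ.1
  refine ⟨Q, hQ, ?_, fun x hx hxQ => sub_isLeast_mem_Icc_of_isMinOn hP hclose hx (hmin hxQ)⟩
  rw [← hx₀Q]
  exact isLeast_sub_mem_Icc_of_isMinOn hP hclose hx₀ (hmin hx₀Q)

end NearOptimality

end JointDecoding

open JointDecoding in
theorem mainTheorem1 {N M : ℕ} {S E : Type*} [Fintype S] [DecidableEq S]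
    (D : JointDecoding N M S E) (hN : 0 < N)
    (htrellis : D.AcceptsAllInputs)
    (hcheck : ∀ j, (D.checkNbr j).card ≠ 1) :
    ∃ Pstar : ℝ, IsLeast ((fun x => D.cost x.1) '' D.feasibleSet) Pstar ∧
    ∀ δ : ℝ, 0 < δ → ∃ K₀ : ℝ, 0 < K₀ ∧ ∀ K₁ K₂ : ℝ, K₀ ≤ K₁ → K₀ ≤ K₂ →
      -- Problem-PS has a unique optimal solution, and its value is the maximum of Problem-DS
      (∃ (g : Fin N → E → ℝ) (w : Fin M → Finset (Fin N) → ℝ) (Pt : ℝ),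
        (g, w) ∈ D.feasibleSet ∧ D.psObj K₁ K₂ (g, w) = Pt ∧
        (∀ x ∈ D.feasibleSet, x ≠ (g, w) → Pt < D.psObj K₁ K₂ x) ∧
        (∀ p, IsGreatest (Set.range (D.dsObj K₁ K₂ p)) Pt) ∧
        -- the optimal solution is nearly optimal for Problem-P, and the two values are close
        0 ≤ (D.cost g - Pstar) / N ∧ (D.cost g - Pstar) / N ≤ δ ∧
        0 ≤ (Pstar - Pt) / N ∧ (Pstar - Pt) / N ≤ δ ∧
        -- the algorithm converges to the maximum of Problem-DS and yields this solution
        ((∀ i, ((D.bitNbr i).card : ℝ) * K₂ < K₁) →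
          (∀ p, Tendsto (fun l => D.dsObj K₁ K₂ p (D.iter K₁ K₂ l)) atTop (𝓝 Pt)) ∧
          Tendsto (fun l => D.gOf K₂ (D.iter K₁ K₂ l)) atTop (𝓝 g) ∧
          Tendsto (fun l => D.wOf K₁ (D.iter K₁ K₂ l)) atTop (𝓝 w) ∧
          -- without checks of degree two, the messages converge, and finitely many iterations
          -- already give a feasible and nearly optimal point
          ((∀ j, (D.checkNbr j).card ≠ 2) →
            (∃ m, (∀ p, D.dsObj K₁ K₂ p m = Pt) ∧
              Tendsto (fun l => D.iter K₁ K₂ l) atTop (𝓝 m)) ∧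
            ∀ᶠ l in atTop,
              (∃ w', (D.gOf K₂ (D.iter K₁ K₂ l), w') ∈ D.feasibleSet) ∧
              0 ≤ (D.cost (D.gOf K₂ (D.iter K₁ K₂ l)) - Pstar) / N ∧
              (D.cost (D.gOf K₂ (D.iter K₁ K₂ l)) - Pstar) / N ≤ δ))) ∧
      -- the same closeness when only the entropy of one section is kept in Problem-PS
      (∀ p, ∃ Pp : ℝ, IsLeast (D.psObjAt K₁ K₂ p '' D.feasibleSet) Pp ∧
        0 ≤ (Pstar - Pp) / N ∧ (Pstar - Pp) / N ≤ δ ∧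
        ∀ x ∈ D.feasibleSet, D.psObjAt K₁ K₂ p x = Pp →
          0 ≤ (D.cost x.1 - Pstar) / N ∧ (D.cost x.1 - Pstar) / N ≤ δ) := by
  obtain ⟨P, hP⟩ := exists_isLeast_image_feasibleSet htrellis hN hcheck
    (D.continuous_cost.comp continuous_fst)
  refine ⟨P, hP, fun δ hδ => ?_⟩
  obtain ⟨K₀, hK₀, hη⟩ := D.exists_entropyBound_div_lt hδ
  refine ⟨K₀, hK₀, fun K₁ K₂ h₁ h₂ => ?_⟩
  have hK₁ := hK₀.trans_le h₁
  have hK₂ := hK₀.trans_le h₂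
  simp only [D.dsObj_eq_dual, ← and_assoc (a := (0 : ℝ) ≤ _ / _), ← Set.mem_Icc]
  obtain ⟨m, hm⟩ := exists_isStationary htrellis hN hcheck hK₁ hK₂
  have hcost := hm.cost_gOf_sub_mem_Icc htrellis hN hcheck hP hK₀ h₁ h₂
  have hdual := hm.sub_dual_mem_Icc htrellis hN hcheck hP hK₀ h₁ h₂
  refine ⟨⟨D.gOf K₂ m, D.wOf K₁ m, D.dual K₁ K₂ m, hm.feasible htrellis hcheck,
    (hm.dual_eq htrellis hcheck hK₁ hK₂ hN).symm,
    fun x hx => Feasible.dual_lt_psObj htrellis hN hK₁ hK₂ hx,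
    fun _ => hm.isGreatest_range_dual htrellis hN hcheck hK₁ hK₂,
    div_natCast_mem_Icc hN hcost hη.le, div_natCast_mem_Icc hN hdual hη.le,
    fun hK => ⟨fun _ => hm.tendsto_dual_iter htrellis hN hcheck hK₁ hK₂ hK,
      hm.tendsto_gOf_iter htrellis hN hcheck hK₁ hK₂ hK,
      hm.tendsto_wOf_iter htrellis hN hcheck hK₁ hK₂ hK, fun hcheck' => ⟨?_, ?_⟩⟩⟩, fun p => ?_⟩
  · obtain ⟨m', hm', hlim⟩ := hm.exists_tendsto_iter htrellis hN hcheck hcheck' hK₁ hK₂ hK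
    exact ⟨m', fun _ => hm', hlim⟩
  · exact (hm.eventually_cost_gOf_iter_sub_mem_Icc htrellis hN hcheck hcheck' hK₁ hK₂ hK hP
      (hcost.2.trans_lt hη)).mono fun _ h => ⟨h.1, div_natCast_mem_Icc hN h.2 le_rfl⟩
  · obtain ⟨Q, hQ, hval, hopt⟩ := exists_isLeast_psObjAt htrellis hN hcheck hP hK₀ h₁ h₂ p
    exact ⟨Q, hQ, div_natCast_mem_Icc hN hval hη.le,
      fun x hx hxQ => div_natCast_mem_Icc hN (hopt x hx hxQ) hη.le⟩
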